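/- Let $\rho:\mathbb R^3\to\mathbb R$ be radially symmetric, $\rho(x)=\rho_r(|x|)$, of class $C^1$, with $\rho$ and $\nabla\rho$ decaying faster than any power of $|x|$, and put $I=\frac23\int x^2\rho(x)\,dx$. Let $t_1<t_2$. For potentials $\mathcal A=(A_0,A)$, with $A_0(x,t)\in\mathbb R$ and $A(x,t)\in\mathbb R^3$, put $E=-\nabla A_0-\dot A$ and $B=\nabla\wedge A$. Let $\mathcal D$ be the class of potentials which are $C^2$ in $(t,x)\in\mathbb R\times\mathbb R^3$ and whose derivatives in $(t,x)$ of order $k=0,1,2$ are $O((1+|x|)^{-(k+1)})$, uniformly for $t\in[t_1,t_2]$. Let $\mathcal A^{ext}=(A_0^{ext},A^{ext})$ be external potentials of class $C^1$ in $(t,x)$ which, together with their first derivatives, grow at most polynomially in $x$, uniformly for $t\in[t_1,t_2]$, and let $E^{ext},B^{ext}$ be their fields. Let $\mathcal A\in\mathcal D$, and let $q:\mathbb R\to\mathbb R^3$ and $R:\mathbb R\to SO(3)$ be of class $C^2$. Let $\omega(t)\in\mathbb R^3$ be the angular velocity, defined by $\dot R(t)R(t)^{-1}x=\omega(t)\wedge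 x$ for all $x\in\mathbb R^3$. Define the Lagrangian $$L=\frac12\int(E^2-B^2)\,dx+\frac12\dot q^2+\frac12I\omega^2-\int[A_0+A_0^{ext}]\,\rho(x-q)\,dx+\int(\dot q+\omega\wedge(x-q))\cdot[A+A^{ext}]\,\rho(x-q)\,dx$$ and the action $S(\mathcal A,q,R)=\int_{t_1}^{t_2}L\,dt$. Then the following are equivalent. (i) The Maxwell–Lorentz system with spin holds for all $t\in[t_1,t_2]$ and $x\in\mathbb R^3$: $$\dot E=\nabla\wedge B-(\dot q+\omega\wedge(x-q))\rho(x-q),\qquad \dot B=-\nabla\wedge E,$$ $$\nabla\cdot E=\rho(x-q),\qquad \nabla\cdot B=0,$$ $$\ddot q=\int[E+E^{ext}+(\dot q+\omega\wedge(x-q))\wedge(B+B^{ext})]\,\rho(x-q)\,dx,$$ $$I\dot\omega=\int(x-q)\wedge[E+E^{ext}+(\dot q+\omega\wedge(x-q))\wedge(B+B^{ext})]\,\rho(x-q)\,dx.$$ (ii) The Hamilton least action principle $\delta S(\mathcal A,q,R)=0$ holds: for every $\delta\mathcal A\in\mathcal D$ and every $C^2$ function $\delta q:\mathbb R\to\mathbb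 R^3$ which vanish at $t=t_1$ and $t=t_2$, and every family $R_\varepsilon(t)\in SO(3)$, of class $C^2$ in $(\varepsilon,t)\in\mathbb R^2$, with $R_0=R$ and with $R_\varepsilon(t_1)=R(t_1)$, $R_\varepsilon(t_2)=R(t_2)$ for all $\varepsilon$, the derivative $\frac{d}{d\varepsilon}S(\mathcal A+\varepsilon\,\delta\mathcal A,\;q+\varepsilon\,\delta q,\;R_\varepsilon)$ exists at $\varepsilon=0$ and equals $0$. -/

import Mathlib

open MeasureTheory Set

noncomputable section

namespace RotatingCharge

/-- Physical space `ℝ³` with its Euclidean norm. -/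
abbrev Space : Type := EuclideanSpace ℝ (Fin 3)

/-- The rotation group `SO(3)`. -/
abbrev SO3 : Type := Matrix.specialOrthogonalGroup (Fin 3) ℝ

/-! ### Vector calculus on `ℝ³` -/

/-- The vector product `a ∧ b`. -/
def cross (a b : Space) : Space := WithLp.toLp 2 (crossProduct a.ofLp b.ofLp)

/-- The partial derivative `∂ᵢ f`. -/
def partialDeriv (i : Fin 3) (f : Space → ℝ) (x : Space) : ℝ :=
  fderiv ℝ f x (EuclideanSpace.single i 1)

/-- `∇ · V`. -/
def divergence (V : Space → Space) (x : Space) : ℝ :=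
  ∑ i, partialDeriv i (fun y => V y i) x

/-- `∇ ∧ V`. -/
def curl (V : Space → Space) (x : Space) : Space :=
  !₂[partialDeriv 1 (fun y => V y 2) x - partialDeriv 2 (fun y => V y 1) x,
     partialDeriv 2 (fun y => V y 0) x - partialDeriv 0 (fun y => V y 2) x,
     partialDeriv 0 (fun y => V y 1) x - partialDeriv 1 (fun y => V y 0) x]

/-- The time derivative of a time-dependent vector field. -/
def timeDeriv (V : ℝ → Space → Space) (t : ℝ) (x : Space) : Space :=
  deriv (fun s => V s x) t

/-! ### Angular velocity -/

/-- The isomorphism `𝒥` of `ℝ³` with the skew-symmetric matrices, `𝒥 ω x = ω ∧ x`. -/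
def skew (w : Space) : Matrix (Fin 3) (Fin 3) ℝ :=
  !![0, -w 2, w 1; w 2, 0, -w 0; -w 1, w 0, 0]

/-- The inverse `𝒥⁻¹` of `skew`, meaningful on skew-symmetric matrices. -/
def unskew (M : Matrix (Fin 3) (Fin 3) ℝ) : Space := !₂[M 2 1, M 0 2, M 1 0]

/-- The velocity `Ṙ(t)`, as a matrix. -/
def rotationDeriv (R : ℝ → SO3) (t : ℝ) : Matrix (Fin 3) (Fin 3) ℝ :=
  Matrix.of fun i j => deriv (fun s => (R s : Matrix (Fin 3) (Fin 3) ℝ) i j) t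

/-- The angular velocity in space, `ω(t) = 𝒥⁻¹ (Ṙ(t) R(t)⁻¹)`. -/
def angularVelocity (R : ℝ → SO3) (t : ℝ) : Space :=
  unskew (rotationDeriv R t * (R t : Matrix (Fin 3) (Fin 3) ℝ)⁻¹)

theorem skew_unskew {M : Matrix (Fin 3) (Fin 3) ℝ} (hM : M.transpose = -M) :
    skew (unskew M) = M := by
  have h : ∀ i j, M j i = -M i j := fun i j => congrFun (congrFun hM i) j
  ext i j
  have h00 := h 0 0; have h11 := h 1 1; have h22 := h 2 2
  have h01 := h 0 1; have h02 := h 0 2; have h12 := h 1 2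
  fin_cases i <;> fin_cases j <;> simp [skew, unskew] <;> linarith

/-- The defining relation `Ṙ R⁻¹ = 𝒥 ω`. -/
theorem skew_angularVelocity (R : ℝ → SO3) (t : ℝ)
    (hR : ∀ i j, DifferentiableAt ℝ (fun s => (R s : Matrix (Fin 3) (Fin 3) ℝ) i j) t) :
    skew (angularVelocity R t)
      = rotationDeriv R t * (R t : Matrix (Fin 3) (Fin 3) ℝ)⁻¹ := by
  have horth : ∀ s, (R s : Matrix (Fin 3) (Fin 3) ℝ)
      * (R s : Matrix (Fin 3) (Fin 3) ℝ).transpose = 1 := fun s =>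
    Matrix.mem_orthogonalGroup_iff (Fin 3) ℝ |>.1
      (Matrix.mem_specialOrthogonalGroup_iff.1 (R s).2).1
  have hinv : (R t : Matrix (Fin 3) (Fin 3) ℝ)⁻¹
      = (R t : Matrix (Fin 3) (Fin 3) ℝ).transpose := Matrix.inv_eq_right_inv (horth t)
  apply skew_unskew
  rw [hinv]
  ext i j
  have h1 : ∀ s, ∑ k, (R s : Matrix (Fin 3) (Fin 3) ℝ) i k
      * (R s : Matrix (Fin 3) (Fin 3) ℝ) j k = (1 : Matrix (Fin 3) (Fin 3) ℝ) i j := by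
    intro s
    rw [← horth s]
    simp [Matrix.mul_apply]
  have h2 : HasDerivAt (fun s => ∑ k, (R s : Matrix (Fin 3) (Fin 3) ℝ) i k
      * (R s : Matrix (Fin 3) (Fin 3) ℝ) j k)
      (∑ k, (rotationDeriv R t i k * (R t : Matrix (Fin 3) (Fin 3) ℝ) j k
        + (R t : Matrix (Fin 3) (Fin 3) ℝ) i k * rotationDeriv R t j k)) t :=
    HasDerivAt.fun_sum fun k _ => (hR i k).hasDerivAt.mul (hR j k).hasDerivAt
  simp only [h1] at h2
  have h3 := h2.unique (hasDerivAt_const t _)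
  simp only [Finset.sum_add_distrib] at h3
  simp only [Matrix.transpose_apply, Matrix.neg_apply, Matrix.mul_apply]
  have h4 : ∑ k, (R t : Matrix (Fin 3) (Fin 3) ℝ) i k * rotationDeriv R t j k
      = ∑ k, rotationDeriv R t j k * (R t : Matrix (Fin 3) (Fin 3) ℝ) i k :=
    Finset.sum_congr rfl fun k _ => mul_comm _ _
  linarith

/-! ### The charge -/

/-- The standing assumption on the coupling function: `ρ` is radially symmetric, `C¹`, and
`ρ` and its first derivatives decay faster than any power of `|x|`. -/
structure IsChargeDensity (ρ : Space → ℝ) : Prop where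
  radial : ∃ ρr : ℝ → ℝ, ∀ x, ρ x = ρr ‖x‖
  contDiff : ContDiff ℝ 1 ρ
  decay : ∀ k ≤ 1, ∀ N : ℕ, ∃ C : ℝ, ∀ x,
    ‖iteratedFDeriv ℝ k ρ x‖ ≤ C / (1 + ‖x‖) ^ N

/-- The moment of inertia `I = (2/3) ∫ x² ρ(x) dx`. -/
def momentOfInertia (ρ : Space → ℝ) : ℝ := 2 / 3 * ∫ x, ‖x‖ ^ 2 * ρ x

/-! ### Potentials and fields -/

/-- Time-dependent electromagnetic potentials `𝒜 = (A₀, A)`. -/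
structure Potentials where
  A₀ : ℝ → Space → ℝ
  A : ℝ → Space → Space

/-- `E = -∇A₀ - Ȧ`. -/
def Potentials.E (𝒜 : Potentials) (t : ℝ) (x : Space) : Space :=
  -gradient (𝒜.A₀ t) x - timeDeriv 𝒜.A t x

/-- `B = ∇ ∧ A`. -/
def Potentials.B (𝒜 : Potentials) (t : ℝ) (x : Space) : Space := curl (𝒜.A t) x

/-- `f` is of class `C²` in `(t, x)`, and on the time interval `[t₁, t₂]` its derivatives of
order `k ≤ 2` are `O(|x|^{-(k+1)})`, uniformly in time. This is the decay of the Coulomb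
potential of a charge with nonzero total charge. -/
def SmoothDecaying {F : Type} [NormedAddCommGroup F] [NormedSpace ℝ F]
    (t₁ t₂ : ℝ) (f : ℝ → Space → F) : Prop :=
  ContDiff ℝ 2 (fun p : ℝ × Space => f p.1 p.2) ∧
  ∃ C : ℝ, ∀ k ≤ 2, ∀ t ∈ Icc t₁ t₂, ∀ x,
    ‖iteratedFDeriv ℝ k (fun p : ℝ × Space => f p.1 p.2) (t, x)‖ ≤ C / (1 + ‖x‖) ^ (k + 1)

/-- `f` is of class `C¹` in `(t, x)`, and on the time interval `[t₁, t₂]` it grows, with its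
first derivatives, at most polynomially in `x`, uniformly in time. -/
def SmoothModerate {F : Type} [NormedAddCommGroup F] [NormedSpace ℝ F]
    (t₁ t₂ : ℝ) (f : ℝ → Space → F) : Prop :=
  ContDiff ℝ 1 (fun p : ℝ × Space => f p.1 p.2) ∧
  ∃ (C : ℝ) (N : ℕ), ∀ k ≤ 1, ∀ t ∈ Icc t₁ t₂, ∀ x,
    ‖iteratedFDeriv ℝ k (fun p : ℝ × Space => f p.1 p.2) (t, x)‖ ≤ C * (1 + ‖x‖) ^ N

/-- The class of potentials of the field, and of their variations. -/
structure Potentials.Decaying (t₁ t₂ : ℝ) (𝒜 : Potentials) : Prop where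
  scalar : SmoothDecaying t₁ t₂ 𝒜.A₀
  vector : SmoothDecaying t₁ t₂ 𝒜.A

/-- The class of external potentials. -/
structure Potentials.Moderate (t₁ t₂ : ℝ) (𝒜 : Potentials) : Prop where
  scalar : SmoothModerate t₁ t₂ 𝒜.A₀
  vector : SmoothModerate t₁ t₂ 𝒜.A

/-! ### The Maxwell-Lorentz system -/

/-- The velocity `q̇ + ω ∧ (x - q)` of the point of the body which is at `x` at time `t`. -/
def bodyVelocity (q : ℝ → Space) (R : ℝ → SO3) (t : ℝ) (x : Space) : Space :=
  deriv q t + cross (angularVelocity R t) (x - q t)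

/-- The Maxwell-Lorentz system with spin, on the time interval `[t₁, t₂]`, for the fields
`E, B`, the position `q` and the rotation `R`, in the external fields `Eext, Bext`. -/
structure MaxwellLorentzSystem (ρ : Space → ℝ) (Eext Bext : ℝ → Space → Space) (t₁ t₂ : ℝ)
    (E B : ℝ → Space → Space) (q : ℝ → Space) (R : ℝ → SO3) : Prop where
  electric : ∀ t ∈ Icc t₁ t₂, ∀ x,
    timeDeriv E t x = curl (B t) x - ρ (x - q t) • bodyVelocity q R t x
  magnetic : ∀ t ∈ Icc t₁ t₂, ∀ x, timeDeriv B t x = -curl (E t) x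
  div_electric : ∀ t ∈ Icc t₁ t₂, ∀ x, divergence (E t) x = ρ (x - q t)
  div_magnetic : ∀ t ∈ Icc t₁ t₂, ∀ x, divergence (B t) x = 0
  force : ∀ t ∈ Icc t₁ t₂,
    deriv (deriv q) t = ∫ x, ρ (x - q t) •
      (E t x + Eext t x + cross (bodyVelocity q R t x) (B t x + Bext t x))
  torque : ∀ t ∈ Icc t₁ t₂,
    momentOfInertia ρ • deriv (angularVelocity R) t = ∫ x, ρ (x - q t) •
      cross (x - q t) (E t x + Eext t x + cross (bodyVelocity q R t x) (B t x + Bext t x))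

/-! ### The action -/

/-- The Lagrangian `L(𝒜, q, R, 𝒜̇, q̇, Ṙ)` as a function of the instantaneous potentials
`A₀, A`, position, rotation and velocities; it does not involve the velocity of `A₀`.
`A₀ext, Aext` are the external potentials at that instant, and `ω = 𝒥⁻¹ (Ṙ R⁻¹)`. -/
def lagrangian (ρ : Space → ℝ) (A₀ext : Space → ℝ) (Aext : Space → Space)
    (A₀ : Space → ℝ) (A : Space → Space) (q : Space) (R : Matrix (Fin 3) (Fin 3) ℝ)
    (Adot : Space → Space) (qdot : Space) (Rdot : Matrix (Fin 3) (Fin 3) ℝ) : ℝ :=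
  1 / 2 * (∫ x, (‖-gradient A₀ x - Adot x‖ ^ 2 - ‖curl A x‖ ^ 2))
    + 1 / 2 * ‖qdot‖ ^ 2
    + 1 / 2 * momentOfInertia ρ * ‖unskew (Rdot * R⁻¹)‖ ^ 2
    - (∫ x, (A₀ x + A₀ext x) * ρ (x - q))
    + ∫ x, inner ℝ (qdot + cross (unskew (Rdot * R⁻¹)) (x - q)) (A x + Aext x) * ρ (x - q)

/-- The action functional `S(𝒜, q, R)`, the integral of the Lagrangian over `[t₁, t₂]`. -/
def action (ρ : Space → ℝ) (𝒜ext : Potentials) (t₁ t₂ : ℝ)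
    (𝒜 : Potentials) (q : ℝ → Space) (R : ℝ → SO3) : ℝ :=
  ∫ t in t₁..t₂, lagrangian ρ (𝒜ext.A₀ t) (𝒜ext.A t)
    (𝒜.A₀ t) (𝒜.A t) (q t) (R t) (timeDeriv 𝒜.A t) (deriv q t) (rotationDeriv R t)

/-- The varied potentials `𝒜 + ε δ𝒜`. -/
def Potentials.vary (𝒜 δ𝒜 : Potentials) (ε : ℝ) : Potentials where
  A₀ t x := 𝒜.A₀ t x + ε * δ𝒜.A₀ t x
  A t x := 𝒜.A t x + ε • δ𝒜.A t x

/-- A `C²` path in `SO(3)`. -/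
def SmoothPath (R : ℝ → SO3) : Prop :=
  ∀ i j, ContDiff ℝ 2 (fun t => (R t : Matrix (Fin 3) (Fin 3) ℝ) i j)

/-- A variation `(ε, t) ↦ Rv ε t` in `SO(3)` of the path `R` over `[t₁, t₂]`: a `C²` family of
paths which is `R` at `ε = 0` and has the same end points as `R`. -/
structure IsRotationVariation (t₁ t₂ : ℝ) (R : ℝ → SO3) (Rv : ℝ → ℝ → SO3) : Prop where
  contDiff : ∀ i j,
    ContDiff ℝ 2 (fun p : ℝ × ℝ => (Rv p.1 p.2 : Matrix (Fin 3) (Fin 3) ℝ) i j)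
  at_zero : ∀ t, Rv 0 t = R t
  left_end : ∀ ε, Rv ε t₁ = R t₁
  right_end : ∀ ε, Rv ε t₂ = R t₂

/-- The Hamilton least action principle `δS(𝒜, q, R) = 0`: for all simultaneous variations of
`𝒜`, `q` and `R` which vanish at `t₁` and `t₂`, the derivative of the action along the
variation exists and is zero. -/
def LeastActionPrinciple (ρ : Space → ℝ) (𝒜ext : Potentials) (t₁ t₂ : ℝ)
    (𝒜 : Potentials) (q : ℝ → Space) (R : ℝ → SO3) : Prop :=
  ∀ (δ𝒜 : Potentials) (δq : ℝ → Space) (Rv : ℝ → ℝ → SO3),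
    δ𝒜.Decaying t₁ t₂ → ContDiff ℝ 2 δq →
    (∀ x, δ𝒜.A₀ t₁ x = 0 ∧ δ𝒜.A t₁ x = 0 ∧ δ𝒜.A₀ t₂ x = 0 ∧ δ𝒜.A t₂ x = 0) →
    δq t₁ = 0 → δq t₂ = 0 →
    IsRotationVariation t₁ t₂ R Rv →
    HasDerivAt
      (fun ε : ℝ => action ρ 𝒜ext t₁ t₂ (𝒜.vary δ𝒜 ε) (fun t => q t + ε • δq t) (Rv ε)) 0 0

end RotatingCharge

end

open RotatingCharge

noncomputable section

namespace RotatingCharge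

/-! ### Integrals over space -/

/-! The proof computes the first variation of the action in closed form and reads the equations off
its coefficients. `hasDerivAt_action` shows that along any admissible variation the derivative at `ε
= 0` exists and equals `∫ dt [ ∫ (G δA₀ + K · δA) dx + δq · F + φ · T ]`, where `G`, `K`, `F`, `T`
are the defects in Gauss's law, Ampère's law, the force balance and the torque balance, and `φ =
𝒥⁻¹(∂_ε R R⁻¹)` is the infinitesimal rotation. The two homogeneous Maxwell equations hold for any
potentials, so the Maxwell-Lorentz system says exactly that the four defects vanish on `[t₁, t₂]`
(`maxwellLorentzSystem_iff`). One implication is then immediate; the other is the fundamental lemma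
of the calculus of variations, with test variations of `A₀`, of one component of `A`, of one
component of `q`, and with a rotation about one coordinate axis.

Field part. The action is quadratic in the potentials, and the linear term is integrated by parts.
The boundary terms are products of a field, `O(|x|⁻²)`, and a potential, `O(|x|⁻¹)`. Such a product
is in general not integrable over space, but its flux through large spheres tends to zero: this is
`integral_fderiv_apply_eq_zero`. In time, `integral_integral_timeDeriv_eq_zero` plays the same role,
through Fubini.

Particle part. After the substitution `x = q + y` the coupling depends on the motion only through
the averages of `A₀`, `A` and `y ∧ A` with weight `ρ`, which are `C¹` functions of `(t, q)`.
Integrating by parts in time requires `δω = φ̇ + φ ∧ ω` (`angularVelocity_variation`), which comes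
from the structure equation of `SO(3)`.

The Euler-Lagrange force and torque obtained this way are not literally the Lorentz ones. The
integrands differ by infinitesimal rotations of functions, weighted by `ρ`, and these integrate to
zero because `ρ` is radial (`IsChargeDensity.integral_rotation_eq_zero`). For the torque the
remaining terms cancel by the Jacobi identity. See `hasSpaceIntegral_force` and
`hasSpaceIntegral_torque`. -/

theorem integrable_div_one_add_norm_pow (C : ℝ) :
    Integrable (fun x : Space => C / (1 + ‖x‖) ^ 4) := by
  have h : Integrable (fun x : Space => (1 + ‖x‖) ^ (-(4 : ℝ))) :=
    integrable_one_add_norm (by simp; norm_num)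
  refine (h.const_mul C).congr (Filter.Eventually.of_forall fun x => ?_)
  have hx : 0 ≤ 1 + ‖x‖ := by positivity
  simp only [Real.rpow_neg hx, div_eq_mul_inv]
  norm_cast

theorem integrable_of_norm_le {F : Type*} [NormedAddCommGroup F] {f : Space → F}
    (hf : Continuous f) {C : ℝ} (hC : ∀ x, ‖f x‖ ≤ C / (1 + ‖x‖) ^ 4) : Integrable f :=
  (integrable_div_one_add_norm_pow C).mono' hf.aestronglyMeasurable
    (Filter.Eventually.of_forall hC)

theorem hasFDerivAt_inv_one_add_mul_norm_sq {a : ℝ} (ha : 0 < a) (x : Space) :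
    HasFDerivAt (fun x : Space => (1 + a * ‖x‖ ^ 2)⁻¹)
      (-((1 + a * ‖x‖ ^ 2) ^ 2)⁻¹ • (a • (2 • innerSL ℝ x))) x := by
  have h1 : HasFDerivAt (fun x : Space => 1 + a * ‖x‖ ^ 2) (a • (2 • innerSL ℝ x)) x :=
    ((hasStrictFDerivAt_norm_sq x).hasFDerivAt.const_mul a).const_add 1
  have h2 : 1 + a * ‖x‖ ^ 2 ≠ 0 := by positivity
  exact (hasDerivAt_inv h2).comp_hasFDerivAt x h1

/-- The integral of a partial derivative vanishes, under decay conditions which do not make the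
function itself integrable. -/
theorem integral_fderiv_apply_eq_zero {f : Space → ℝ} (hf : ContDiff ℝ 1 f) {C : ℝ} {v : Space}
    (h0 : ∀ x, |f x| ≤ C / (1 + ‖x‖) ^ 3) (h1 : ∀ x, |fderiv ℝ f x v| ≤ C / (1 + ‖x‖) ^ 4) :
    ∫ x, fderiv ℝ f x v = 0 := by
  have hC : 0 ≤ C := by simpa using (abs_nonneg _).trans (h0 0)
  have hdf : Continuous fun x => fderiv ℝ f x v :=
    (hf.continuous_fderiv one_ne_zero).clm_apply continuous_const
  -- The bound `O(|x|⁻³)` does not make `f` integrable on `ℝ³`, so the integration by parts is done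
  -- against cutoffs `w n`, which increase to `1` as `a n → 0`.
  set a : ℕ → ℝ := fun n => 1 / ((n : ℝ) + 1) with ha
  have ha0 : ∀ n, 0 < a n := fun n => by positivity
  have ha1 : ∀ n, a n ≤ 1 := fun n => by
    rw [ha]; simp only
    rw [div_le_one (by positivity)]
    linarith [Nat.cast_nonneg (α := ℝ) n]
  have halim : Filter.Tendsto a Filter.atTop (nhds 0) := tendsto_one_div_add_atTop_nhds_zero_nat
  set w : ℕ → Space → ℝ := fun n x => (1 + a n * ‖x‖ ^ 2)⁻¹ with hw
  have hwd : ∀ n x, HasFDerivAt (w n)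
      (-((1 + a n * ‖x‖ ^ 2) ^ 2)⁻¹ • (a n • (2 • innerSL ℝ x))) x :=
    fun n x => hasFDerivAt_inv_one_add_mul_norm_sq (ha0 n) x
  have hwv : ∀ n x, fderiv ℝ (w n) x v
      = -((1 + a n * ‖x‖ ^ 2) ^ 2)⁻¹ * (a n * (2 * inner ℝ x v)) := fun n x => by
    rw [(hwd n x).fderiv]; simp
  have hpos : ∀ n (x : Space), 0 < 1 + a n * ‖x‖ ^ 2 := fun n x => by
    have := ha0 n; positivity
  have hw1 : ∀ n x, |w n x| ≤ 1 := fun n x => by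
    rw [abs_of_pos (inv_pos.2 (hpos n x))]
    exact inv_le_one_of_one_le₀ (by have := ha0 n; nlinarith [sq_nonneg ‖x‖])
  have hwc : ∀ n, Continuous (w n) := fun n =>
    (continuous_const.add (continuous_const.mul (continuous_norm.pow 2))).inv₀
      fun x => (hpos n x).ne'
  have hwvc : ∀ n, Continuous fun x => fderiv ℝ (w n) x v := fun n => by
    simp only [hwv]
    refine Continuous.mul (Continuous.neg (Continuous.inv₀ (by fun_prop) fun x => ?_))
      (by fun_prop)
    exact (pow_pos (hpos n x) 2).ne'
  have hwvb : ∀ n x, |fderiv ℝ (w n) x v| ≤ 4 * ‖v‖ / (1 + ‖x‖) := fun n x => by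
    rw [hwv, abs_mul, abs_neg, abs_of_pos (inv_pos.2 (pow_pos (hpos n x) 2)), abs_mul,
      abs_of_pos (ha0 n), abs_mul, abs_of_pos (by norm_num : (0 : ℝ) < 2), le_div_iff₀ (by positivity),
      inv_mul_eq_div, div_mul_eq_mul_div, div_le_iff₀ (pow_pos (hpos n x) 2)]
    have h3 : |inner ℝ x v| ≤ ‖x‖ * ‖v‖ := abs_real_inner_le_norm x v
    -- This makes the bound on the gradient of the cutoff uniform in `n`: it supplies the fourth
    -- power of decay that the product with `f` needs for a common integrable majorant.
    have h4 : a n * ‖x‖ * (1 + ‖x‖) ≤ 2 * (1 + a n * ‖x‖ ^ 2) ^ 2 := by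
      have := ha0 n; have := ha1 n
      have h5 : 0 ≤ a n * ‖x‖ ^ 2 := by positivity
      nlinarith [sq_nonneg (‖x‖ - 1), norm_nonneg x, mul_nonneg (ha0 n).le (sq_nonneg (‖x‖ - 1)),
        sq_nonneg (a n * ‖x‖ ^ 2)]
    have h6 : a n * (2 * |inner ℝ x v|) * (1 + ‖x‖) ≤ a n * (2 * (‖x‖ * ‖v‖)) * (1 + ‖x‖) := by
      have := (ha0 n).le
      gcongr
    nlinarith [mul_le_mul_of_nonneg_right h4 (norm_nonneg v)]
  have hbound : ∀ n x, |f x * fderiv ℝ (w n) x v| ≤ C * (4 * ‖v‖) / (1 + ‖x‖) ^ 4 := fun n x => by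
    rw [abs_mul]
    calc _ ≤ C / (1 + ‖x‖) ^ 3 * (4 * ‖v‖ / (1 + ‖x‖)) :=
          mul_le_mul (h0 x) (hwvb n x) (abs_nonneg _) (by positivity)
      _ = _ := by rw [div_mul_div_comm, ← pow_succ]
  have hbound' : ∀ n x, |fderiv ℝ f x v * w n x| ≤ C / (1 + ‖x‖) ^ 4 := fun n x => by
    rw [abs_mul]
    calc _ ≤ C / (1 + ‖x‖) ^ 4 * 1 :=
          mul_le_mul (h1 x) (hw1 n x) (abs_nonneg _) (by positivity)
      _ = _ := mul_one _
  have hparts : ∀ n, ∫ x, f x * fderiv ℝ (w n) x v = -∫ x, fderiv ℝ f x v * w n x := fun n => by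
    refine integral_mul_fderiv_eq_neg_fderiv_mul_of_integrable
      (integrable_of_norm_le (hdf.mul (hwc n)) (hbound' n))
      (integrable_of_norm_le (hf.continuous.mul (hwvc n)) (hbound n))
      (integrable_of_norm_le (C := C * (2 / a n)) (hf.continuous.mul (hwc n)) fun x => ?_)
      (fun x _ => hf.differentiable one_ne_zero x) (fun x _ => (hwd n x).differentiableAt)
    -- This constant blows up with `n`, which is harmless: it only serves the integrability of `f *
    -- w n` for each fixed `n`.
    have h2 : |w n x| ≤ 2 / a n / (1 + ‖x‖) := by
      rw [abs_of_pos (inv_pos.2 (hpos n x)), div_div, inv_eq_one_div,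
        div_le_div_iff₀ (hpos n x) (by have := ha0 n; positivity)]
      have := ha0 n; have := ha1 n
      nlinarith [sq_nonneg (‖x‖ - 1), norm_nonneg x, mul_nonneg (ha0 n).le (sq_nonneg (‖x‖ - 1))]
    rw [Real.norm_eq_abs, abs_mul]
    calc _ ≤ C / (1 + ‖x‖) ^ 3 * (2 / a n / (1 + ‖x‖)) :=
          mul_le_mul (h0 x) h2 (abs_nonneg _) (by positivity)
      _ = _ := by rw [div_mul_div_comm, ← pow_succ]
  -- The term containing the gradient of the cutoff disappears in the limit, while the other term
  -- converges to the integral sought.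
  have hl : Filter.Tendsto (fun n => ∫ x, f x * fderiv ℝ (w n) x v) Filter.atTop
      (nhds (∫ _ : Space, (0 : ℝ))) := by
    refine tendsto_integral_of_dominated_convergence _
      (fun n => (hf.continuous.mul (hwvc n)).aestronglyMeasurable)
      (integrable_div_one_add_norm_pow (C * (4 * ‖v‖)))
      (fun n => Filter.Eventually.of_forall (hbound n)) (Filter.Eventually.of_forall fun x => ?_)
    have h3 : ContinuousAt
        (fun b : ℝ => f x * (-((1 + b * ‖x‖ ^ 2) ^ 2)⁻¹ * (b * (2 * inner ℝ x v)))) 0 := by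
      refine continuousAt_const.mul (ContinuousAt.mul (ContinuousAt.neg
        (ContinuousAt.inv₀ (by fun_prop) (by simp))) (by fun_prop))
    have h4 := h3.tendsto.comp halim
    simpa [Function.comp_def, hwv] using h4
  have hr : Filter.Tendsto (fun n => ∫ x, fderiv ℝ f x v * w n x) Filter.atTop
      (nhds (∫ x, fderiv ℝ f x v)) := by
    refine tendsto_integral_of_dominated_convergence _
      (fun n => (hdf.mul (hwc n)).aestronglyMeasurable)
      (integrable_div_one_add_norm_pow C)
      (fun n => Filter.Eventually.of_forall (hbound' n)) (Filter.Eventually.of_forall fun x => ?_)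
    have h3 : ContinuousAt (fun b : ℝ => fderiv ℝ f x v * (1 + b * ‖x‖ ^ 2)⁻¹) 0 :=
      continuousAt_const.mul (ContinuousAt.inv₀ (by fun_prop) (by simp))
    have h4 := h3.tendsto.comp halim
    simpa [Function.comp_def] using h4
  have := tendsto_nhds_unique hl (by simpa only [hparts] using hr.neg)
  simp only [integral_zero] at this
  linarith

/-- A spatial integral depends continuously on time. -/
theorem continuousOn_integral_space {F : Type*} [NormedAddCommGroup F] [NormedSpace ℝ F]
    {t₁ t₂ C : ℝ} {g : ℝ × Space → F} (hg : Continuous g)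
    (hC : ∀ t ∈ Icc t₁ t₂, ∀ x, ‖g (t, x)‖ ≤ C / (1 + ‖x‖) ^ 4) :
    ContinuousOn (fun t => ∫ x, g (t, x)) (Icc t₁ t₂) :=
  continuousOn_of_dominated (bound := fun x => C / (1 + ‖x‖) ^ 4)
    (fun t _ => (by fun_prop : Continuous fun x => g (t, x)).aestronglyMeasurable)
    (fun t ht => Filter.Eventually.of_forall (hC t ht)) (integrable_div_one_add_norm_pow C)
    (Filter.Eventually.of_forall fun x =>
      (by fun_prop : Continuous fun t => g (t, x)).continuousOn)

/-- The space-time integral of the time derivative of a function with equal values at the initial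
and final times vanishes. -/
theorem integral_integral_timeDeriv_eq_zero {t₁ t₂ C : ℝ} (ht : t₁ ≤ t₂) {g : ℝ × Space → ℝ}
    (hg : ContDiff ℝ 1 g)
    (hC : ∀ t ∈ Icc t₁ t₂, ∀ x, |fderiv ℝ g (t, x) (1, 0)| ≤ C / (1 + ‖x‖) ^ 4)
    (hends : ∀ x, g (t₁, x) = g (t₂, x)) :
    ∫ t in t₁..t₂, ∫ x, fderiv ℝ g (t, x) (1, 0) = 0 := by
  have hc : Continuous fun p => fderiv ℝ g p (1, 0) :=
    (hg.continuous_fderiv one_ne_zero).clm_apply continuous_const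
  -- After Fubini the fundamental theorem of calculus acts at each fixed `x`. The spatial integral
  -- of `g` itself, which may diverge, never appears.
  rw [intervalIntegral.integral_of_le ht, integral_integral_swap]
  · rw [← integral_zero Space ℝ]
    congr 1
    ext x
    rw [← intervalIntegral.integral_of_le ht,
      intervalIntegral.integral_eq_sub_of_hasDerivAt (f := fun t => g (t, x)), hends, sub_self]
    · intro t _
      have h1 : HasDerivAt (fun t : ℝ => (t, x)) ((1 : ℝ), (0 : Space)) t :=
        (hasDerivAt_id t).prodMk (hasDerivAt_const t x)
      exact ((hg.differentiable one_ne_zero (t, x)).hasFDerivAt.comp_hasDerivAt t h1)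
    · exact (by fun_prop : Continuous fun t => fderiv ℝ g (t, x) (1, 0)).intervalIntegrable _ _
  · have h2 : Integrable (fun p : ℝ × Space => (1 : ℝ) * (C / (1 + ‖p.2‖) ^ 4))
        ((volume.restrict (Ioc t₁ t₂)).prod volume) :=
      Integrable.mul_prod (f := fun _ : ℝ => (1 : ℝ)) (g := fun x : Space => C / (1 + ‖x‖) ^ 4)
        (integrable_const _) (integrable_div_one_add_norm_pow C)
    refine h2.mono' hc.aestronglyMeasurable ?_
    have h3 : ∀ᵐ p : ℝ × Space ∂((volume.restrict (Ioc t₁ t₂)).prod volume), p.1 ∈ Ioc t₁ t₂ := by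
      have : (volume.restrict (Ioc t₁ t₂)).prod (volume : Measure Space)
          = (volume.prod volume).restrict (Ioc t₁ t₂ ×ˢ univ) := by
        rw [← Measure.prod_restrict, Measure.restrict_univ]
      rw [this]
      filter_upwards [ae_restrict_mem (measurableSet_Ioc.prod MeasurableSet.univ)] with p hp
      exact hp.1
    filter_upwards [h3] with p hp
    exact (hC p.1 (Ioc_subset_Icc_self hp) p.2).trans_eq (one_mul _).symm

/-! ### Directional derivatives on space-time -/

/-- The derivative of `f` in the direction `v` of space-time. -/
def dirDeriv (v : ℝ × Space) (f : ℝ × Space → ℝ) (p : ℝ × Space) : ℝ := fderiv ℝ f p v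

/-- The direction of time. -/
def timeDir : ℝ × Space := (1, 0)

/-- The direction of the `i`-th space coordinate. -/
def spaceDir (i : Fin 3) : ℝ × Space := (0, EuclideanSpace.single i 1)

theorem dirDeriv_add {v p : ℝ × Space} {f g : ℝ × Space → ℝ} (hf : DifferentiableAt ℝ f p)
    (hg : DifferentiableAt ℝ g p) :
    dirDeriv v (fun p => f p + g p) p = dirDeriv v f p + dirDeriv v g p := by
  simp [dirDeriv, fderiv_fun_add hf hg]

theorem dirDeriv_sub {v p : ℝ × Space} {f g : ℝ × Space → ℝ} (hf : DifferentiableAt ℝ f p)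
    (hg : DifferentiableAt ℝ g p) :
    dirDeriv v (fun p => f p - g p) p = dirDeriv v f p - dirDeriv v g p := by
  simp [dirDeriv, fderiv_fun_sub hf hg]

theorem dirDeriv_neg {v p : ℝ × Space} {f : ℝ × Space → ℝ} :
    dirDeriv v (fun p => -f p) p = -dirDeriv v f p := by
  simp [dirDeriv]

theorem dirDeriv_mul {v p : ℝ × Space} {f g : ℝ × Space → ℝ} (hf : DifferentiableAt ℝ f p)
    (hg : DifferentiableAt ℝ g p) :
    dirDeriv v (fun p => f p * g p) p = dirDeriv v f p * g p + f p * dirDeriv v g p := by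
  simp [dirDeriv, fderiv_fun_mul hf hg]; ring

theorem dirDeriv_const_mul {v p : ℝ × Space} {f : ℝ × Space → ℝ} (hf : DifferentiableAt ℝ f p)
    (c : ℝ) : dirDeriv v (fun p => c * f p) p = c * dirDeriv v f p := by
  simp [dirDeriv, fderiv_const_mul hf]

theorem dirDeriv_comm {f : ℝ × Space → ℝ} (hf : ContDiff ℝ 2 f) (v w p : ℝ × Space) :
    dirDeriv v (dirDeriv w f) p = dirDeriv w (dirDeriv v f) p := by
  have h1 : Differentiable ℝ (fderiv ℝ f) :=
    (hf.fderiv_right (m := 1) (by norm_num)).differentiable one_ne_zero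
  have h2 : ∀ v w, dirDeriv v (dirDeriv w f) p = fderiv ℝ (fderiv ℝ f) p v w := fun v w => by
    change fderiv ℝ (fun p => fderiv ℝ f p w) p v = _
    rw [fderiv_clm_apply (h1 p) (differentiableAt_const w)]
    simp
  rw [h2, h2]
  exact (hf.contDiffAt.isSymmSndFDerivAt (by simp)) v w

theorem contDiff_dirDeriv {n : ℕ} {f : ℝ × Space → ℝ} (hf : ContDiff ℝ (n + 1) f)
    (v : ℝ × Space) : ContDiff ℝ n (dirDeriv v f) :=
  (hf.fderiv_right le_rfl).clm_apply contDiff_const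

theorem continuous_dirDeriv {f : ℝ × Space → ℝ} (hf : ContDiff ℝ 1 f) (v : ℝ × Space) :
    Continuous (dirDeriv v f) :=
  (hf.continuous_fderiv one_ne_zero).clm_apply continuous_const

theorem hasFDerivAt_slice {F : Type*} [NormedAddCommGroup F] [NormedSpace ℝ F]
    {f : ℝ × Space → F} {t : ℝ} {x : Space}
    (hf : DifferentiableAt ℝ f (t, x)) :
    HasFDerivAt (fun y => f (t, y)) ((fderiv ℝ f (t, x)).comp (ContinuousLinearMap.inr ℝ ℝ Space))
      x :=
  hf.hasFDerivAt.comp x (hasFDerivAt_prodMk_right t x)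

theorem partialDeriv_slice {f : ℝ × Space → ℝ} {t : ℝ} {x : Space}
    (hf : DifferentiableAt ℝ f (t, x)) (i : Fin 3) :
    partialDeriv i (fun y => f (t, y)) x = dirDeriv (spaceDir i) f (t, x) := by
  simp [partialDeriv, (hasFDerivAt_slice hf).fderiv, dirDeriv, spaceDir]

theorem hasDerivAt_time {F : Type*} [NormedAddCommGroup F] [NormedSpace ℝ F]
    {f : ℝ × Space → F} {t : ℝ} {x : Space}
    (hf : DifferentiableAt ℝ f (t, x)) :
    HasDerivAt (fun s => f (s, x)) (fderiv ℝ f (t, x) timeDir) t :=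
  hf.hasFDerivAt.comp_hasDerivAt t ((hasDerivAt_id t).prodMk (hasDerivAt_const t x))

theorem gradient_slice_apply {f : ℝ × Space → ℝ} {t : ℝ} {x : Space}
    (hf : DifferentiableAt ℝ f (t, x)) (i : Fin 3) :
    gradient (fun y => f (t, y)) x i = dirDeriv (spaceDir i) f (t, x) := by
  rw [← partialDeriv_slice hf, partialDeriv, ← toDual_gradient,
    InnerProductSpace.toDual_apply_apply, EuclideanSpace.inner_single_right]
  simp

theorem timeDeriv_apply {V : ℝ → Space → Space} {t : ℝ} {x : Space}
    (hV : ∀ i, DifferentiableAt ℝ (fun p : ℝ × Space => V p.1 p.2 i) (t, x)) (i : Fin 3) :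
    timeDeriv V t x i = dirDeriv timeDir (fun p => V p.1 p.2 i) (t, x) := by
  have h1 : DifferentiableAt ℝ (fun p : ℝ × Space => V p.1 p.2) (t, x) :=
    differentiableAt_euclidean.2 hV
  have h2 := hasDerivAt_time h1
  have h3 : HasDerivAt (fun s => V s x i) (fderiv ℝ (fun p => V p.1 p.2) (t, x) timeDir i) t :=
    (EuclideanSpace.proj (𝕜 := ℝ) i).hasFDerivAt.comp_hasDerivAt t h2
  rw [timeDeriv, h2.deriv, ← h3.deriv]
  exact (hasDerivAt_time (hV i)).deriv

/-- The components of the curl, as functions on space-time. -/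
def curlComp (V : Fin 3 → ℝ × Space → ℝ) : Fin 3 → ℝ × Space → ℝ :=
  ![fun p => dirDeriv (spaceDir 1) (V 2) p - dirDeriv (spaceDir 2) (V 1) p,
    fun p => dirDeriv (spaceDir 2) (V 0) p - dirDeriv (spaceDir 0) (V 2) p,
    fun p => dirDeriv (spaceDir 0) (V 1) p - dirDeriv (spaceDir 1) (V 0) p]

/-- Indices in `Fin 3` add modulo 3, so a single cyclic formula covers the three components. -/
theorem curlComp_apply (V : Fin 3 → ℝ × Space → ℝ) (i : Fin 3) (p : ℝ × Space) :
    curlComp V i p = dirDeriv (spaceDir (i + 1)) (V (i + 2)) p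
      - dirDeriv (spaceDir (i + 2)) (V (i + 1)) p := by
  fin_cases i <;> rfl

theorem curl_apply {V : ℝ → Space → Space} {t : ℝ} {x : Space}
    (hV : ∀ i, DifferentiableAt ℝ (fun p : ℝ × Space => V p.1 p.2 i) (t, x)) (i : Fin 3) :
    curl (V t) x i = curlComp (fun j p => V p.1 p.2 j) i (t, x) := by
  have h := fun i j => partialDeriv_slice (hV j) i
  fin_cases i <;> simp [curl, curlComp, h]

theorem divergence_apply {V : ℝ → Space → Space} {t : ℝ} {x : Space}
    (hV : ∀ i, DifferentiableAt ℝ (fun p : ℝ × Space => V p.1 p.2 i) (t, x)) :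
    divergence (V t) x = ∑ i, dirDeriv (spaceDir i) (fun p => V p.1 p.2 i) (t, x) :=
  Finset.sum_congr rfl fun i _ => partialDeriv_slice (hV i) i

theorem cross_apply (a b : Space) (i : Fin 3) :
    cross a b i = a (i + 1) * b (i + 2) - a (i + 2) * b (i + 1) := by
  fin_cases i <;> simp [cross, crossProduct]

/-! ### Decay and growth of functions on space-time -/

/-- `f` is `C¹`, and for `t ∈ [t₁, t₂]` it is `O(|x|^{-m})` and its derivative is
`O(|x|^{-(m+1)})`. -/
structure DecayingC1 (t₁ t₂ : ℝ) (m : ℕ) (f : ℝ × Space → ℝ) : Prop where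
  contDiff : ContDiff ℝ 1 f
  bound : ∃ C, ∀ t ∈ Icc t₁ t₂, ∀ x, |f (t, x)| ≤ C / (1 + ‖x‖) ^ m ∧
    ‖fderiv ℝ f (t, x)‖ ≤ C / (1 + ‖x‖) ^ (m + 1)

namespace DecayingC1

variable {t₁ t₂ : ℝ} {m n : ℕ} {f g : ℝ × Space → ℝ}

theorem differentiable (hf : DecayingC1 t₁ t₂ m f) : Differentiable ℝ f :=
  hf.contDiff.differentiable one_ne_zero

theorem add (hf : DecayingC1 t₁ t₂ m f) (hg : DecayingC1 t₁ t₂ m g) :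
    DecayingC1 t₁ t₂ m (fun p => f p + g p) := by
  obtain ⟨C, hC⟩ := hf.bound
  obtain ⟨D, hD⟩ := hg.bound
  refine ⟨hf.contDiff.add hg.contDiff, C + D, fun t ht x => ⟨?_, ?_⟩⟩
  · rw [add_div]
    exact (abs_add_le _ _).trans (add_le_add (hC t ht x).1 (hD t ht x).1)
  · rw [add_div, fderiv_fun_add (hf.differentiable _) (hg.differentiable _)]
    exact (norm_add_le _ _).trans (add_le_add (hC t ht x).2 (hD t ht x).2)

theorem neg (hf : DecayingC1 t₁ t₂ m f) : DecayingC1 t₁ t₂ m (fun p => -f p) := by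
  obtain ⟨C, hC⟩ := hf.bound
  refine ⟨hf.contDiff.neg, C, fun t ht x => ?_⟩
  simpa using hC t ht x

theorem sub (hf : DecayingC1 t₁ t₂ m f) (hg : DecayingC1 t₁ t₂ m g) :
    DecayingC1 t₁ t₂ m (fun p => f p - g p) := by
  simpa only [sub_eq_add_neg] using hf.add hg.neg

/-- Decay orders add: field times field has order 4 and is integrable, field times potential has
order 3, and its derivatives are integrable. -/
theorem mul (hf : DecayingC1 t₁ t₂ m f) (hg : DecayingC1 t₁ t₂ n g) :
    DecayingC1 t₁ t₂ (m + n) (fun p => f p * g p) := by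
  obtain ⟨C, hC⟩ := hf.bound
  obtain ⟨D, hD⟩ := hg.bound
  refine ⟨hf.contDiff.mul hg.contDiff, 2 * |C * D|, fun t ht x => ?_⟩
  obtain ⟨h1, h2⟩ := hC t ht x
  obtain ⟨h3, h4⟩ := hD t ht x
  have hs : 0 < 1 + ‖x‖ := by positivity
  have h1' := (abs_nonneg _).trans h1
  have h2' := (norm_nonneg _).trans h2
  constructor
  · rw [abs_mul]
    calc _ ≤ C / (1 + ‖x‖) ^ m * (D / (1 + ‖x‖) ^ n) := mul_le_mul h1 h3 (abs_nonneg _) h1'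
      _ = C * D / (1 + ‖x‖) ^ (m + n) := by rw [div_mul_div_comm, ← pow_add]
      _ ≤ _ := by
        refine div_le_div_of_nonneg_right ?_ (by positivity)
        linarith [le_abs_self (C * D), abs_nonneg (C * D)]
  · rw [fderiv_fun_mul (hf.differentiable _) (hg.differentiable _)]
    calc _ ≤ ‖f (t, x)‖ * ‖fderiv ℝ g (t, x)‖ + ‖g (t, x)‖ * ‖fderiv ℝ f (t, x)‖ := by
          refine (norm_add_le _ _).trans ?_
          rw [norm_smul, norm_smul]
      _ ≤ C / (1 + ‖x‖) ^ m * (D / (1 + ‖x‖) ^ (n + 1))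
          + D / (1 + ‖x‖) ^ n * (C / (1 + ‖x‖) ^ (m + 1)) :=
        add_le_add (mul_le_mul h1 h4 (norm_nonneg _) h1')
          (mul_le_mul h3 h2 (norm_nonneg _) ((abs_nonneg _).trans h3))
      _ = 2 * (C * D) / (1 + ‖x‖) ^ (m + n + 1) := by
        rw [div_mul_div_comm, div_mul_div_comm, ← pow_add, ← pow_add,
          show n + (m + 1) = m + (n + 1) by ring, ← add_div, ← add_assoc]
        ring
      _ ≤ _ := by
        refine div_le_div_of_nonneg_right ?_ (by positivity)
        linarith [le_abs_self (C * D)]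

/-- Bounds on the function and its directional derivatives, with nonnegative constant. -/
theorem exists_abs_le (hf : DecayingC1 t₁ t₂ m f) :
    ∃ C, ∀ t ∈ Icc t₁ t₂, ∀ x, |f (t, x)| ≤ C / (1 + ‖x‖) ^ m :=
  let ⟨C, hC⟩ := hf.bound
  ⟨C, fun t ht x => (hC t ht x).1⟩

theorem exists_abs_dirDeriv_le (hf : DecayingC1 t₁ t₂ m f) (v : ℝ × Space) :
    ∃ C, ∀ t ∈ Icc t₁ t₂, ∀ x, |dirDeriv v f (t, x)| ≤ C / (1 + ‖x‖) ^ (m + 1) := by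
  obtain ⟨C, hC⟩ := hf.bound
  refine ⟨C * ‖v‖, fun t ht x => ((fderiv ℝ f (t, x)).le_opNorm v).trans ?_⟩
  rw [mul_div_right_comm]
  exact mul_le_mul_of_nonneg_right (hC t ht x).2 (norm_nonneg _)

theorem continuousOn_integral_dirDeriv (hf : DecayingC1 t₁ t₂ 3 f) (v : ℝ × Space) :
    ContinuousOn (fun t => ∫ x, dirDeriv v f (t, x)) (Icc t₁ t₂) :=
  let ⟨_, hC⟩ := hf.exists_abs_dirDeriv_le v
  continuousOn_integral_space (continuous_dirDeriv hf.contDiff v) hC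

theorem continuousOn_integral (hf : DecayingC1 t₁ t₂ 4 f) :
    ContinuousOn (fun t => ∫ x, f (t, x)) (Icc t₁ t₂) :=
  let ⟨_, hC⟩ := hf.exists_abs_le
  continuousOn_integral_space hf.contDiff.continuous hC

theorem integrable (hf : DecayingC1 t₁ t₂ 4 f) {t : ℝ} (ht : t ∈ Icc t₁ t₂) :
    Integrable fun x => f (t, x) :=
  let ⟨_, hC⟩ := hf.exists_abs_le
  integrable_of_norm_le (by have := hf.contDiff.continuous; fun_prop) (hC t ht)

theorem integrable_dirDeriv (hf : DecayingC1 t₁ t₂ 3 f) (v : ℝ × Space) {t : ℝ}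
    (ht : t ∈ Icc t₁ t₂) : Integrable fun x => dirDeriv v f (t, x) :=
  let ⟨_, hC⟩ := hf.exists_abs_dirDeriv_le v
  integrable_of_norm_le (by have := continuous_dirDeriv hf.contDiff v; fun_prop) (hC t ht)

/-- Order 3 is the borderline case of field times potential; this discards the spatial boundary
terms in the variation of the field action. -/
theorem integral_dirDeriv_spaceDir (hf : DecayingC1 t₁ t₂ 3 f) (i : Fin 3) {t : ℝ}
    (ht : t ∈ Icc t₁ t₂) : ∫ x, dirDeriv (spaceDir i) f (t, x) = 0 := by
  obtain ⟨C, hC⟩ := hf.exists_abs_le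
  obtain ⟨D, hD⟩ := hf.exists_abs_dirDeriv_le (spaceDir i)
  have h1 : ∀ x, dirDeriv (spaceDir i) f (t, x)
      = fderiv ℝ (fun y => f (t, y)) x (EuclideanSpace.single i 1) := fun x =>
    (partialDeriv_slice (hf.differentiable _) i).symm
  simp only [h1]
  refine integral_fderiv_apply_eq_zero (C := max C D)
    (hf.contDiff.comp (contDiff_prodMk_right t)) (fun x => (hC t ht x).trans ?_) fun x => ?_
  · gcongr; exact le_max_left _ _
  · refine ((congrArg abs (h1 x)).symm.trans_le (hD t ht x)).trans ?_
    gcongr; exact le_max_right _ _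

theorem integral_dirDeriv_timeDir (hf : DecayingC1 t₁ t₂ 3 f) (ht : t₁ ≤ t₂)
    (hends : ∀ x, f (t₁, x) = f (t₂, x)) :
    ∫ t in t₁..t₂, ∫ x, dirDeriv timeDir f (t, x) = 0 :=
  let ⟨_, hC⟩ := hf.exists_abs_dirDeriv_le timeDir
  integral_integral_timeDeriv_eq_zero ht hf.contDiff hC hends

end DecayingC1

/-- `f` is `C²`, and for `t ∈ [t₁, t₂]` it and its first and second derivatives decay like a
Coulomb potential. -/
structure DecayingC2 (t₁ t₂ : ℝ) (f : ℝ × Space → ℝ) : Prop where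
  contDiff : ContDiff ℝ 2 f
  decaying : DecayingC1 t₁ t₂ 1 f
  decaying_dirDeriv : ∀ v, DecayingC1 t₁ t₂ 2 (dirDeriv v f)

theorem SmoothDecaying.decayingC2 {t₁ t₂ : ℝ} {f : ℝ → Space → ℝ}
    (hf : SmoothDecaying t₁ t₂ f) : DecayingC2 t₁ t₂ (fun p => f p.1 p.2) := by
  obtain ⟨h2, C, hC⟩ := hf
  set g : ℝ × Space → ℝ := fun p => f p.1 p.2
  have hg0 : ∀ t ∈ Icc t₁ t₂, ∀ x, |g (t, x)| ≤ C / (1 + ‖x‖) ^ 1 := fun t ht x => by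
    simpa using hC 0 (by norm_num) t ht x
  have hg1 : ∀ t ∈ Icc t₁ t₂, ∀ x, ‖fderiv ℝ g (t, x)‖ ≤ C / (1 + ‖x‖) ^ 2 := fun t ht x => by
    simpa [norm_iteratedFDeriv_one] using hC 1 (by norm_num) t ht x
  have hg2 : ∀ t ∈ Icc t₁ t₂, ∀ x, ‖fderiv ℝ (fderiv ℝ g) (t, x)‖ ≤ C / (1 + ‖x‖) ^ 3 :=
    fun t ht x => by
      have := hC 2 le_rfl t ht x
      rwa [← norm_iteratedFDeriv_fderiv, norm_iteratedFDeriv_one] at this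
  refine ⟨h2, ⟨h2.of_le (by norm_num), C, fun t ht x => ⟨hg0 t ht x, hg1 t ht x⟩⟩, fun v =>
    ⟨contDiff_dirDeriv h2 v, C * ‖v‖, fun t ht x => ⟨?_, ?_⟩⟩⟩
  · refine ((fderiv ℝ g (t, x)).le_opNorm v).trans ?_
    rw [mul_div_right_comm]
    exact mul_le_mul_of_nonneg_right (hg1 t ht x) (norm_nonneg _)
  · have h1 : Differentiable ℝ (fderiv ℝ g) :=
      (h2.fderiv_right (m := 1) (by norm_num)).differentiable one_ne_zero
    have h3 : fderiv ℝ (dirDeriv v g) (t, x) = (fderiv ℝ (fderiv ℝ g) (t, x)).flip v := by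
      change fderiv ℝ (fun p => fderiv ℝ g p v) (t, x) = _
      rw [fderiv_clm_apply (h1 _) (differentiableAt_const v)]
      simp
    rw [h3, mul_div_right_comm]
    refine ((fderiv ℝ (fderiv ℝ g) (t, x)).flip.le_opNorm v).trans ?_
    rw [ContinuousLinearMap.opNorm_flip]
    exact mul_le_mul_of_nonneg_right (hg2 t ht x) (norm_nonneg _)

theorem norm_euclideanSpace_proj_le (i : Fin 3) :
    ‖(EuclideanSpace.proj i : Space →L[ℝ] ℝ)‖ ≤ 1 :=
  ContinuousLinearMap.opNorm_le_bound _ zero_le_one fun x => by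
    simpa using PiLp.norm_apply_le x i

theorem norm_iteratedFDeriv_component_le {V : ℝ × Space → Space} {n : ℕ∞} {k : ℕ}
    (hV : ContDiff ℝ n V) (hk : (k : ℕ∞) ≤ n) (i : Fin 3) (p : ℝ × Space) :
    ‖iteratedFDeriv ℝ k (fun p => V p i) p‖ ≤ ‖iteratedFDeriv ℝ k V p‖ := by
  refine ((EuclideanSpace.proj (𝕜 := ℝ) i).norm_iteratedFDeriv_comp_left
    (hV.contDiffAt (x := p)) (by exact_mod_cast hk)).trans ?_
  exact mul_le_of_le_one_left (norm_nonneg _) (norm_euclideanSpace_proj_le i)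

theorem SmoothDecaying.component {t₁ t₂ : ℝ} {V : ℝ → Space → Space}
    (hV : SmoothDecaying t₁ t₂ V) (i : Fin 3) : SmoothDecaying t₁ t₂ (fun t x => V t x i) := by
  obtain ⟨h2, C, hC⟩ := hV
  exact ⟨contDiff_euclidean.1 h2 i, C, fun k hk t ht x =>
    (norm_iteratedFDeriv_component_le (n := 2) h2 (by exact_mod_cast hk) i _).trans
      (hC k hk t ht x)⟩

/-- `f` is `C¹`, and for `t ∈ [t₁, t₂]` it and its first derivative grow at most polynomially. -/
structure ModerateC1 (t₁ t₂ : ℝ) (f : ℝ × Space → ℝ) : Prop where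
  contDiff : ContDiff ℝ 1 f
  bound : ∃ (C : ℝ) (N : ℕ), 0 ≤ C ∧ ∀ t ∈ Icc t₁ t₂, ∀ x, |f (t, x)| ≤ C * (1 + ‖x‖) ^ N ∧
    ‖fderiv ℝ f (t, x)‖ ≤ C * (1 + ‖x‖) ^ N

theorem ModerateC1.differentiable {t₁ t₂ : ℝ} {f : ℝ × Space → ℝ} (hf : ModerateC1 t₁ t₂ f) :
    Differentiable ℝ f :=
  hf.contDiff.differentiable one_ne_zero

theorem ModerateC1.add {t₁ t₂ : ℝ} {f g : ℝ × Space → ℝ} (hf : ModerateC1 t₁ t₂ f)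
    (hg : ModerateC1 t₁ t₂ g) : ModerateC1 t₁ t₂ (fun p => f p + g p) := by
  obtain ⟨C, N, hC0, hC⟩ := hf.bound
  obtain ⟨D, M, hD0, hD⟩ := hg.bound
  refine ⟨hf.contDiff.add hg.contDiff, C + D, max N M, by positivity, fun t ht x => ?_⟩
  have hN : C * (1 + ‖x‖) ^ N + D * (1 + ‖x‖) ^ M ≤ (C + D) * (1 + ‖x‖) ^ max N M := by
    have h1 : 1 ≤ 1 + ‖x‖ := by linarith [norm_nonneg x]
    rw [add_mul]
    gcongr
    · exact le_max_left _ _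
    · exact le_max_right _ _
  constructor
  · exact (abs_add_le _ _).trans ((add_le_add (hC t ht x).1 (hD t ht x).1).trans hN)
  · rw [fderiv_fun_add (hf.differentiable _) (hg.differentiable _)]
    exact (norm_add_le _ _).trans ((add_le_add (hC t ht x).2 (hD t ht x).2).trans hN)

/-- Places the potentials of the field in the same class as the external ones, so that the particle
can be coupled to their sum. -/
theorem DecayingC1.moderateC1 {t₁ t₂ : ℝ} {m : ℕ} {f : ℝ × Space → ℝ}
    (hf : DecayingC1 t₁ t₂ m f) : ModerateC1 t₁ t₂ f := by
  obtain ⟨C, hC⟩ := hf.bound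
  refine ⟨hf.contDiff, |C|, 0, abs_nonneg _, fun t ht x => ?_⟩
  have h1 : ∀ k : ℕ, C / (1 + ‖x‖) ^ k ≤ |C| * (1 + ‖x‖) ^ 0 := fun k => by
    rw [pow_zero, mul_one]
    refine (div_le_div_of_nonneg_right (le_abs_self C) (by positivity)).trans
      (div_le_self (abs_nonneg _) (one_le_pow₀ (by linarith [norm_nonneg x])))
  exact ⟨(hC t ht x).1.trans (h1 _), (hC t ht x).2.trans (h1 _)⟩

theorem SmoothModerate.moderateC1 {t₁ t₂ : ℝ} {f : ℝ → Space → ℝ}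
    (hf : SmoothModerate t₁ t₂ f) : ModerateC1 t₁ t₂ (fun p => f p.1 p.2) := by
  obtain ⟨h1, C, N, hC⟩ := hf
  refine ⟨h1, |C|, N, abs_nonneg _, fun t ht x => ?_⟩
  have h2 : C * (1 + ‖x‖) ^ N ≤ |C| * (1 + ‖x‖) ^ N := by gcongr; exact le_abs_self C
  have h3 := hC 0 (by norm_num) t ht x
  have h4 := hC 1 le_rfl t ht x
  rw [norm_iteratedFDeriv_zero] at h3
  rw [norm_iteratedFDeriv_one] at h4
  exact ⟨h3.trans h2, h4.trans h2⟩

theorem SmoothModerate.component {t₁ t₂ : ℝ} {V : ℝ → Space → Space}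
    (hV : SmoothModerate t₁ t₂ V) (i : Fin 3) : SmoothModerate t₁ t₂ (fun t x => V t x i) := by
  obtain ⟨h2, C, N, hC⟩ := hV
  exact ⟨contDiff_euclidean.1 h2 i, C, N, fun k hk t ht x =>
    (norm_iteratedFDeriv_component_le (n := 1) h2 (by exact_mod_cast hk) i _).trans
      (hC k hk t ht x)⟩

/-! ### Components of potentials and fields -/

/-- The components of the electric field as functions on space-time. -/
def electricComp (a₀ : ℝ × Space → ℝ) (a : Fin 3 → ℝ × Space → ℝ) (i : Fin 3) (p : ℝ × Space) : ℝ :=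
  -dirDeriv (spaceDir i) a₀ p - dirDeriv timeDir (a i) p

namespace Potentials

/-- The scalar potential as a function on space-time. -/
def scal (𝒜 : Potentials) (p : ℝ × Space) : ℝ := 𝒜.A₀ p.1 p.2

/-- The components of the vector potential as functions on space-time. -/
def vec (𝒜 : Potentials) (i : Fin 3) (p : ℝ × Space) : ℝ := 𝒜.A p.1 p.2 i

theorem E_apply {𝒜 : Potentials} (h0 : Differentiable ℝ 𝒜.scal)
    (h1 : ∀ i, Differentiable ℝ (𝒜.vec i)) (t : ℝ) (x : Space) (i : Fin 3) :
    𝒜.E t x i = electricComp 𝒜.scal 𝒜.vec i (t, x) := by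
  have h2 := gradient_slice_apply (h0 (t, x)) i
  have h3 := timeDeriv_apply (V := 𝒜.A) (fun i => h1 i (t, x)) i
  change gradient (𝒜.A₀ t) x i = _ at h2
  simp only [E, PiLp.sub_apply, PiLp.neg_apply, h2, h3]
  rfl

theorem B_apply {𝒜 : Potentials} (h1 : ∀ i, Differentiable ℝ (𝒜.vec i)) (t : ℝ) (x : Space)
    (i : Fin 3) : 𝒜.B t x i = curlComp 𝒜.vec i (t, x) :=
  curl_apply (fun i => h1 i (t, x)) i

end Potentials

/-! ### Averages against a rapidly decaying weight -/

/-- `w` is continuous and decays faster than any power. -/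
structure RapidDecay (w : Space → ℝ) : Prop where
  continuous : Continuous w
  decay : ∀ N : ℕ, ∃ C : ℝ, ∀ x, |w x| ≤ C / (1 + ‖x‖) ^ N

theorem IsChargeDensity.rapidDecay {ρ : Space → ℝ} (hρ : IsChargeDensity ρ) : RapidDecay ρ :=
  ⟨hρ.contDiff.continuous, fun N => by simpa using hρ.decay 0 zero_le_one N⟩

theorem abs_coord_le (x : Space) (i : Fin 3) : |x i| ≤ 1 + ‖x‖ := by
  have := PiLp.norm_apply_le x i
  rw [Real.norm_eq_abs] at this
  linarith

theorem RapidDecay.mul_coord {w : Space → ℝ} (hw : RapidDecay w) (i : Fin 3) :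
    RapidDecay (fun x => w x * x i) := by
  refine ⟨hw.continuous.mul (EuclideanSpace.proj i).continuous, fun N => ?_⟩
  obtain ⟨C, hC⟩ := hw.decay (N + 1)
  refine ⟨C, fun x => ?_⟩
  have hs : 0 < 1 + ‖x‖ := by positivity
  rw [abs_mul]
  calc _ ≤ C / (1 + ‖x‖) ^ (N + 1) * (1 + ‖x‖) :=
        mul_le_mul (hC x) (abs_coord_le x i) (abs_nonneg _) ((abs_nonneg _).trans (hC x))
    _ = _ := by rw [pow_succ]; field_simp

/-- The average `∫ w(y) f(t, z + y) dy`. -/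
def smear {F : Type*} [NormedAddCommGroup F] [NormedSpace ℝ F] (w : Space → ℝ)
    (f : ℝ × Space → F) (p : ℝ × Space) : F :=
  ∫ y, w y • f (p.1, p.2 + y)

section

variable {F : Type*} [NormedAddCommGroup F] [NormedSpace ℝ F] {w : Space → ℝ}
  {f : ℝ × Space → F} {t₁ t₂ C : ℝ} {N : ℕ}

/-- From `1 + ‖z + y‖ ≤ (1 + K)(1 + ‖y‖)` for `‖z‖ ≤ K`, the growth `N` is absorbed by `N + 4`
powers of decay of the weight. The majorant is uniform for `z` in a ball, as dominated convergence
near a point requires. -/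
theorem RapidDecay.exists_norm_smul_le (hw : RapidDecay w) (hC : 0 ≤ C)
    (hf : ∀ t ∈ Icc t₁ t₂, ∀ x, ‖f (t, x)‖ ≤ C * (1 + ‖x‖) ^ N) (K : ℝ) :
    ∃ D, ∀ p : ℝ × Space, p.1 ∈ Icc t₁ t₂ → ‖p.2‖ ≤ K →
      ∀ y, ‖w y • f (p.1, p.2 + y)‖ ≤ D / (1 + ‖y‖) ^ 4 := by
  obtain ⟨D, hD⟩ := hw.decay (N + 4)
  refine ⟨D * (C * (1 + K) ^ N), fun p hp hK y => ?_⟩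
  have hs : 0 < 1 + ‖y‖ := by positivity
  have hD' := (abs_nonneg _).trans (hD y)
  have hK0 := (norm_nonneg _).trans hK
  rw [norm_smul, Real.norm_eq_abs]
  calc _ ≤ D / (1 + ‖y‖) ^ (N + 4) * (C * ((1 + K) * (1 + ‖y‖)) ^ N) := by
        refine mul_le_mul (hD y) ((hf _ hp _).trans ?_) (norm_nonneg _) hD'
        gcongr
        have := norm_add_le p.2 y
        nlinarith [norm_nonneg y]
    _ = _ := by
        rw [mul_pow, pow_add]
        field_simp

theorem continuous_smul_translate (hw : RapidDecay w) (hf : Continuous f) (p : ℝ × Space) :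
    Continuous fun y => w y • f (p.1, p.2 + y) := by
  have := hw.continuous
  fun_prop

theorem RapidDecay.integrable_smul (hw : RapidDecay w) (hf : Continuous f) (hC : 0 ≤ C)
    (hfC : ∀ t ∈ Icc t₁ t₂, ∀ x, ‖f (t, x)‖ ≤ C * (1 + ‖x‖) ^ N) {p : ℝ × Space}
    (hp : p.1 ∈ Icc t₁ t₂) : Integrable fun y => w y • f (p.1, p.2 + y) :=
  let ⟨_, hD⟩ := hw.exists_norm_smul_le hC hfC ‖p.2‖
  integrable_of_norm_le (continuous_smul_translate hw hf p) (hD p hp le_rfl)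

theorem RapidDecay.continuousOn_smear (hw : RapidDecay w) (hf : Continuous f) (hC : 0 ≤ C)
    (hfC : ∀ t ∈ Icc t₁ t₂, ∀ x, ‖f (t, x)‖ ≤ C * (1 + ‖x‖) ^ N) :
    ContinuousOn (smear w f) (Icc t₁ t₂ ×ˢ univ) := by
  intro p hp
  obtain ⟨D, hD⟩ := hw.exists_norm_smul_le hC hfC (‖p.2‖ + 1)
  refine continuousWithinAt_of_dominated
    (Filter.Eventually.of_forall fun p =>
      (continuous_smul_translate hw hf p).aestronglyMeasurable)
    (bound := fun y => D / (1 + ‖y‖) ^ 4) ?_ (integrable_div_one_add_norm_pow D)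
    (Filter.Eventually.of_forall fun y => ?_)
  · have h1 : ∀ᶠ p' in nhdsWithin p (Icc t₁ t₂ ×ˢ univ), ‖p'.2‖ < ‖p.2‖ + 1 :=
      nhdsWithin_le_nhds ((by fun_prop : Continuous fun p' : ℝ × Space => ‖p'.2‖).continuousAt
        (gt_mem_nhds (lt_add_one _)))
    filter_upwards [h1, self_mem_nhdsWithin] with p' h2 h3
    exact Filter.Eventually.of_forall (hD p' h3.1 h2.le)
  · exact (by fun_prop : Continuous fun p : ℝ × Space => w y • f (p.1, p.2 + y)).continuousWithinAt

end

/-- `U` is continuous on `[t₁, t₂] × ℝ³` and has the derivative `U'` on `(t₁, t₂) × ℝ³`, which is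
continuous up to the initial and final times. -/
structure DiffUpToEnds (t₁ t₂ : ℝ) (U : ℝ × Space → ℝ) (U' : ℝ × Space → ℝ × Space →L[ℝ] ℝ) :
    Prop where
  hasFDerivAt : ∀ p : ℝ × Space, p.1 ∈ Ioo t₁ t₂ → HasFDerivAt U (U' p) p
  continuousOn : ContinuousOn U (Icc t₁ t₂ ×ˢ univ)
  continuousOn_deriv : ContinuousOn U' (Icc t₁ t₂ ×ˢ univ)

theorem DiffUpToEnds.sub {t₁ t₂ : ℝ} {U V : ℝ × Space → ℝ} {U' V' : ℝ × Space → ℝ × Space →L[ℝ] ℝ}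
    (hU : DiffUpToEnds t₁ t₂ U U') (hV : DiffUpToEnds t₁ t₂ V V') :
    DiffUpToEnds t₁ t₂ (fun p => U p - V p) (fun p => U' p - V' p) :=
  ⟨fun p hp => (hU.hasFDerivAt p hp).fun_sub (hV.hasFDerivAt p hp),
    hU.continuousOn.sub hV.continuousOn, hU.continuousOn_deriv.sub hV.continuousOn_deriv⟩

section

variable {w : Space → ℝ} {f g : ℝ × Space → ℝ} {t₁ t₂ : ℝ}

theorem ModerateC1.integrable (hf : ModerateC1 t₁ t₂ f) (hw : RapidDecay w) {p : ℝ × Space}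
    (hp : p.1 ∈ Icc t₁ t₂) : Integrable fun y => w y * f (p.1, p.2 + y) :=
  let ⟨_, _, hC, h⟩ := hf.bound
  hw.integrable_smul hf.contDiff.continuous hC (fun t ht x => (h t ht x).1) hp

theorem ModerateC1.exists_abs_dirDeriv_le (hf : ModerateC1 t₁ t₂ f) (v : ℝ × Space) :
    ∃ (C : ℝ) (N : ℕ), 0 ≤ C ∧ ∀ t ∈ Icc t₁ t₂, ∀ x, |dirDeriv v f (t, x)| ≤ C * (1 + ‖x‖) ^ N := by
  obtain ⟨C, N, hC0, hC⟩ := hf.bound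
  refine ⟨C * ‖v‖, N, by positivity, fun t ht x =>
    ((fderiv ℝ f (t, x)).le_opNorm v).trans ?_⟩
  rw [mul_right_comm]
  exact mul_le_mul_of_nonneg_right (hC t ht x).2 (norm_nonneg _)

theorem ModerateC1.integrable_dirDeriv (hf : ModerateC1 t₁ t₂ f) (hw : RapidDecay w)
    (v : ℝ × Space) {p : ℝ × Space} (hp : p.1 ∈ Icc t₁ t₂) :
    Integrable fun y => w y * dirDeriv v f (p.1, p.2 + y) :=
  let ⟨_, _, hC, h⟩ := hf.exists_abs_dirDeriv_le v
  hw.integrable_smul (continuous_dirDeriv hf.contDiff v) hC h hp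

theorem ModerateC1.smear_fderiv_apply (hf : ModerateC1 t₁ t₂ f) (hw : RapidDecay w)
    {p : ℝ × Space} (hp : p.1 ∈ Icc t₁ t₂) (v : ℝ × Space) :
    smear w (fderiv ℝ f) p v = ∫ y, w y * dirDeriv v f (p.1, p.2 + y) := by
  obtain ⟨C, N, hC0, hC⟩ := hf.bound
  have h1 := hw.integrable_smul (hf.contDiff.continuous_fderiv one_ne_zero) hC0
    (fun t ht x => (hC t ht x).2) hp
  rw [smear, ContinuousLinearMap.integral_apply h1]
  rfl

theorem ModerateC1.smear_add (hf : ModerateC1 t₁ t₂ f) (hg : ModerateC1 t₁ t₂ g)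
    (hw : RapidDecay w) {p : ℝ × Space} (hp : p.1 ∈ Icc t₁ t₂) :
    smear w (fun p => f p + g p) p = smear w f p + smear w g p := by
  rw [smear, smear, smear, ← integral_add]
  · simp only [smul_add]
  · exact hf.integrable hw hp
  · exact hg.integrable hw hp

theorem smear_const_mul (c : ℝ) (p : ℝ × Space) :
    smear w (fun p => c * f p) p = c * smear w f p := by
  rw [smear, smear, ← integral_const_mul]
  simp only [smul_eq_mul]
  congr 1; ext y; ring

/-- Differentiation under the integral sign. The growth bounds hold only for `t ∈ [t₁, t₂]`, so a
two-sided derivative is obtained at interior times only; the function and its derivative remain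
continuous up to the ends. -/
theorem ModerateC1.diffUpToEnds_smear (hf : ModerateC1 t₁ t₂ f) (hw : RapidDecay w) :
    DiffUpToEnds t₁ t₂ (smear w f) (smear w (fderiv ℝ f)) := by
  obtain ⟨C, N, hC0, hC⟩ := hf.bound
  have hf1 : Continuous (fderiv ℝ f) := hf.contDiff.continuous_fderiv one_ne_zero
  refine ⟨fun p hp => ?_,
    hw.continuousOn_smear hf.contDiff.continuous hC0 fun t ht x => (hC t ht x).1,
    hw.continuousOn_smear hf1 hC0 fun t ht x => (hC t ht x).2⟩
  obtain ⟨D, hD⟩ := hw.exists_norm_smul_le hC0 (fun t ht x => (hC t ht x).2) (‖p.2‖ + 1)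
  have hs : Ioo t₁ t₂ ×ˢ Metric.ball p.2 1 ∈ nhds p :=
    prod_mem_nhds (Ioo_mem_nhds hp.1 hp.2) (Metric.ball_mem_nhds _ one_pos)
  refine hasFDerivAt_integral_of_dominated_of_fderiv_le hs
    (Filter.Eventually.of_forall fun p =>
      (continuous_smul_translate hw hf.contDiff.continuous p).aestronglyMeasurable)
    (hf.integrable hw (Ioo_subset_Icc_self hp))
    (continuous_smul_translate hw hf1 p).aestronglyMeasurable
    (bound := fun y => D / (1 + ‖y‖) ^ 4)
    (Filter.Eventually.of_forall fun y p' hp' => hD p' (Ioo_subset_Icc_self hp'.1) ?_ y)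
    (integrable_div_one_add_norm_pow D)
    (Filter.Eventually.of_forall fun y p' _ => ?_)
  · have h1 := mem_ball_iff_norm.1 hp'.2
    have h2 := norm_add_le (p'.2 - p.2) p.2
    rw [sub_add_cancel] at h2
    linarith
  · have h1 : HasFDerivAt (fun p : ℝ × Space => (p.1, p.2 + y))
        (ContinuousLinearMap.id ℝ (ℝ × Space)) p' := by
      have := (hasFDerivAt_id (𝕜 := ℝ) p').add_const ((0 : ℝ), y)
      refine this.congr_of_eventuallyEq (Filter.Eventually.of_forall fun p => ?_)
      simp [Prod.ext_iff]
    have h2 := ((hf.differentiable (p'.1, p'.2 + y)).hasFDerivAt.comp p' h1).const_smul (w y)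
    simpa [Function.comp_def, Pi.smul_def] using h2

end

/-! ### Radial symmetry -/

namespace IsChargeDensity

variable {ρ : Space → ℝ}

/-- If `u ⊥ x` then `x + su` and `x - su` have the same norm, so `s ↦ ρ (x + su)` is even and its
derivative at `0` vanishes. No differentiability of the radial profile is needed. -/
theorem fderiv_apply_of_inner_eq_zero (hρ : IsChargeDensity ρ) {x u : Space}
    (h : inner ℝ x u = 0) : fderiv ℝ ρ x u = 0 := by
  obtain ⟨ρr, hr⟩ := hρ.radial
  have hd : DifferentiableAt ℝ ρ x := hρ.contDiff.differentiable one_ne_zero x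
  have h1 : ∀ v : Space, HasDerivAt (fun s : ℝ => ρ (x + s • v)) (fderiv ℝ ρ x v) 0 := fun v => by
    have h2 : HasDerivAt (fun s : ℝ => x + s • v) v 0 := by
      simpa using ((hasDerivAt_id (0 : ℝ)).smul_const v).const_add x
    have h3 : HasFDerivAt ρ (fderiv ℝ ρ x) (x + (0 : ℝ) • v) := by simpa using hd.hasFDerivAt
    exact h3.comp_hasDerivAt 0 h2
  have h2 : (fun s : ℝ => ρ (x + s • u)) = fun s : ℝ => ρ (x + s • -u) := by
    ext s
    have h3 : ‖x + s • u‖ ^ 2 = ‖x + s • -u‖ ^ 2 := by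
      rw [norm_add_sq_real, norm_add_sq_real, smul_neg, inner_neg_right, inner_smul_right, h,
        norm_neg]
      simp
    rw [hr, hr, (pow_left_inj₀ (norm_nonneg _) (norm_nonneg _) two_ne_zero).1 h3]
  have h3 := h1 u
  rw [h2] at h3
  have h4 := h3.unique (h1 (-u))
  rw [map_neg] at h4
  linarith

/-- The vector `x_j e_k - x_k e_j` is orthogonal to `x`: it generates the rotation in the `(j, k)`
plane. -/
theorem coord_mul_fderiv_comm (hρ : IsChargeDensity ρ) (x : Space) (j k : Fin 3) :
    x j * fderiv ℝ ρ x (EuclideanSpace.single k 1)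
      = x k * fderiv ℝ ρ x (EuclideanSpace.single j 1) := by
  have h := hρ.fderiv_apply_of_inner_eq_zero (x := x)
    (u := x j • EuclideanSpace.single k 1 - x k • EuclideanSpace.single j 1) (by
      simp [inner_sub_right, inner_smul_right, EuclideanSpace.inner_single_right]; ring)
  rw [map_sub, map_smul, map_smul, smul_eq_mul, smul_eq_mul] at h
  linarith

theorem exists_abs_fderiv_le (hρ : IsChargeDensity ρ) (N : ℕ) (v : Space) :
    ∃ C, ∀ x, |fderiv ℝ ρ x v| ≤ C / (1 + ‖x‖) ^ N := by
  obtain ⟨C, hC⟩ := hρ.decay 1 le_rfl N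
  refine ⟨C * ‖v‖, fun x => ((fderiv ℝ ρ x).le_opNorm v).trans ?_⟩
  rw [mul_div_right_comm]
  refine mul_le_mul_of_nonneg_right ?_ (norm_nonneg _)
  simpa [norm_iteratedFDeriv_one] using hC x

theorem rapidDecay_fderiv (hρ : IsChargeDensity ρ) (v : Space) :
    RapidDecay fun x => fderiv ℝ ρ x v :=
  ⟨(hρ.contDiff.continuous_fderiv one_ne_zero).clm_apply continuous_const,
    fun N => hρ.exists_abs_fderiv_le N v⟩

end IsChargeDensity

theorem RapidDecay.integrable_mul {w g : Space → ℝ} (hw : RapidDecay w) (hg : Continuous g)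
    {C : ℝ} {N : ℕ} (hC : 0 ≤ C) (hgC : ∀ x, |g x| ≤ C * (1 + ‖x‖) ^ N) :
    Integrable fun x => w x * g x := by
  have := hw.integrable_smul (f := fun p : ℝ × Space => g p.2) (t₁ := 0) (t₂ := 0) (p := (0, 0))
    (by fun_prop) hC (fun _ _ x => hgC x) (by simp)
  simpa using this

theorem hasFDerivAt_coord (j : Fin 3) (x : Space) :
    HasFDerivAt (fun y : Space => y j) (EuclideanSpace.proj j : Space →L[ℝ] ℝ) x :=
  (EuclideanSpace.proj j : Space →L[ℝ] ℝ).hasFDerivAt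

theorem coord_single (j k : Fin 3) :
    (EuclideanSpace.single k (1 : ℝ) : Space) j = if j = k then 1 else 0 := by
  simp

/-- Rotational invariance of `ρ`, in weak form: the infinitesimal rotations are skew-adjoint and
annihilate `ρ`. -/
theorem IsChargeDensity.integral_rotation_eq_zero {ρ : Space → ℝ} (hρ : IsChargeDensity ρ)
    {g : Space → ℝ} (hg : ContDiff ℝ 1 g) {C : ℝ} {N : ℕ} (hC : 0 ≤ C)
    (h0 : ∀ x, |g x| ≤ C * (1 + ‖x‖) ^ N) (h1 : ∀ x, ‖fderiv ℝ g x‖ ≤ C * (1 + ‖x‖) ^ N)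
    (j k : Fin 3) :
    ∫ x, ρ x * (x j * fderiv ℝ g x (EuclideanSpace.single k 1)
      - x k * fderiv ℝ g x (EuclideanSpace.single j 1)) = 0 := by
  have hgv : ∀ (v : Space) x, |fderiv ℝ g x v| ≤ C * ‖v‖ * (1 + ‖x‖) ^ N := fun v x => by
    rw [mul_right_comm]
    exact ((fderiv ℝ g x).le_opNorm v).trans (mul_le_mul_of_nonneg_right (h1 x) (norm_nonneg _))
  have hgc : ∀ v, Continuous fun x => fderiv ℝ g x v := fun v =>
    (hg.continuous_fderiv one_ne_zero).clm_apply continuous_const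
  have hd : ∀ i x, HasFDerivAt (fun x => ρ x * x i)
      (ρ x • (EuclideanSpace.proj i : Space →L[ℝ] ℝ) + x i • fderiv ℝ ρ x) x := fun i x =>
    (hρ.contDiff.differentiable one_ne_zero x).hasFDerivAt.mul (hasFDerivAt_coord i x)
  have hfd : ∀ i x v, fderiv ℝ (fun x => ρ x * x i) x v = ρ x * v i + fderiv ℝ ρ x v * x i :=
    fun i x v => by simp [(hd i x).fderiv]; ring
  have hi1 : ∀ i l, Integrable fun x => ρ x * x i * fderiv ℝ g x (EuclideanSpace.single l 1) :=
    fun i l => (hρ.rapidDecay.mul_coord i).integrable_mul (hgc _) (by positivity) (hgv _)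
  have hi2 : ∀ i l, Integrable fun x =>
      fderiv ℝ (fun x => ρ x * x i) x (EuclideanSpace.single l 1) * g x := fun i l => by
    simp only [hfd, add_mul]
    refine Integrable.add ?_ ?_
    · simp only [mul_right_comm]
      exact (hρ.rapidDecay.integrable_mul hg.continuous hC h0).mul_const _
    · exact ((hρ.rapidDecay_fderiv _).mul_coord i).integrable_mul hg.continuous hC h0
  have hp : ∀ i l, ∫ x, ρ x * x i * fderiv ℝ g x (EuclideanSpace.single l 1)
      = -∫ x, fderiv ℝ (fun x => ρ x * x i) x (EuclideanSpace.single l 1) * g x := fun i l =>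
    integral_mul_fderiv_eq_neg_fderiv_mul_of_integrable (hi2 i l) (hi1 i l)
      ((hρ.rapidDecay.mul_coord i).integrable_mul hg.continuous hC h0)
      (fun x _ => (hd i x).differentiableAt) (fun x _ => hg.differentiable one_ne_zero x)
  have hs : ∀ x, ρ x * (x j * fderiv ℝ g x (EuclideanSpace.single k 1)
      - x k * fderiv ℝ g x (EuclideanSpace.single j 1))
      = ρ x * x j * fderiv ℝ g x (EuclideanSpace.single k 1)
        - ρ x * x k * fderiv ℝ g x (EuclideanSpace.single j 1) := fun x => by ring
  simp only [hs]
  -- After integration by parts both terms contain the same Kronecker delta, from differentiating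
  -- the coordinate, and the derivatives of `ρ` agree by `coord_mul_fderiv_comm`.
  rw [integral_sub (hi1 j k) (hi1 k j), hp, hp, sub_eq_zero, neg_inj]
  congr 1
  ext x
  rw [hfd, hfd, coord_single, coord_single]
  have h3 := hρ.coord_mul_fderiv_comm x j k
  have h4 : (if j = k then (1 : ℝ) else 0) = if k = j then 1 else 0 := by simp only [eq_comm]
  rw [h4, mul_comm _ (x j), mul_comm _ (x k), h3]

/-! ### Actions depending on a parameter -/

/-- `L ε t` has the derivative `L' ε t` in `ε` for `t ∈ (t₁, t₂)`, and both are jointly continuous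
for `t ∈ [t₁, t₂]`. -/
structure ParamDiff (t₁ t₂ : ℝ) (L L' : ℝ → ℝ → ℝ) : Prop where
  hasDerivAt : ∀ t ∈ Ioo t₁ t₂, ∀ ε, HasDerivAt (fun ε => L ε t) (L' ε t) ε
  continuousOn : ContinuousOn (fun p : ℝ × ℝ => L p.1 p.2) (univ ×ˢ Icc t₁ t₂)
  continuousOn_deriv : ContinuousOn (fun p : ℝ × ℝ => L' p.1 p.2) (univ ×ˢ Icc t₁ t₂)

namespace ParamDiff

variable {t₁ t₂ : ℝ} {L L' M M' : ℝ → ℝ → ℝ}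

theorem add (hL : ParamDiff t₁ t₂ L L') (hM : ParamDiff t₁ t₂ M M') :
    ParamDiff t₁ t₂ (fun ε t => L ε t + M ε t) (fun ε t => L' ε t + M' ε t) :=
  ⟨fun t ht ε => (hL.hasDerivAt t ht ε).fun_add (hM.hasDerivAt t ht ε),
    hL.continuousOn.add hM.continuousOn, hL.continuousOn_deriv.add hM.continuousOn_deriv⟩

theorem mul (hL : ParamDiff t₁ t₂ L L') (hM : ParamDiff t₁ t₂ M M') :
    ParamDiff t₁ t₂ (fun ε t => L ε t * M ε t) (fun ε t => L' ε t * M ε t + L ε t * M' ε t) :=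
  ⟨fun t ht ε => (hL.hasDerivAt t ht ε).fun_mul (hM.hasDerivAt t ht ε),
    hL.continuousOn.mul hM.continuousOn,
    (hL.continuousOn_deriv.mul hM.continuousOn).add (hL.continuousOn.mul hM.continuousOn_deriv)⟩

theorem of_time {c : ℝ → ℝ} (hc : ContinuousOn c (Icc t₁ t₂)) :
    ParamDiff t₁ t₂ (fun _ t => c t) (fun _ _ => 0) :=
  ⟨fun _ _ ε => hasDerivAt_const ε _, hc.comp continuousOn_snd fun _ hp => hp.2,
    continuousOn_const⟩

theorem const (c : ℝ) : ParamDiff t₁ t₂ (fun _ _ => c) (fun _ _ => 0) :=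
  of_time continuousOn_const

theorem param : ParamDiff t₁ t₂ (fun ε _ => ε) (fun _ _ => 1) :=
  ⟨fun _ _ ε => hasDerivAt_id ε, continuousOn_fst, continuousOn_const⟩

theorem sum {ι : Type*} (s : Finset ι) {L L' : ι → ℝ → ℝ → ℝ}
    (h : ∀ i ∈ s, ParamDiff t₁ t₂ (L i) (L' i)) :
    ParamDiff t₁ t₂ (fun ε t => ∑ i ∈ s, L i ε t) (fun ε t => ∑ i ∈ s, L' i ε t) :=
  ⟨fun t ht ε => HasDerivAt.fun_sum fun i hi => (h i hi).hasDerivAt t ht ε,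
    continuousOn_finsetSum _ fun i hi => (h i hi).continuousOn,
    continuousOn_finsetSum _ fun i hi => (h i hi).continuousOn_deriv⟩

theorem of_contDiff {f : ℝ × ℝ → ℝ} (hf : ContDiff ℝ 1 f) :
    ParamDiff t₁ t₂ (fun ε t => f (ε, t)) (fun ε t => fderiv ℝ f (ε, t) (1, 0)) :=
  ⟨fun t _ ε => ((hf.differentiable one_ne_zero (ε, t)).hasFDerivAt.comp_hasDerivAt ε
      ((hasDerivAt_id ε).prodMk (hasDerivAt_const ε t))),
    hf.continuous.continuousOn,
    ((hf.continuous_fderiv one_ne_zero).clm_apply continuous_const).continuousOn⟩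

theorem comp_line {U : ℝ × Space → ℝ} {U' : ℝ × Space → ℝ × Space →L[ℝ] ℝ}
    (hU : DiffUpToEnds t₁ t₂ U U') {q δq : ℝ → Space} (hq : Continuous q) (hδq : Continuous δq) :
    ParamDiff t₁ t₂ (fun ε t => U (t, q t + ε • δq t))
      (fun ε t => U' (t, q t + ε • δq t) (0, δq t)) := by
  have hc : ContinuousOn (fun p : ℝ × ℝ => (p.2, q p.2 + p.1 • δq p.2)) (univ ×ˢ Icc t₁ t₂) :=
    Continuous.continuousOn (by fun_prop)
  have hm : MapsTo (fun p : ℝ × ℝ => (p.2, q p.2 + p.1 • δq p.2)) (univ ×ˢ Icc t₁ t₂)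
      (Icc t₁ t₂ ×ˢ univ) := fun p hp => ⟨hp.2, mem_univ _⟩
  refine ⟨fun t ht ε => ?_, hU.continuousOn.comp hc hm,
    (hU.continuousOn_deriv.comp hc hm).clm_apply (Continuous.continuousOn (by fun_prop))⟩
  refine (hU.hasFDerivAt (t, q t + ε • δq t) ht).comp_hasDerivAt ε ?_
  exact (hasDerivAt_const ε t).prodMk
    (by simpa using ((hasDerivAt_id ε).smul_const (δq t)).const_add (q t))

theorem hasDerivAt_integral (hL : ParamDiff t₁ t₂ L L') (ht : t₁ ≤ t₂) :
    HasDerivAt (fun ε => ∫ t in t₁..t₂, L ε t) (∫ t in t₁..t₂, L' 0 t) 0 := by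
  have hmem : ∀ {ε : ℝ}, ContinuousOn (fun t => (ε, t)) (Icc t₁ t₂) :=
    Continuous.continuousOn (by fun_prop)
  have hLc : ∀ ε, ContinuousOn (L ε) (Icc t₁ t₂) := fun ε =>
    hL.continuousOn.comp hmem fun t ht => ⟨mem_univ _, ht⟩
  have hLc' : ContinuousOn (L' 0) (Icc t₁ t₂) :=
    hL.continuousOn_deriv.comp hmem fun t ht => ⟨mem_univ _, ht⟩
  -- Joint continuity on the compact rectangle `[-1, 1] × [t₁, t₂]` gives a constant majorant for
  -- the parameter derivative.
  obtain ⟨C, hC⟩ := ((isCompact_Icc (a := (-1 : ℝ)) (b := 1)).prod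
    (isCompact_Icc (a := t₁) (b := t₂))).exists_bound_of_continuousOn
    (hL.continuousOn_deriv.mono (prod_mono (subset_univ _) subset_rfl))
  have hI : uIoc t₁ t₂ = Ioc t₁ t₂ := uIoc_of_le ht
  refine (intervalIntegral.hasDerivAt_integral_of_dominated_loc_of_deriv_le
    (Icc_mem_nhds (by norm_num : (-1 : ℝ) < 0) zero_lt_one)
    (Filter.Eventually.of_forall fun ε => ?_) ((hLc 0).intervalIntegrable_of_Icc ht) ?_
    (bound := fun _ => C) (Filter.Eventually.of_forall fun t ht' ε hε => ?_)
    (by simp) ?_).2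
  · rw [hI]
    exact ((hLc ε).mono Ioc_subset_Icc_self).aestronglyMeasurable measurableSet_Ioc
  · rw [hI]
    exact (hLc'.mono Ioc_subset_Icc_self).aestronglyMeasurable measurableSet_Ioc
  · rw [hI] at ht'
    exact hC (ε, t) ⟨hε, Ioc_subset_Icc_self ht'⟩
  -- Differentiability is known only in the open interval; the half-open interval of integration
  -- adds just the null set `{t₂}`.
  · have h1 : ∀ᵐ t : ℝ, t ≠ t₂ := by simp [ae_iff, measure_singleton]
    filter_upwards [h1] with t h2 h3 ε _
    rw [hI] at h3
    exact hL.hasDerivAt t ⟨h3.1, lt_of_le_of_ne h3.2 h2⟩ ε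

end ParamDiff

/-! ### Variations of rotations -/

theorem inv_eq_transpose (R : SO3) :
    (R : Matrix (Fin 3) (Fin 3) ℝ)⁻¹ = (R : Matrix (Fin 3) (Fin 3) ℝ).transpose :=
  Matrix.inv_eq_right_inv (Matrix.mem_orthogonalGroup_iff (Fin 3) ℝ |>.1
    (Matrix.mem_specialOrthogonalGroup_iff.1 R.2).1)

theorem row_orthonormal (R : SO3) (a b : Fin 3) :
    ∑ l, (R : Matrix (Fin 3) (Fin 3) ℝ) a l * (R : Matrix (Fin 3) (Fin 3) ℝ) b l
      = if a = b then 1 else 0 := by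
  have h := Matrix.mem_orthogonalGroup_iff (Fin 3) ℝ |>.1
    (Matrix.mem_specialOrthogonalGroup_iff.1 R.2).1
  have h2 := congrFun (congrFun h a) b
  simpa [Matrix.mul_apply, Matrix.one_apply] using h2

theorem col_orthonormal (R : SO3) (a b : Fin 3) :
    ∑ l, (R : Matrix (Fin 3) (Fin 3) ℝ) l a * (R : Matrix (Fin 3) (Fin 3) ℝ) l b
      = if a = b then 1 else 0 := by
  have h := Matrix.mem_orthogonalGroup_iff' (Fin 3) ℝ |>.1
    (Matrix.mem_specialOrthogonalGroup_iff.1 R.2).1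
  have h2 := congrFun (congrFun h a) b
  simpa [Matrix.mul_apply, Matrix.one_apply] using h2

/-- The entries read by `unskew` are, for each `k`, those at the cyclic position `(k + 2, k + 1)`;
`R⁻¹` is the transpose. -/
theorem angularVelocity_apply (R : ℝ → SO3) (t : ℝ) (k : Fin 3) :
    angularVelocity R t k = ∑ l, deriv (fun s => (R s : Matrix (Fin 3) (Fin 3) ℝ) (k + 2) l) t
      * (R t : Matrix (Fin 3) (Fin 3) ℝ) (k + 1) l := by
  rw [angularVelocity, inv_eq_transpose]
  fin_cases k <;> simp [unskew, Matrix.mul_apply, rotationDeriv]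

theorem contDiff_angularVelocity {R : ℝ → SO3} (hR : SmoothPath R) (k : Fin 3) :
    ContDiff ℝ 1 (fun t => angularVelocity R t k) := by
  simp only [angularVelocity_apply]
  exact ContDiff.sum fun l _ => (ContDiff.deriv' (n := 1) (hR _ l)).mul
    ((hR _ l).of_le (by norm_num))

section

variable {r : Fin 3 → Fin 3 → ℝ × ℝ → ℝ}

/-- The matrix `(∂ᵥ r) rᵀ`, for a family `r` of matrices. -/
def spin (r : Fin 3 → Fin 3 → ℝ × ℝ → ℝ) (v : ℝ × ℝ) (a b : Fin 3) (p : ℝ × ℝ) : ℝ :=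
  ∑ l, fderiv ℝ (r a l) p v * r b l p

theorem contDiff_spin (hr : ∀ i j, ContDiff ℝ 2 (r i j)) (v : ℝ × ℝ) (a b : Fin 3) :
    ContDiff ℝ 1 (spin r v a b) :=
  ContDiff.sum fun l _ => (((hr a l).fderiv_right (m := 1) (by norm_num)).clm_apply
    contDiff_const).mul ((hr b l).of_le (by norm_num))

theorem spin_skew (hr : ∀ i j, ContDiff ℝ 2 (r i j))
    (hrow : ∀ p a b, ∑ l, r a l p * r b l p = if a = b then 1 else 0) (v : ℝ × ℝ) (a b : Fin 3)
    (p : ℝ × ℝ) : spin r v a b p = -spin r v b a p := by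
  have hd : ∀ i j, HasFDerivAt (r i j) (fderiv ℝ (r i j) p) p := fun i j =>
    ((hr i j).differentiable two_ne_zero p).hasFDerivAt
  have h1 : HasFDerivAt (fun p => ∑ l, r a l p * r b l p)
      (∑ l, (r a l p • fderiv ℝ (r b l) p + r b l p • fderiv ℝ (r a l) p)) p :=
    HasFDerivAt.fun_sum fun l _ => (hd a l).mul (hd b l)
  simp only [hrow] at h1
  have h2 := congrArg (fun T => T v) (h1.unique (hasFDerivAt_const _ p))
  simp only [sum_apply, add_apply,
    smul_apply, smul_eq_mul, Finset.sum_add_distrib,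
    zero_apply] at h2
  have h3 : ∑ l, r b l p * fderiv ℝ (r a l) p v = spin r v a b p :=
    Finset.sum_congr rfl fun _ _ => mul_comm _ _
  have h4 : ∑ l, r a l p * fderiv ℝ (r b l) p v = spin r v b a p :=
    Finset.sum_congr rfl fun _ _ => mul_comm _ _
  rw [h3, h4] at h2
  linarith

/-- With `Ω_v = (∂ᵥ r) rᵀ` this is `Ω_v r = ∂ᵥ r`, because `rᵀ r = 1`. -/
theorem sum_spin_mul (hcol : ∀ p a b, ∑ l, r l a p * r l b p = if a = b then 1 else 0)
    (v : ℝ × ℝ) (a l : Fin 3) (p : ℝ × ℝ) :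
    ∑ c, spin r v a c p * r c l p = fderiv ℝ (r a l) p v := by
  simp only [spin, Finset.sum_mul]
  rw [Finset.sum_comm]
  simp only [mul_assoc, ← Finset.mul_sum, hcol]
  simp

/-- Substituting `∂ᵥ r = Ω_v r` in `(∂ᵥ r)(∂_w r)ᵀ` gives `Ω_v Ω_wᵀ`. -/
theorem sum_fderiv_mul_fderiv
    (hcol : ∀ p a b, ∑ l, r l a p * r l b p = if a = b then 1 else 0)
    (v w : ℝ × ℝ) (a b : Fin 3) (p : ℝ × ℝ) :
    ∑ l, fderiv ℝ (r a l) p v * fderiv ℝ (r b l) p w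
      = ∑ c, spin r v a c p * spin r w b c p := by
  have h1 : ∀ c, spin r w b c p = ∑ l, fderiv ℝ (r b l) p w * r c l p := fun _ => rfl
  simp only [h1, Finset.mul_sum]
  rw [Finset.sum_comm]
  refine Finset.sum_congr rfl fun l _ => ?_
  rw [← sum_spin_mul hcol v a l p, Finset.sum_mul]
  exact Finset.sum_congr rfl fun c _ => by ring

/-- The structure equation of `SO(3)`. -/
theorem fderiv_spin_sub (hr : ∀ i j, ContDiff ℝ 2 (r i j))
    (hcol : ∀ p a b, ∑ l, r l a p * r l b p = if a = b then 1 else 0)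
    (v w : ℝ × ℝ) (a b : Fin 3) (p : ℝ × ℝ) :
    fderiv ℝ (spin r w a b) p v - fderiv ℝ (spin r v a b) p w
      = ∑ c, (spin r w a c p * spin r v b c p - spin r v a c p * spin r w b c p) := by
  have hd1 : ∀ i j, DifferentiableAt ℝ (r i j) p := fun i j =>
    (hr i j).differentiable two_ne_zero p
  have hd2 : ∀ i j, DifferentiableAt ℝ (fderiv ℝ (r i j)) p := fun i j =>
    ((hr i j).fderiv_right (m := 1) (by norm_num)).differentiable one_ne_zero p
  have h1 : ∀ v w, fderiv ℝ (spin r w a b) p v = ∑ l, (fderiv ℝ (fderiv ℝ (r a l)) p v w * r b l p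
      + fderiv ℝ (r a l) p w * fderiv ℝ (r b l) p v) := fun v w => by
    have h2 : HasFDerivAt (spin r w a b) (∑ l, (fderiv ℝ (r a l) p w • fderiv ℝ (r b l) p
        + r b l p • (fderiv ℝ (fderiv ℝ (r a l)) p).flip w)) p := by
      refine HasFDerivAt.fun_sum fun l _ => HasFDerivAt.mul ?_ (hd1 b l).hasFDerivAt
      have := (hd2 a l).hasFDerivAt.clm_apply (hasFDerivAt_const w p)
      simpa using this
    rw [h2.fderiv]
    simp only [sum_apply, add_apply,
      smul_apply, smul_eq_mul, ContinuousLinearMap.flip_apply]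
    exact Finset.sum_congr rfl fun l _ => by ring
  -- Mixed second derivatives are symmetric and drop out of the difference, which leaves only
  -- products of first derivatives.
  have h3 : ∀ l, fderiv ℝ (fderiv ℝ (r a l)) p v w = fderiv ℝ (fderiv ℝ (r a l)) p w v := fun l =>
    ((hr a l).contDiffAt.isSymmSndFDerivAt (by simp)) v w
  rw [h1, h1, Finset.sum_sub_distrib, ← sum_fderiv_mul_fderiv hcol,
    ← sum_fderiv_mul_fderiv hcol]
  simp only [h3, Finset.sum_add_distrib]
  ring

end

namespace IsRotationVariation

variable {t₁ t₂ : ℝ} {R : ℝ → SO3} {Rv : ℝ → ℝ → SO3}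

/-- The matrix entries of a variation. -/
def entry (Rv : ℝ → ℝ → SO3) (i j : Fin 3) (p : ℝ × ℝ) : ℝ :=
  (Rv p.1 p.2 : Matrix (Fin 3) (Fin 3) ℝ) i j

/-- The angular variation `φ = 𝒥⁻¹ (∂_ε R R⁻¹)` at `ε = 0`. -/
def angle (Rv : ℝ → ℝ → SO3) (t : ℝ) (k : Fin 3) : ℝ :=
  spin (entry Rv) (1, 0) (k + 2) (k + 1) (0, t)

/-- The time derivative of the angular variation. -/
def angleDeriv (Rv : ℝ → ℝ → SO3) (t : ℝ) (k : Fin 3) : ℝ :=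
  fderiv ℝ (spin (entry Rv) (1, 0) (k + 2) (k + 1)) (0, t) (0, 1)

theorem angularVelocity_eq_spin (h : IsRotationVariation t₁ t₂ R Rv) (ε t : ℝ) (k : Fin 3) :
    angularVelocity (Rv ε) t k = spin (entry Rv) (0, 1) (k + 2) (k + 1) (ε, t) := by
  rw [angularVelocity_apply]
  refine Finset.sum_congr rfl fun l _ => ?_
  have h1 : HasDerivAt (fun s => (Rv ε s : Matrix (Fin 3) (Fin 3) ℝ) (k + 2) l)
      (fderiv ℝ (entry Rv (k + 2) l) (ε, t) (0, 1)) t :=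
    ((h.contDiff (k + 2) l).differentiable two_ne_zero (ε, t)).hasFDerivAt.comp_hasDerivAt t
      ((hasDerivAt_const t ε).prodMk (hasDerivAt_id t))
  rw [h1.deriv]
  rfl

theorem paramDiff_angularVelocity (h : IsRotationVariation t₁ t₂ R Rv) (k : Fin 3) :
    ParamDiff t₁ t₂ (fun ε t => angularVelocity (Rv ε) t k)
      (fun ε t => fderiv ℝ (spin (entry Rv) (0, 1) (k + 2) (k + 1)) (ε, t) (1, 0)) := by
  simp only [h.angularVelocity_eq_spin]
  exact ParamDiff.of_contDiff (contDiff_spin h.contDiff _ _ _)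

theorem hasDerivAt_angle (h : IsRotationVariation t₁ t₂ R Rv) (k : Fin 3) (t : ℝ) :
    HasDerivAt (fun t => angle Rv t k) (angleDeriv Rv t k) t :=
  ((contDiff_spin (r := entry Rv) h.contDiff _ _ _).differentiable one_ne_zero (0, t)).hasFDerivAt.comp_hasDerivAt t
    ((hasDerivAt_const t 0).prodMk (hasDerivAt_id t))

theorem continuous_angleDeriv (h : IsRotationVariation t₁ t₂ R Rv) (k : Fin 3) :
    Continuous fun t => angleDeriv Rv t k := by
  have := ((contDiff_spin (r := entry Rv) h.contDiff (1, 0) (k + 2) (k + 1)).continuous_fderiv one_ne_zero)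
  unfold angleDeriv
  fun_prop

theorem hasDerivAt_entry (h : IsRotationVariation t₁ t₂ R Rv) (t : ℝ) (a l : Fin 3) :
    HasDerivAt (fun ε => (Rv ε t : Matrix (Fin 3) (Fin 3) ℝ) a l)
      (fderiv ℝ (entry Rv a l) (0, t) (1, 0)) 0 := by
  have h0 : HasDerivAt (fun ε : ℝ => (ε, t)) (1, 0) 0 :=
    (hasDerivAt_id (0 : ℝ)).prodMk (hasDerivAt_const (0 : ℝ) t)
  have h2 : HasFDerivAt (entry Rv a l) (fderiv ℝ (entry Rv a l) (0, t)) (0, t) :=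
    ((h.contDiff a l).differentiable two_ne_zero (0, t)).hasFDerivAt
  exact h2.comp_hasDerivAt_of_eq (0 : ℝ) h0 rfl

theorem angle_eq_zero (h : IsRotationVariation t₁ t₂ R Rv) (k : Fin 3) {t : ℝ}
    (ht : ∀ ε, Rv ε t = R t) : angle Rv t k = 0 := by
  unfold angle spin
  refine Finset.sum_eq_zero fun l _ => ?_
  have h1 := h.hasDerivAt_entry t (k + 2) l
  simp only [ht] at h1
  rw [h1.unique (hasDerivAt_const 0 _), zero_mul]

/-- `δω = φ̇ + φ ∧ ω`. -/
theorem angularVelocity_variation (h : IsRotationVariation t₁ t₂ R Rv) (t : ℝ) (k : Fin 3) :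
    fderiv ℝ (spin (entry Rv) (0, 1) (k + 2) (k + 1)) (0, t) (1, 0) = angleDeriv Rv t k
      + (angle Rv t (k + 1) * angularVelocity R t (k + 2)
        - angle Rv t (k + 2) * angularVelocity R t (k + 1)) := by
  have hrow : ∀ p a b, ∑ l, entry Rv a l p * entry Rv b l p = if a = b then 1 else 0 :=
    fun p => row_orthonormal (Rv p.1 p.2)
  have hcol : ∀ p a b, ∑ l, entry Rv l a p * entry Rv l b p = if a = b then 1 else 0 :=
    fun p => col_orthonormal (Rv p.1 p.2)
  -- The structure equation in the directions of `ε` and `t`. Skew symmetry leaves three independent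
  -- entries for each direction, and the quadratic term becomes the vector product.
  have h1 := fderiv_spin_sub (r := entry Rv) h.contDiff hcol (1, 0) (0, 1) (k + 2) (k + 1) (0, t)
  have h2 : ∀ k, angularVelocity R t k = spin (entry Rv) (0, 1) (k + 2) (k + 1) (0, t) := fun k => by
    rw [← h.angularVelocity_eq_spin]
    rw [show Rv 0 = R from funext h.at_zero]
  have h3 := fun v a b => spin_skew (r := entry Rv) h.contDiff hrow v a b (0, t)
  have h4 := fun v a => h3 v a a
  simp only [h2, angle, angleDeriv]
  rw [Fin.sum_univ_three] at h1
  have ha := h3 (1, 0) 0 1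
  have hb := h3 (1, 0) 0 2
  have hc := h3 (1, 0) 1 2
  have hd := h3 (0, 1) 0 1
  have he := h3 (0, 1) 0 2
  have hf := h3 (0, 1) 1 2
  have e0 : ∀ v a, spin (entry Rv) v a a (0, t) = 0 := fun v a => by linarith [h4 v a]
  rw [sub_eq_iff_eq_add] at h1
  rw [h1]
  fin_cases k <;> simp only [Fin.reduceFinMk, Fin.isValue, Fin.zero_eta, Fin.mk_one, zero_add,
    Fin.reduceAdd, e0, ha, hb, hc, hd, he, hf] <;> ring

end IsRotationVariation

/-! ### The Lagrangian of the particle and its first variation. -/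

theorem ParamDiff.congr {t₁ t₂ : ℝ} {L L' M M' : ℝ → ℝ → ℝ} (hL : ParamDiff t₁ t₂ L L')
    (h : ∀ ε t, M ε t = L ε t) (h' : ∀ ε t, M' ε t = L' ε t) : ParamDiff t₁ t₂ M M' := by
  obtain rfl : M = L := funext fun ε => funext (h ε)
  obtain rfl : M' = L' := funext fun ε => funext (h' ε)
  exact hL

theorem ParamDiff.continuousOn_deriv_slice {t₁ t₂ : ℝ} {L L' : ℝ → ℝ → ℝ}
    (hL : ParamDiff t₁ t₂ L L') (ε : ℝ) : ContinuousOn (L' ε) (Icc t₁ t₂) :=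
  hL.continuousOn_deriv.comp (f := fun t => (ε, t)) (Continuous.continuousOn (by fun_prop))
    fun _ ht => ⟨mem_univ _, ht⟩

theorem integral_deriv_eq_zero {t₁ t₂ : ℝ} (ht : t₁ ≤ t₂) {W W' : ℝ → ℝ}
    (hW : ContinuousOn W (Icc t₁ t₂)) (hd : ∀ t ∈ Ioo t₁ t₂, HasDerivAt W (W' t) t)
    (hW' : ContinuousOn W' (Icc t₁ t₂)) (hends : W t₁ = W t₂) : ∫ t in t₁..t₂, W' t = 0 := by
  rw [intervalIntegral.integral_eq_sub_of_hasDerivAt_of_le ht hW hd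
    (hW'.intervalIntegrable_of_Icc ht), hends, sub_self]

theorem contDiff_coord {n : WithTop ℕ∞} {q : ℝ → Space} (hq : ContDiff ℝ n q) (i : Fin 3) :
    ContDiff ℝ n fun t => q t i :=
  contDiff_euclidean.1 hq i

theorem contDiff_deriv_coord {q : ℝ → Space} (hq : ContDiff ℝ 2 q) (i : Fin 3) :
    ContDiff ℝ 1 fun t => deriv q t i :=
  contDiff_coord (ContDiff.deriv' (n := 1) hq) i

theorem hasDerivAt_coord {q : ℝ → Space} {q' : Space} {t : ℝ} (hq : HasDerivAt q q' t)
    (i : Fin 3) : HasDerivAt (fun t => q t i) (q' i) t :=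
  (EuclideanSpace.proj (𝕜 := ℝ) i).hasFDerivAt.comp_hasDerivAt t hq

/-- The interaction of the particle with the potentials, reduced to functions of time and position:
the averaged scalar potential, the averaged vector potential, and its averaged moment. -/
structure Coupling where
  scal : ℝ × Space → ℝ
  vec : Fin 3 → ℝ × Space → ℝ
  mom : Fin 3 → ℝ × Space → ℝ

/-- Derivatives of the functions in a `Coupling`. -/
structure CouplingDeriv where
  scal : ℝ × Space → ℝ × Space →L[ℝ] ℝ
  vec : Fin 3 → ℝ × Space → ℝ × Space →L[ℝ] ℝ
  mom : Fin 3 → ℝ × Space → ℝ × Space →L[ℝ] ℝ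

/-- The functions in a coupling are continuously differentiable up to the end points. -/
structure Coupling.Diff (t₁ t₂ : ℝ) (c : Coupling) (c' : CouplingDeriv) : Prop where
  scal : DiffUpToEnds t₁ t₂ c.scal c'.scal
  vec : ∀ i, DiffUpToEnds t₁ t₂ (c.vec i) (c'.vec i)
  mom : ∀ i, DiffUpToEnds t₁ t₂ (c.mom i) (c'.mom i)

/-- The coupling term of the Lagrangian of the particle. -/
def Coupling.lagr (c : Coupling) (v w : Fin 3 → ℝ) (p : ℝ × Space) : ℝ :=
  -c.scal p + ∑ i, v i * c.vec i p + ∑ i, w i * c.mom i p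

/-- The Lagrangian of the particle along a variation. -/
def particleLagrangian (I : ℝ) (c δc : Coupling) (q δq : ℝ → Space) (Rv : ℝ → ℝ → SO3)
    (ε t : ℝ) : ℝ :=
  1 / 2 * ∑ i, (deriv q t i + ε * deriv δq t i) ^ 2
    + 1 / 2 * I * ∑ i, angularVelocity (Rv ε) t i ^ 2
    + (c.lagr (fun i => deriv q t i + ε * deriv δq t i) (angularVelocity (Rv ε) t)
        (t, q t + ε • δq t)
      + ε * δc.lagr (fun i => deriv q t i + ε * deriv δq t i) (angularVelocity (Rv ε) t)
        (t, q t + ε • δq t))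

open IsRotationVariation

section

variable {t₁ t₂ : ℝ} {c δc : Coupling} {c' δc' : CouplingDeriv} {q δq : ℝ → Space}
  {R : ℝ → SO3} {Rv : ℝ → ℝ → SO3}

/-- The force on the particle minus the time derivative of the part of its momentum which is due to
the potentials. -/
def CouplingDeriv.force (c' : CouplingDeriv) (q : ℝ → Space) (R : ℝ → SO3) (t : ℝ) (i : Fin 3) :
    ℝ :=
  -c'.scal (t, q t) (spaceDir i) + ∑ j, deriv q t j * c'.vec j (t, q t) (spaceDir i)
    + ∑ j, angularVelocity R t j * c'.mom j (t, q t) (spaceDir i)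
    - c'.vec i (t, q t) (1, deriv q t)

/-- The torque on the particle. -/
def Coupling.torque (c : Coupling) (c' : CouplingDeriv) (q : ℝ → Space) (R : ℝ → SO3) (t : ℝ)
    (i : Fin 3) : ℝ :=
  angularVelocity R t (i + 1) * c.mom (i + 2) (t, q t)
    - angularVelocity R t (i + 2) * c.mom (i + 1) (t, q t)
    - c'.mom i (t, q t) (1, deriv q t)

/-- The derivative of `particleLagrangian` in the parameter. -/
def particleLagrangianDeriv (I : ℝ) (c δc : Coupling) (c' δc' : CouplingDeriv)
    (q δq : ℝ → Space) (Rv : ℝ → ℝ → SO3) (ε t : ℝ) : ℝ :=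
  ∑ i, (deriv q t i + ε * deriv δq t i) * deriv δq t i
    + I * ∑ i, angularVelocity (Rv ε) t i
      * fderiv ℝ (spin (entry Rv) (0, 1) (i + 2) (i + 1)) (ε, t) (1, 0)
    + (-c'.scal (t, q t + ε • δq t) (0, δq t)
      + ∑ i, (deriv δq t i * c.vec i (t, q t + ε • δq t)
        + (deriv q t i + ε * deriv δq t i) * c'.vec i (t, q t + ε • δq t) (0, δq t))
      + ∑ i, (fderiv ℝ (spin (entry Rv) (0, 1) (i + 2) (i + 1)) (ε, t) (1, 0)
          * c.mom i (t, q t + ε • δq t)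
        + angularVelocity (Rv ε) t i * c'.mom i (t, q t + ε • δq t) (0, δq t)))
    + (δc.lagr (fun i => deriv q t i + ε * deriv δq t i) (angularVelocity (Rv ε) t)
        (t, q t + ε • δq t)
      + ε * (-δc'.scal (t, q t + ε • δq t) (0, δq t)
        + ∑ i, (deriv δq t i * δc.vec i (t, q t + ε • δq t)
          + (deriv q t i + ε * deriv δq t i) * δc'.vec i (t, q t + ε • δq t) (0, δq t))
        + ∑ i, (fderiv ℝ (spin (entry Rv) (0, 1) (i + 2) (i + 1)) (ε, t) (1, 0)
            * δc.mom i (t, q t + ε • δq t)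
          + angularVelocity (Rv ε) t i * δc'.mom i (t, q t + ε • δq t) (0, δq t))))

theorem paramDiff_velocity (hq : ContDiff ℝ 2 q) (hδq : ContDiff ℝ 2 δq) (i : Fin 3) :
    ParamDiff t₁ t₂ (fun ε t => deriv q t i + ε * deriv δq t i) (fun _ t => deriv δq t i) := by
  have h1 := (contDiff_deriv_coord hq i).continuous.continuousOn (s := Icc t₁ t₂)
  have h2 := (contDiff_deriv_coord hδq i).continuous.continuousOn (s := Icc t₁ t₂)
  exact ((ParamDiff.of_time h1).add (ParamDiff.param.mul (ParamDiff.of_time h2))).congr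
    (fun _ _ => rfl) fun ε t => by ring

theorem paramDiff_lagr (hc : c.Diff t₁ t₂ c') (hq : ContDiff ℝ 2 q) (hδq : ContDiff ℝ 2 δq)
    (hRv : IsRotationVariation t₁ t₂ R Rv) :
    ParamDiff t₁ t₂ (fun ε t => c.lagr (fun i => deriv q t i + ε * deriv δq t i)
        (angularVelocity (Rv ε) t) (t, q t + ε • δq t))
      (fun ε t => -c'.scal (t, q t + ε • δq t) (0, δq t)
        + ∑ i, (deriv δq t i * c.vec i (t, q t + ε • δq t)
          + (deriv q t i + ε * deriv δq t i) * c'.vec i (t, q t + ε • δq t) (0, δq t))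
        + ∑ i, (fderiv ℝ (spin (entry Rv) (0, 1) (i + 2) (i + 1)) (ε, t) (1, 0)
            * c.mom i (t, q t + ε • δq t)
          + angularVelocity (Rv ε) t i * c'.mom i (t, q t + ε • δq t) (0, δq t))) := by
  have h := fun {U U'} (hU : DiffUpToEnds t₁ t₂ U U') =>
    ParamDiff.comp_line hU hq.continuous hδq.continuous
  refine (((((ParamDiff.const (-1)).mul (h hc.scal)).add
    (ParamDiff.sum Finset.univ fun i _ => (paramDiff_velocity hq hδq i).mul (h (hc.vec i)))).add
    (ParamDiff.sum Finset.univ fun i _ =>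
      (hRv.paramDiff_angularVelocity i).mul (h (hc.mom i))))).congr (fun ε t => ?_) fun ε t => ?_
  · simp only [Coupling.lagr]; ring
  · ring

theorem paramDiff_particleLagrangian (I : ℝ) (hc : c.Diff t₁ t₂ c') (hδc : δc.Diff t₁ t₂ δc')
    (hq : ContDiff ℝ 2 q) (hδq : ContDiff ℝ 2 δq) (hRv : IsRotationVariation t₁ t₂ R Rv) :
    ParamDiff t₁ t₂ (particleLagrangian I c δc q δq Rv)
      (particleLagrangianDeriv I c δc c' δc' q δq Rv) := by
  have hv := ParamDiff.sum (Finset.univ : Finset (Fin 3)) fun i _ =>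
    (paramDiff_velocity (t₁ := t₁) (t₂ := t₂) hq hδq i).mul (paramDiff_velocity hq hδq i)
  have hw := ParamDiff.sum (Finset.univ : Finset (Fin 3)) fun i _ =>
    (hRv.paramDiff_angularVelocity i).mul (hRv.paramDiff_angularVelocity i)
  refine ((((ParamDiff.const (1 / 2)).mul hv).add ((ParamDiff.const (1 / 2 * I)).mul hw)).add
    ((paramDiff_lagr hc hq hδq hRv).add
      (ParamDiff.param.mul (paramDiff_lagr hδc hq hδq hRv)))).congr (fun ε t => ?_) fun ε t => ?_
  · simp only [particleLagrangian, pow_two]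
  · simp only [particleLagrangianDeriv, Fin.sum_univ_three]
    ring

theorem continuousOn_along {F : Type*} [TopologicalSpace F] {U : ℝ × Space → F}
    (hU : ContinuousOn U (Icc t₁ t₂ ×ˢ univ)) (hq : Continuous q) :
    ContinuousOn (fun t => U (t, q t)) (Icc t₁ t₂) :=
  hU.comp (Continuous.continuousOn (by fun_prop)) fun t ht => ⟨ht, mem_univ (q t)⟩

theorem DiffUpToEnds.hasDerivAt_along {U : ℝ × Space → ℝ} {U' : ℝ × Space → ℝ × Space →L[ℝ] ℝ}
    (hU : DiffUpToEnds t₁ t₂ U U') (hq : Differentiable ℝ q) {t : ℝ} (ht : t ∈ Ioo t₁ t₂) :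
    HasDerivAt (fun t => U (t, q t)) (U' (t, q t) (1, deriv q t)) t :=
  (hU.hasFDerivAt (t, q t) ht).comp_hasDerivAt t ((hasDerivAt_id t).prodMk (hq t).hasDerivAt)

theorem DiffUpToEnds.continuousOn_deriv_along {U : ℝ × Space → ℝ}
    {U' : ℝ × Space → ℝ × Space →L[ℝ] ℝ} (hU : DiffUpToEnds t₁ t₂ U U') (hq : ContDiff ℝ 2 q) :
    ContinuousOn (fun t => U' (t, q t) (1, deriv q t)) (Icc t₁ t₂) :=
  (continuousOn_along hU.continuousOn_deriv hq.continuous).clm_apply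
    (by have := hq.continuous_deriv (by norm_num); exact Continuous.continuousOn (by fun_prop))

theorem apply_zero_prod (T : ℝ × Space →L[ℝ] ℝ) (v : Space) :
    T (0, v) = ∑ i, v i * T (spaceDir i) := by
  have h : ((0 : ℝ), v) = ∑ i, v i • spaceDir i := by
    refine Prod.ext ?_ ?_
    · simp [Prod.fst_sum, spaceDir]
    · ext j
      simp [Prod.snd_sum, spaceDir, Pi.single_apply]
  rw [h, map_sum]
  simp

/-- Arranged for integration by parts: `δq̇` and `φ̇` multiply the conjugate momenta, `q̇` plus the
averaged vector potential and `I ω` plus its averaged moment. The force and torque contain minus the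
time derivative of the potential part of these momenta, which is therefore added back. In the
torque, `(φ ∧ ω) · M = φ · (ω ∧ M)`, while `(φ ∧ ω) · Iω = 0`. -/
theorem particleLagrangianDeriv_zero (I : ℝ) (c δc : Coupling) (c' δc' : CouplingDeriv)
    (q δq : ℝ → Space) (hRv : IsRotationVariation t₁ t₂ R Rv) (t : ℝ) :
    particleLagrangianDeriv I c δc c' δc' q δq Rv 0 t
      = δc.lagr (fun i => deriv q t i) (angularVelocity R t) (t, q t)
        + ∑ i, (δq t i * (c'.force q R t i + c'.vec i (t, q t) (1, deriv q t))
          + (deriv q t i + c.vec i (t, q t)) * deriv δq t i)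
        + ∑ i, (angle Rv t i * (c.torque c' q R t i + c'.mom i (t, q t) (1, deriv q t))
          + (I * angularVelocity R t i + c.mom i (t, q t)) * angleDeriv Rv t i) := by
  have hR0 : Rv 0 = R := funext hRv.at_zero
  simp only [particleLagrangianDeriv, zero_smul, add_zero, zero_mul, hR0,
    hRv.angularVelocity_variation, CouplingDeriv.force, Coupling.torque,
    apply_zero_prod _ (δq t), Fin.sum_univ_three, Fin.isValue, zero_add, Fin.reduceAdd]
  ring

/-- Integration by parts in the first variation of the action of the particle. -/
theorem integral_particleLagrangianDeriv (I : ℝ) (ht : t₁ ≤ t₂) (hc : c.Diff t₁ t₂ c')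
    (hδc : δc.Diff t₁ t₂ δc') (hq : ContDiff ℝ 2 q) (hδq : ContDiff ℝ 2 δq)
    (h1 : δq t₁ = 0) (h2 : δq t₂ = 0) (hR : SmoothPath R)
    (hRv : IsRotationVariation t₁ t₂ R Rv) :
    ∫ t in t₁..t₂, particleLagrangianDeriv I c δc c' δc' q δq Rv 0 t
      = ∫ t in t₁..t₂, (δc.lagr (fun i => deriv q t i) (angularVelocity R t) (t, q t)
        + ∑ i, δq t i * (c'.force q R t i - deriv (deriv q) t i)
        + ∑ i, angle Rv t i * (c.torque c' q R t i
          - I * deriv (fun s => angularVelocity R s i) t)) := by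
  -- `W` pairs the conjugate momenta with the variations. It vanishes at both ends, so subtracting
  -- its derivative does not change the integral.
  set W : ℝ → ℝ := fun t => ∑ i, (deriv q t i + c.vec i (t, q t)) * δq t i
    + ∑ i, (I * angularVelocity R t i + c.mom i (t, q t)) * angle Rv t i with hWdef
  set W' : ℝ → ℝ := fun t =>
    ∑ i, ((deriv (deriv q) t i + c'.vec i (t, q t) (1, deriv q t)) * δq t i
      + (deriv q t i + c.vec i (t, q t)) * deriv δq t i)
    + ∑ i, ((I * deriv (fun s => angularVelocity R s i) t + c'.mom i (t, q t) (1, deriv q t))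
        * angle Rv t i
      + (I * angularVelocity R t i + c.mom i (t, q t)) * angleDeriv Rv t i) with hW'def
  have hqd : Differentiable ℝ q := hq.differentiable two_ne_zero
  have hδqd : Differentiable ℝ δq := hδq.differentiable two_ne_zero
  have hq1 : ContDiff ℝ 1 (deriv q) := ContDiff.deriv' (n := 1) hq
  have hq2 : Continuous (deriv (deriv q)) := hq1.continuous_deriv le_rfl
  have hω := fun i => contDiff_angularVelocity hR i
  have cq2 : ∀ i, ContinuousOn (fun t => deriv (deriv q) t i) (Icc t₁ t₂) := fun i =>
    ((EuclideanSpace.proj i : Space →L[ℝ] ℝ).continuous.comp hq2).continuousOn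
  have cq1 : ∀ i, ContinuousOn (fun t => deriv q t i) (Icc t₁ t₂) := fun i =>
    (contDiff_deriv_coord hq i).continuous.continuousOn
  have cδ0 : ∀ i, ContinuousOn (fun t => δq t i) (Icc t₁ t₂) := fun i =>
    (contDiff_coord hδq i).continuous.continuousOn
  have cδ1 : ∀ i, ContinuousOn (fun t => deriv δq t i) (Icc t₁ t₂) := fun i =>
    (contDiff_deriv_coord hδq i).continuous.continuousOn
  have cω : ∀ i, ContinuousOn (fun t => angularVelocity R t i) (Icc t₁ t₂) := fun i =>
    (hω i).continuous.continuousOn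
  have cω1 : ∀ i, ContinuousOn (fun t => deriv (fun s => angularVelocity R s i) t) (Icc t₁ t₂) :=
    fun i => ((hω i).continuous_deriv le_rfl).continuousOn
  have dφ := fun i t => hRv.hasDerivAt_angle i t
  have cφ : ∀ i, ContinuousOn (fun t => angle Rv t i) (Icc t₁ t₂) := fun i t _ =>
    (dφ i t).continuousAt.continuousWithinAt
  have cφ1 : ∀ i, ContinuousOn (fun t => angleDeriv Rv t i) (Icc t₁ t₂) := fun i =>
    (hRv.continuous_angleDeriv i).continuousOn
  have cS := fun i => continuousOn_along (hc.vec i).continuousOn hq.continuous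
  have cM := fun i => continuousOn_along (hc.mom i).continuousOn hq.continuous
  have cS' := fun i => (hc.vec i).continuousOn_deriv_along hq
  have cM' := fun i => (hc.mom i).continuousOn_deriv_along hq
  have hW : ContinuousOn W (Icc t₁ t₂) :=
    (continuousOn_finsetSum _ fun i _ => ((cq1 i).add (cS i)).mul (cδ0 i)).add
      (continuousOn_finsetSum _ fun i _ =>
        ((continuousOn_const.mul (cω i)).add (cM i)).mul (cφ i))
  have hW' : ContinuousOn W' (Icc t₁ t₂) :=
    (continuousOn_finsetSum _ fun i _ => (((cq2 i).add (cS' i)).mul (cδ0 i)).add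
      (((cq1 i).add (cS i)).mul (cδ1 i))).add
      (continuousOn_finsetSum _ fun i _ =>
        (((continuousOn_const.mul (cω1 i)).add (cM' i)).mul (cφ i)).add
        (((continuousOn_const.mul (cω i)).add (cM i)).mul (cφ1 i)))
  have hd : ∀ t ∈ Ioo t₁ t₂, HasDerivAt W (W' t) t := fun t ht' => by
    have hda : ∀ i, HasDerivAt (fun t => (deriv q t i + c.vec i (t, q t)) * δq t i)
        ((deriv (deriv q) t i + c'.vec i (t, q t) (1, deriv q t)) * δq t i
          + (deriv q t i + c.vec i (t, q t)) * deriv δq t i) t := fun i =>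
      ((hasDerivAt_coord (hq1.differentiable one_ne_zero t).hasDerivAt i).fun_add
        ((hc.vec i).hasDerivAt_along hqd ht')).fun_mul (hasDerivAt_coord (hδqd t).hasDerivAt i)
    have hdb : ∀ i, HasDerivAt
        (fun t => (I * angularVelocity R t i + c.mom i (t, q t)) * angle Rv t i)
        ((I * deriv (fun s => angularVelocity R s i) t + c'.mom i (t, q t) (1, deriv q t))
            * angle Rv t i
          + (I * angularVelocity R t i + c.mom i (t, q t)) * angleDeriv Rv t i) t := fun i =>
      (((((hω i).differentiable one_ne_zero t).hasDerivAt).const_mul I).fun_add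
        ((hc.mom i).hasDerivAt_along hqd ht')).fun_mul (dφ i t)
    exact (HasDerivAt.fun_sum fun i _ => hda i).fun_add (HasDerivAt.fun_sum fun i _ => hdb i)
  have hends : W t₁ = W t₂ := by
    simp [hWdef, h1, h2, hRv.angle_eq_zero _ hRv.left_end, hRv.angle_eq_zero _ hRv.right_end]
  have hzero := integral_deriv_eq_zero ht hW hd hW' hends
  have hraw := (paramDiff_particleLagrangian I hc hδc hq hδq hRv).continuousOn_deriv_slice 0
  have hsub := intervalIntegral.integral_sub (hraw.intervalIntegrable_of_Icc (μ := volume) ht)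
    (hW'.intervalIntegrable_of_Icc ht)
  rw [hzero, sub_zero] at hsub
  rw [← hsub]
  refine intervalIntegral.integral_congr fun t _ => ?_
  simp only [hW'def, particleLagrangianDeriv_zero I c δc c' δc' q δq hRv, Fin.sum_univ_three]
  ring

end

/-! ### Coupling of the particle to potentials -/

/-- `f` is integrable over space with integral `I`. -/
structure HasSpaceIntegral (f : Space → ℝ) (I : ℝ) : Prop where
  integrable : Integrable f
  integral_eq : ∫ x, f x = I

namespace HasSpaceIntegral

variable {f g : Space → ℝ} {I J : ℝ}

theorem add (hf : HasSpaceIntegral f I) (hg : HasSpaceIntegral g J) :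
    HasSpaceIntegral (fun x => f x + g x) (I + J) :=
  ⟨hf.integrable.add hg.integrable, by
    rw [integral_add hf.integrable hg.integrable, hf.integral_eq, hg.integral_eq]⟩

theorem sub (hf : HasSpaceIntegral f I) (hg : HasSpaceIntegral g J) :
    HasSpaceIntegral (fun x => f x - g x) (I - J) :=
  ⟨hf.integrable.sub hg.integrable, by
    rw [integral_sub hf.integrable hg.integrable, hf.integral_eq, hg.integral_eq]⟩

theorem const_mul (hf : HasSpaceIntegral f I) (c : ℝ) :
    HasSpaceIntegral (fun x => c * f x) (c * I) :=
  ⟨hf.integrable.const_mul c, by rw [integral_const_mul, hf.integral_eq]⟩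

theorem sum {ι : Type*} (s : Finset ι) {f : ι → Space → ℝ} {I : ι → ℝ}
    (h : ∀ i, HasSpaceIntegral (f i) (I i)) :
    HasSpaceIntegral (fun x => ∑ i ∈ s, f i x) (∑ i ∈ s, I i) :=
  ⟨integrable_finsetSum _ fun i _ => (h i).integrable, by
    rw [integral_finsetSum _ fun i _ => (h i).integrable]
    exact Finset.sum_congr rfl fun i _ => (h i).integral_eq⟩

theorem congr (hf : HasSpaceIntegral f I) (h : ∀ x, g x = f x) (h' : J = I) :
    HasSpaceIntegral g J := by
  rw [show g = f from funext h, h']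
  exact hf

theorem translate (hf : HasSpaceIntegral f I) (z : Space) :
    HasSpaceIntegral (fun x => f (x - z)) I :=
  ⟨hf.integrable.comp_sub_right z, by rw [integral_sub_right_eq_self, hf.integral_eq]⟩

end HasSpaceIntegral

variable {ρ : Space → ℝ} {t₁ t₂ t : ℝ} {f a₀ b₀ : ℝ × Space → ℝ} {a b : Fin 3 → ℝ × Space → ℝ}

/-- The coupling of the charge `ρ` to given potentials. -/
def coupling (ρ : Space → ℝ) (a₀ : ℝ × Space → ℝ) (a : Fin 3 → ℝ × Space → ℝ) : Coupling where
  scal := smear ρ a₀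
  vec i := smear ρ (a i)
  mom i p := smear (fun y => ρ y * y (i + 1)) (a (i + 2)) p
    - smear (fun y => ρ y * y (i + 2)) (a (i + 1)) p

/-- The derivative of `coupling`. -/
def couplingDeriv (ρ : Space → ℝ) (a₀ : ℝ × Space → ℝ) (a : Fin 3 → ℝ × Space → ℝ) :
    CouplingDeriv where
  scal := smear ρ (fderiv ℝ a₀)
  vec i := smear ρ (fderiv ℝ (a i))
  mom i p := smear (fun y => ρ y * y (i + 1)) (fderiv ℝ (a (i + 2))) p
    - smear (fun y => ρ y * y (i + 2)) (fderiv ℝ (a (i + 1))) p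

theorem coupling_diff (hρ : RapidDecay ρ) (h0 : ModerateC1 t₁ t₂ a₀)
    (h : ∀ i, ModerateC1 t₁ t₂ (a i)) :
    (coupling ρ a₀ a).Diff t₁ t₂ (couplingDeriv ρ a₀ a) :=
  ⟨h0.diffUpToEnds_smear hρ, fun i => (h i).diffUpToEnds_smear hρ, fun i =>
    ((h (i + 2)).diffUpToEnds_smear (hρ.mul_coord (i + 1))).sub
      ((h (i + 1)).diffUpToEnds_smear (hρ.mul_coord (i + 2)))⟩

theorem ModerateC1.const_mul (hf : ModerateC1 t₁ t₂ f) (c : ℝ) :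
    ModerateC1 t₁ t₂ fun p => c * f p := by
  obtain ⟨C, N, hC0, hC⟩ := hf.bound
  refine ⟨contDiff_const.mul hf.contDiff, |c| * C, N, by positivity, fun t ht x => ?_⟩
  rw [fderiv_const_mul (hf.differentiable _), norm_smul, Real.norm_eq_abs, abs_mul, mul_assoc]
  exact ⟨mul_le_mul_of_nonneg_left (hC t ht x).1 (abs_nonneg c),
    mul_le_mul_of_nonneg_left (hC t ht x).2 (abs_nonneg c)⟩

theorem coupling_lagr_add_mul (hρ : RapidDecay ρ) (h0 : ModerateC1 t₁ t₂ a₀)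
    (h : ∀ i, ModerateC1 t₁ t₂ (a i)) (h0' : ModerateC1 t₁ t₂ b₀)
    (h' : ∀ i, ModerateC1 t₁ t₂ (b i)) (ε : ℝ) (v w : Fin 3 → ℝ) {p : ℝ × Space}
    (hp : p.1 ∈ Icc t₁ t₂) :
    (coupling ρ (fun p => a₀ p + ε * b₀ p) fun i p => a i p + ε * b i p).lagr v w p
      = (coupling ρ a₀ a).lagr v w p + ε * (coupling ρ b₀ b).lagr v w p := by
  have hs : ∀ {w : Space → ℝ} {f g : ℝ × Space → ℝ}, RapidDecay w → ModerateC1 t₁ t₂ f →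
      ModerateC1 t₁ t₂ g →
      smear w (fun p => f p + ε * g p) p = smear w f p + ε * smear w g p := fun hw hf hg => by
    rw [hf.smear_add (hg.const_mul ε) hw hp, smear_const_mul]
  simp only [Coupling.lagr, coupling, hs hρ h0 h0', hs hρ (h _) (h' _),
    hs (hρ.mul_coord _) (h _) (h' _), Fin.sum_univ_three]
  ring

theorem ModerateC1.hasSpaceIntegral (hf : ModerateC1 t₁ t₂ f) {w : Space → ℝ} (hw : RapidDecay w)
    (ht : t ∈ Icc t₁ t₂) (z : Space) :
    HasSpaceIntegral (fun y => w y * f (t, z + y)) (smear w f (t, z)) :=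
  ⟨hf.integrable hw (p := (t, z)) ht, rfl⟩

theorem ModerateC1.hasSpaceIntegral_dirDeriv (hf : ModerateC1 t₁ t₂ f) {w : Space → ℝ}
    (hw : RapidDecay w) (ht : t ∈ Icc t₁ t₂) (z : Space) (v : ℝ × Space) :
    HasSpaceIntegral (fun y => w y * dirDeriv v f (t, z + y)) (smear w (fderiv ℝ f) (t, z) v) :=
  ⟨hf.integrable_dirDeriv hw v (p := (t, z)) ht, (hf.smear_fderiv_apply hw (p := (t, z)) ht v).symm⟩

theorem hasSpaceIntegral_coupling_scal (hρ : RapidDecay ρ) (h0 : ModerateC1 t₁ t₂ a₀)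
    (ht : t ∈ Icc t₁ t₂) (z : Space) :
    HasSpaceIntegral (fun x => a₀ (t, x) * ρ (x - z)) ((coupling ρ a₀ a).scal (t, z)) :=
  ((h0.hasSpaceIntegral hρ ht z).translate z).congr
    (fun x => by rw [add_sub_cancel, mul_comm]) rfl

/-- Substitute `x = z + y` and use `(w ∧ y) · A = w · (y ∧ A)`. -/
theorem hasSpaceIntegral_coupling_vec (hρ : RapidDecay ρ) (h : ∀ i, ModerateC1 t₁ t₂ (a i))
    (ht : t ∈ Icc t₁ t₂) (z v w : Space) :
    HasSpaceIntegral (fun x => (∑ i, (v i + cross w (x - z) i) * a i (t, x)) * ρ (x - z))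
      (∑ i, v i * (coupling ρ a₀ a).vec i (t, z) + ∑ i, w i * (coupling ρ a₀ a).mom i (t, z)) := by
  have h1 := HasSpaceIntegral.sum (Finset.univ : Finset (Fin 3)) fun i =>
    ((h i).hasSpaceIntegral hρ ht z).const_mul (v i)
  have h2 := HasSpaceIntegral.sum (Finset.univ : Finset (Fin 3)) fun i =>
    (((h (i + 2)).hasSpaceIntegral (hρ.mul_coord (i + 1)) ht z).sub
      ((h (i + 1)).hasSpaceIntegral (hρ.mul_coord (i + 2)) ht z)).const_mul (w i)
  refine ((h1.add h2).translate z).congr (fun x => ?_) rfl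
  simp only [add_sub_cancel, cross_apply, Fin.sum_univ_three, Fin.isValue, zero_add, Fin.reduceAdd]
  ring

/-! ### Force and torque -/

theorem dirDeriv_one_prod (u : Space) (f : ℝ × Space → ℝ) (p : ℝ × Space) :
    dirDeriv (1, u) f p = dirDeriv timeDir f p + ∑ i, u i * dirDeriv (spaceDir i) f p := by
  simp only [dirDeriv, ← apply_zero_prod, timeDir, ← map_add]
  simp

/-- `g` is `C¹` on space and it grows, with its derivative, at most polynomially. -/
structure SpaceModerate (g : Space → ℝ) : Prop where
  contDiff : ContDiff ℝ 1 g
  bound : ∃ (C : ℝ) (N : ℕ), 0 ≤ C ∧ ∀ x, |g x| ≤ C * (1 + ‖x‖) ^ N ∧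
    ‖fderiv ℝ g x‖ ≤ C * (1 + ‖x‖) ^ N

theorem ModerateC1.spaceModerate (hf : ModerateC1 t₁ t₂ f) (ht : t ∈ Icc t₁ t₂) (z : Space) :
    SpaceModerate fun y => f (t, z + y) := by
  obtain ⟨C, N, hC0, hC⟩ := hf.bound
  refine ⟨hf.contDiff.comp (contDiff_const.prodMk (contDiff_const.add contDiff_id)),
    C * (1 + ‖z‖) ^ N, N, by positivity, fun y => ?_⟩
  have h1 : C * (1 + ‖z + y‖) ^ N ≤ C * (1 + ‖z‖) ^ N * (1 + ‖y‖) ^ N := by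
    rw [mul_assoc, ← mul_pow]
    gcongr
    nlinarith [norm_add_le z y, norm_nonneg z, norm_nonneg y]
  refine ⟨(hC t ht _).1.trans h1, le_trans ?_ ((hC t ht _).2.trans h1)⟩
  rw [fderiv_comp_add_left (f := fun x => f (t, x)), (hasFDerivAt_slice (hf.differentiable _)).fderiv]
  refine (ContinuousLinearMap.opNorm_comp_le _ _).trans (mul_le_of_le_one_right (norm_nonneg _) ?_)
  exact ContinuousLinearMap.norm_inr_le_one ℝ ℝ Space

theorem SpaceModerate.coord_mul {g : Space → ℝ} (hg : SpaceModerate g) (l : Fin 3) :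
    SpaceModerate fun y => y l * g y := by
  obtain ⟨C, N, hC0, hC⟩ := hg.bound
  have hd : ∀ y, HasFDerivAt (fun y : Space => y l * g y)
      (y l • fderiv ℝ g y + g y • (EuclideanSpace.proj l : Space →L[ℝ] ℝ)) y := fun y =>
    (hasFDerivAt_coord l y).mul (hg.contDiff.differentiable one_ne_zero y).hasFDerivAt
  refine ⟨(EuclideanSpace.proj l : Space →L[ℝ] ℝ).contDiff.mul hg.contDiff, 2 * C, N + 1,
    by positivity, fun y => ⟨?_, ?_⟩⟩
  · rw [abs_mul]
    calc _ ≤ (1 + ‖y‖) * (C * (1 + ‖y‖) ^ N) :=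
          mul_le_mul (abs_coord_le y l) (hC y).1 (abs_nonneg _) (by positivity)
      _ = C * (1 + ‖y‖) ^ (N + 1) := by ring
      _ ≤ _ := by gcongr; linarith
  · rw [(hd y).fderiv]
    have h1 : ‖y l • fderiv ℝ g y‖ ≤ (1 + ‖y‖) * (C * (1 + ‖y‖) ^ N) := by
      rw [norm_smul]
      exact mul_le_mul (abs_coord_le y l) (hC y).2 (norm_nonneg _) (by positivity)
    have h2 : ‖g y • (EuclideanSpace.proj l : Space →L[ℝ] ℝ)‖ ≤ C * (1 + ‖y‖) ^ N * 1 := by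
      rw [norm_smul]
      exact mul_le_mul (hC y).1 (norm_euclideanSpace_proj_le l) (norm_nonneg _) (by positivity)
    have h3 : C * (1 + ‖y‖) ^ N * 1 ≤ C * (1 + ‖y‖) ^ N * (1 + ‖y‖) := by
      gcongr; linarith [norm_nonneg y]
    calc _ ≤ _ := norm_add_le _ _
      _ ≤ (1 + ‖y‖) * (C * (1 + ‖y‖) ^ N) + C * (1 + ‖y‖) ^ N * (1 + ‖y‖) :=
        add_le_add h1 (h2.trans h3)
      _ = _ := by ring

theorem IsChargeDensity.hasSpaceIntegral_of_spaceModerate (hρ : IsChargeDensity ρ) {g : Space → ℝ}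
    (hg : SpaceModerate g) (j k : Fin 3) :
    HasSpaceIntegral (fun y => ρ y * (y j * fderiv ℝ g y (EuclideanSpace.single k 1)
      - y k * fderiv ℝ g y (EuclideanSpace.single j 1))) 0 := by
  obtain ⟨C, N, hC0, hC⟩ := hg.bound
  have h1 : ∀ i l, Integrable fun x => ρ x * x i * fderiv ℝ g x (EuclideanSpace.single l 1) :=
    fun i l => (hρ.rapidDecay.mul_coord i).integrable_mul
      ((hg.contDiff.continuous_fderiv one_ne_zero).clm_apply continuous_const)
      (C := C * ‖(EuclideanSpace.single l 1 : Space)‖) (by positivity) fun x => by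
        rw [mul_right_comm]
        exact ((fderiv ℝ g x).le_opNorm _).trans
          (mul_le_mul_of_nonneg_right (hC x).2 (norm_nonneg _))
  refine ⟨((h1 j k).sub (h1 k j)).congr (Filter.Eventually.of_forall fun x => ?_),
    hρ.integral_rotation_eq_zero hg.contDiff hC0 (fun x => (hC x).1) (fun x => (hC x).2) j k⟩
  simp only [Pi.sub_apply]
  ring

theorem ModerateC1.fderiv_translate (hf : ModerateC1 t₁ t₂ f) (z y : Space) (k : Fin 3) :
    fderiv ℝ (fun y => f (t, z + y)) y (EuclideanSpace.single k 1)
      = dirDeriv (spaceDir k) f (t, z + y) := by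
  rw [fderiv_comp_add_left (f := fun x => f (t, x))]
  exact partialDeriv_slice (hf.differentiable _) k

theorem IsChargeDensity.hasSpaceIntegral_rotation (hρ : IsChargeDensity ρ)
    (hf : ModerateC1 t₁ t₂ f) (ht : t ∈ Icc t₁ t₂) (z : Space) (j k : Fin 3) :
    HasSpaceIntegral (fun y => ρ y * (y j * dirDeriv (spaceDir k) f (t, z + y)
      - y k * dirDeriv (spaceDir j) f (t, z + y))) 0 := by
  simpa only [hf.fderiv_translate] using
    hρ.hasSpaceIntegral_of_spaceModerate (hf.spaceModerate ht z) j k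

/-- Rotational invariance applied to `y_l f`, which still grows polynomially; the Kronecker terms
come from differentiating `y_l`. -/
theorem IsChargeDensity.hasSpaceIntegral_rotation_mul_coord (hρ : IsChargeDensity ρ)
    (hf : ModerateC1 t₁ t₂ f) (ht : t ∈ Icc t₁ t₂) (z : Space) (l j k : Fin 3) :
    HasSpaceIntegral (fun y => ρ y *
      (y j * (y l * dirDeriv (spaceDir k) f (t, z + y) + (if l = k then 1 else 0) * f (t, z + y))
      - y k * (y l * dirDeriv (spaceDir j) f (t, z + y)
        + (if l = j then 1 else 0) * f (t, z + y)))) 0 := by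
  have hg := hf.spaceModerate ht z
  have hd : ∀ y i, fderiv ℝ (fun y : Space => y l * f (t, z + y)) y (EuclideanSpace.single i 1)
      = y l * dirDeriv (spaceDir i) f (t, z + y) + (if l = i then 1 else 0) * f (t, z + y) := by
    intro y i
    have h1 : HasFDerivAt (fun y : Space => y l * f (t, z + y)) _ y :=
      (hasFDerivAt_coord l y).mul (hg.contDiff.differentiable one_ne_zero y).hasFDerivAt
    have h2 : (EuclideanSpace.proj l : Space →L[ℝ] ℝ) (EuclideanSpace.single i 1)
        = if l = i then 1 else 0 := coord_single l i
    rw [h1.fderiv, add_apply, smul_apply, smul_apply, hf.fderiv_translate, smul_eq_mul, smul_eq_mul,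
      h2, mul_comm (f (t, z + y))]
  simpa only [hd] using hρ.hasSpaceIntegral_of_spaceModerate (hg.coord_mul l) j k

/-- The components of `E + v ∧ B`. -/
def lorentzForce (a₀ : ℝ × Space → ℝ) (a : Fin 3 → ℝ × Space → ℝ) (v : Fin 3 → ℝ) (i : Fin 3)
    (p : ℝ × Space) : ℝ :=
  electricComp a₀ a i p + (v (i + 1) * curlComp a (i + 2) p - v (i + 2) * curlComp a (i + 1) p)

/-- With `u = q̇ + ω ∧ y`, the identity `u ∧ (∇ ∧ A) = ∑ u_j ∇A_j - (u · ∇)A` expands the Lorentz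
force. The Euler-Lagrange force differentiates the averaged `A` only along `q̇`, so the two differ
by the average of `((ω ∧ y) · ∇)A`, which vanishes since `ρ` is radial. -/
theorem hasSpaceIntegral_force (hρ : IsChargeDensity ρ) (h0 : ModerateC1 t₁ t₂ a₀)
    (h : ∀ i, ModerateC1 t₁ t₂ (a i)) (ht : t ∈ Icc t₁ t₂) (q : ℝ → Space) (R : ℝ → SO3)
    (i : Fin 3) :
    HasSpaceIntegral (fun y => ρ y * lorentzForce a₀ a
        (fun j => deriv q t j + cross (angularVelocity R t) y j) i (t, q t + y))
      ((couplingDeriv ρ a₀ a).force q R t i) := by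
  have hr := hρ.rapidDecay
  have hd := fun {f} (hf : ModerateC1 t₁ t₂ f) {w} (hw : RapidDecay w) v =>
    hf.hasSpaceIntegral_dirDeriv hw ht (q t) v
  have e1 := (hd h0 hr (spaceDir i)).const_mul (-1)
  have e2 := HasSpaceIntegral.sum (Finset.univ : Finset (Fin 3)) fun j =>
    (hd (h j) hr (spaceDir i)).const_mul (deriv q t j)
  have e3 := HasSpaceIntegral.sum (Finset.univ : Finset (Fin 3)) fun j =>
    ((hd (h (j + 2)) (hr.mul_coord (j + 1)) (spaceDir i)).sub
      (hd (h (j + 1)) (hr.mul_coord (j + 2)) (spaceDir i))).const_mul (angularVelocity R t j)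
  have e4 := hd (h i) hr (1, deriv q t)
  -- The vanishing average of `(ω ∧ y) · ∇ = ω · (y ∧ ∇)` applied to the `i`-th component of `A`.
  have e5 := HasSpaceIntegral.sum (Finset.univ : Finset (Fin 3)) fun m =>
    (hρ.hasSpaceIntegral_rotation (h i) ht (q t) (m + 1) (m + 2)).const_mul (angularVelocity R t m)
  refine ((((e1.add e2).add e3).sub e4).sub e5).congr (fun y => ?_) ?_
  · simp only [lorentzForce, electricComp, curlComp_apply, cross_apply, dirDeriv_one_prod,
      Fin.sum_univ_three]
    fin_cases i <;> simp only [Fin.isValue, zero_add, Fin.reduceAdd, Fin.zero_eta, Fin.mk_one,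
      Fin.reduceFinMk] <;> ring
  · simp [CouplingDeriv.force, couplingDeriv]

/-- Write `y ∧ (E + u ∧ B)` in terms of the potentials, with `u = q̇ + ω ∧ y`. The terms absent from
the Euler-Lagrange torque are `ρ`-averages of infinitesimal rotations of `A₀`, `q̇ · A`, `(ω ∧ y) ·
A` and `y ∧ A`, all zero. The products left over from differentiating the coordinates cancel by the
Jacobi identity `ω ∧ (y ∧ A) + y ∧ (A ∧ ω) + A ∧ (ω ∧ y) = 0`. -/
theorem hasSpaceIntegral_torque (hρ : IsChargeDensity ρ) (h0 : ModerateC1 t₁ t₂ a₀)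
    (h : ∀ i, ModerateC1 t₁ t₂ (a i)) (ht : t ∈ Icc t₁ t₂) (q : ℝ → Space) (R : ℝ → SO3)
    (i : Fin 3) :
    HasSpaceIntegral (fun y => ρ y *
        (y (i + 1) * lorentzForce a₀ a
          (fun j => deriv q t j + cross (angularVelocity R t) y j) (i + 2) (t, q t + y)
        - y (i + 2) * lorentzForce a₀ a
          (fun j => deriv q t j + cross (angularVelocity R t) y j) (i + 1) (t, q t + y)))
      ((coupling ρ a₀ a).torque (couplingDeriv ρ a₀ a) q R t i) := by
  have hr := hρ.rapidDecay
  have hM := fun j => ((h (j + 2)).hasSpaceIntegral (hr.mul_coord (j + 1)) ht (q t)).sub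
    ((h (j + 1)).hasSpaceIntegral (hr.mul_coord (j + 2)) ht (q t))
  have e1 := ((hM (i + 2)).const_mul (angularVelocity R t (i + 1))).sub
    ((hM (i + 1)).const_mul (angularVelocity R t (i + 2)))
  have e2 := ((h (i + 2)).hasSpaceIntegral_dirDeriv (hr.mul_coord (i + 1)) ht (q t)
      (1, deriv q t)).sub
    ((h (i + 1)).hasSpaceIntegral_dirDeriv (hr.mul_coord (i + 2)) ht (q t) (1, deriv q t))
  have e3 := hρ.hasSpaceIntegral_rotation h0 ht (q t) (i + 1) (i + 2)
  have e4 := HasSpaceIntegral.sum (Finset.univ : Finset (Fin 3)) fun n =>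
    (hρ.hasSpaceIntegral_rotation (h n) ht (q t) (i + 1) (i + 2)).const_mul (deriv q t n)
  have hr2 := fun n l j k => hρ.hasSpaceIntegral_rotation_mul_coord (h n) ht (q t) l j k
  -- Rotation about the `i`-th axis applied to `(ω ∧ y) · A`, including the factor `ω ∧ y`.
  have e5 := HasSpaceIntegral.sum (Finset.univ : Finset (Fin 3)) fun l =>
    ((hr2 l (l + 2) (i + 1) (i + 2)).const_mul (angularVelocity R t (l + 1))).sub
      ((hr2 l (l + 1) (i + 1) (i + 2)).const_mul (angularVelocity R t (l + 2)))
  -- Rotation about `ω` applied to the `i`-th component of `y ∧ A`.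
  have e6 := HasSpaceIntegral.sum (Finset.univ : Finset (Fin 3)) fun m =>
    ((hr2 (i + 2) (i + 1) (m + 1) (m + 2)).sub
      (hr2 (i + 1) (i + 2) (m + 1) (m + 2))).const_mul (angularVelocity R t m)
  refine ((((e1.sub e2).sub e3).add e4).add (e5.sub e6)).congr (fun y => ?_) ?_
  · simp only [lorentzForce, electricComp, curlComp_apply, cross_apply, dirDeriv_one_prod,
      Fin.sum_univ_three]
    fin_cases i <;> simp only [Fin.isValue, zero_add, Fin.reduceAdd, Fin.zero_eta, Fin.mk_one,
      Fin.reduceFinMk, Fin.reduceEq, if_true, if_false] <;> ring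
  · simp [Coupling.torque, coupling, couplingDeriv]

/-! ### The fields of potentials -/

section

variable {t₁ t₂ t : ℝ} {a₀ b₀ : ℝ × Space → ℝ} {a b : Fin 3 → ℝ × Space → ℝ}

theorem decaying_electricComp (h0 : DecayingC2 t₁ t₂ a₀) (h : ∀ i, DecayingC2 t₁ t₂ (a i))
    (i : Fin 3) : DecayingC1 t₁ t₂ 2 (electricComp a₀ a i) :=
  (h0.decaying_dirDeriv _).neg.sub ((h i).decaying_dirDeriv _)

theorem decaying_curlComp (h : ∀ i, DecayingC2 t₁ t₂ (a i)) (i : Fin 3) :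
    DecayingC1 t₁ t₂ 2 (curlComp a i) := by
  rw [show curlComp a i = _ from funext (curlComp_apply a i)]
  exact ((h _).decaying_dirDeriv _).sub ((h _).decaying_dirDeriv _)

theorem electricComp_add_mul (h0 : Differentiable ℝ a₀) (h : ∀ i, Differentiable ℝ (a i))
    (h0' : Differentiable ℝ b₀) (h' : ∀ i, Differentiable ℝ (b i)) (ε : ℝ) (i : Fin 3)
    (p : ℝ × Space) :
    electricComp (fun p => a₀ p + ε * b₀ p) (fun i p => a i p + ε * b i p) i p
      = electricComp a₀ a i p + ε * electricComp b₀ b i p := by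
  simp only [electricComp]
  rw [dirDeriv_add (h0 p) ((h0' p).const_mul ε), dirDeriv_add (h i p) ((h' i p).const_mul ε),
    dirDeriv_const_mul (h0' p), dirDeriv_const_mul (h' i p)]
  ring

theorem curlComp_add_mul (h : ∀ i, Differentiable ℝ (a i))
    (h' : ∀ i, Differentiable ℝ (b i)) (ε : ℝ) (i : Fin 3) (p : ℝ × Space) :
    curlComp (fun i p => a i p + ε * b i p) i p = curlComp a i p + ε * curlComp b i p := by
  simp only [curlComp_apply]
  rw [dirDeriv_add (h _ p) ((h' _ p).const_mul ε), dirDeriv_add (h _ p) ((h' _ p).const_mul ε),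
    dirDeriv_const_mul (h' _ p), dirDeriv_const_mul (h' _ p)]
  ring

/-- The polarization of the Lagrangian density `E² - B²`. -/
def fieldDensity (a₀ : ℝ × Space → ℝ) (a : Fin 3 → ℝ × Space → ℝ) (b₀ : ℝ × Space → ℝ)
    (b : Fin 3 → ℝ × Space → ℝ) (p : ℝ × Space) : ℝ :=
  ∑ i, electricComp a₀ a i p * electricComp b₀ b i p - ∑ i, curlComp a i p * curlComp b i p

theorem decaying_fieldDensity (h0 : DecayingC2 t₁ t₂ a₀) (h : ∀ i, DecayingC2 t₁ t₂ (a i))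
    (h0' : DecayingC2 t₁ t₂ b₀) (h' : ∀ i, DecayingC2 t₁ t₂ (b i)) :
    DecayingC1 t₁ t₂ 4 (fieldDensity a₀ a b₀ b) := by
  have h1 := fun i => (decaying_electricComp h0 h i).mul (decaying_electricComp h0' h' i)
  have h2 := fun i => (decaying_curlComp h i).mul (decaying_curlComp h' i)
  unfold fieldDensity
  simp only [Fin.sum_univ_three]
  exact (((h1 0).add (h1 1)).add (h1 2)).sub (((h2 0).add (h2 1)).add (h2 2))

theorem DecayingC1.hasSpaceIntegral {f : ℝ × Space → ℝ} (hf : DecayingC1 t₁ t₂ 4 f)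
    (ht : t ∈ Icc t₁ t₂) : HasSpaceIntegral (fun x => f (t, x)) (∫ x, f (t, x)) :=
  ⟨hf.integrable ht, rfl⟩

theorem DecayingC1.hasSpaceIntegral_spaceDir {f : ℝ × Space → ℝ} (hf : DecayingC1 t₁ t₂ 3 f)
    (ht : t ∈ Icc t₁ t₂) (i : Fin 3) :
    HasSpaceIntegral (fun x => dirDeriv (spaceDir i) f (t, x)) 0 :=
  ⟨hf.integrable_dirDeriv _ ht, hf.integral_dirDeriv_spaceDir i ht⟩

/-- The failure of Gauss's law. -/
def gaussDefect (ρ : Space → ℝ) (q : ℝ → Space) (a₀ : ℝ × Space → ℝ) (a : Fin 3 → ℝ × Space → ℝ)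
    (p : ℝ × Space) : ℝ :=
  ∑ i, dirDeriv (spaceDir i) (electricComp a₀ a i) p - ρ (p.2 - q p.1)

/-- The failure of Ampère's law. -/
def ampereDefect (ρ : Space → ℝ) (q : ℝ → Space) (R : ℝ → SO3) (a₀ : ℝ × Space → ℝ)
    (a : Fin 3 → ℝ × Space → ℝ) (i : Fin 3) (p : ℝ × Space) : ℝ :=
  dirDeriv timeDir (electricComp a₀ a i) p - curlComp (curlComp a) i p
    + ρ (p.2 - q p.1) * bodyVelocity q R p.1 p.2 i

/-- The density whose integral is `∫ E · δA dx`. -/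
def momentumDensity (a₀ : ℝ × Space → ℝ) (a : Fin 3 → ℝ × Space → ℝ) (b : Fin 3 → ℝ × Space → ℝ)
    (p : ℝ × Space) : ℝ :=
  ∑ i, electricComp a₀ a i p * b i p

theorem decaying_momentumDensity (h0 : DecayingC2 t₁ t₂ a₀) (h : ∀ i, DecayingC2 t₁ t₂ (a i))
    (h' : ∀ i, DecayingC2 t₁ t₂ (b i)) : DecayingC1 t₁ t₂ 3 (momentumDensity a₀ a b) := by
  have h1 := fun i => (decaying_electricComp h0 h i).mul (h' i).decaying
  unfold momentumDensity
  simp only [Fin.sum_univ_three]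
  exact ((h1 0).add (h1 1)).add (h1 2)

/-- Integration by parts in space in the first variation of the action of the field. -/
theorem hasSpaceIntegral_maxwellDefect {ρ : Space → ℝ} (hρ : RapidDecay ρ)
    (h0 : DecayingC2 t₁ t₂ a₀) (h : ∀ i, DecayingC2 t₁ t₂ (a i))
    (h0' : DecayingC2 t₁ t₂ b₀) (h' : ∀ i, DecayingC2 t₁ t₂ (b i)) (ht : t ∈ Icc t₁ t₂)
    (q : ℝ → Space) (R : ℝ → SO3) :
    HasSpaceIntegral (fun x => gaussDefect ρ q a₀ a (t, x) * b₀ (t, x)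
        + ∑ i, ampereDefect ρ q R a₀ a i (t, x) * b i (t, x))
      ((∫ x, fieldDensity a₀ a b₀ b (t, x))
        + (coupling ρ b₀ b).lagr (fun i => deriv q t i) (angularVelocity R t) (t, q t)
        + ∫ x, dirDeriv timeDir (momentumDensity a₀ a b) (t, x)) := by
  have hE := decaying_electricComp h0 h
  have hB := decaying_curlComp h
  have e1 := (decaying_fieldDensity h0 h h0' h').hasSpaceIntegral ht
  have e2 := hasSpaceIntegral_coupling_scal (a := b) hρ h0'.decaying.moderateC1 ht (q t)
  have e3 := hasSpaceIntegral_coupling_vec (a₀ := b₀) hρ (fun i => (h' i).decaying.moderateC1) ht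
    (q t) (deriv q t) (angularVelocity R t)
  have e4 : HasSpaceIntegral (fun x => dirDeriv timeDir (momentumDensity a₀ a b) (t, x)) _ :=
    ⟨(decaying_momentumDensity h0 h h').integrable_dirDeriv timeDir ht, rfl⟩
  -- The divergence of `δA₀ E`, which turns `-E · ∇δA₀` into `(∇ · E) δA₀`.
  have e5 := HasSpaceIntegral.sum (Finset.univ : Finset (Fin 3)) fun i =>
    ((hE i).mul h0'.decaying).hasSpaceIntegral_spaceDir ht i
  -- The divergence of `δA ∧ B`, which turns `-B · (∇ ∧ δA)` into `-(∇ ∧ B) · δA`.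
  have e6 := HasSpaceIntegral.sum (Finset.univ : Finset (Fin 3)) fun i =>
    ((((hB (i + 2)).mul (h' (i + 1)).decaying)).hasSpaceIntegral_spaceDir ht i).sub
      ((((hB (i + 1)).mul (h' (i + 2)).decaying)).hasSpaceIntegral_spaceDir ht i)
  refine ((((e1.add (e3.sub e2)).add e4).add e5).add e6).congr (fun x => ?_) ?_
  · have dE := fun i => (hE i).differentiable (t, x)
    have dB := fun i => (hB i).differentiable (t, x)
    have d0 := h0'.decaying.differentiable (t, x)
    have d1 := fun i => (h' i).decaying.differentiable (t, x)
    have dm : dirDeriv timeDir (momentumDensity a₀ a b) (t, x)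
        = ∑ i, (dirDeriv timeDir (electricComp a₀ a i) (t, x) * b i (t, x)
          + electricComp a₀ a i (t, x) * dirDeriv timeDir (b i) (t, x)) := by
      unfold momentumDensity
      simp only [Fin.sum_univ_three]
      rw [dirDeriv_add (((dE 0).fun_mul (d1 0)).fun_add ((dE 1).fun_mul (d1 1)))
          ((dE 2).fun_mul (d1 2)),
        dirDeriv_add ((dE 0).fun_mul (d1 0)) ((dE 1).fun_mul (d1 1)), dirDeriv_mul (dE _) (d1 _),
        dirDeriv_mul (dE _) (d1 _), dirDeriv_mul (dE _) (d1 _)]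
    rw [dm]
    simp only [dirDeriv_mul (dE _) d0, dirDeriv_mul (dB _) (d1 _), gaussDefect, ampereDefect,
      fieldDensity, bodyVelocity, PiLp.add_apply, curlComp_apply (curlComp a),
      curlComp_apply b]
    -- The fields of the given potentials stay opaque from here on; only those of the variation are
    -- to be expanded.
    generalize curlComp a = B
    generalize electricComp a₀ a = E
    simp only [electricComp, Fin.sum_univ_three, Fin.isValue, zero_add, Fin.reduceAdd]
    ring
  · simp only [Coupling.lagr, Finset.sum_const_zero, sub_zero, add_zero]
    ring

end

/-! ### The first variation of the action -/

theorem Potentials.Decaying.scal_decaying {t₁ t₂ : ℝ} {𝒜 : Potentials} (h : 𝒜.Decaying t₁ t₂) :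
    DecayingC2 t₁ t₂ 𝒜.scal :=
  h.scalar.decayingC2

theorem Potentials.Decaying.vec_decaying {t₁ t₂ : ℝ} {𝒜 : Potentials} (h : 𝒜.Decaying t₁ t₂)
    (i : Fin 3) : DecayingC2 t₁ t₂ (𝒜.vec i) :=
  (h.vector.component i).decayingC2

theorem Potentials.Moderate.scal_moderate {t₁ t₂ : ℝ} {𝒜 : Potentials} (h : 𝒜.Moderate t₁ t₂) :
    ModerateC1 t₁ t₂ 𝒜.scal :=
  h.scalar.moderateC1

theorem Potentials.Moderate.vec_moderate {t₁ t₂ : ℝ} {𝒜 : Potentials} (h : 𝒜.Moderate t₁ t₂)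
    (i : Fin 3) : ModerateC1 t₁ t₂ (𝒜.vec i) :=
  (h.vector.component i).moderateC1

/-- The sum of two potentials. -/
def Potentials.total (𝒜 ℬ : Potentials) : Potentials where
  A₀ t x := 𝒜.A₀ t x + ℬ.A₀ t x
  A t x := 𝒜.A t x + ℬ.A t x

section

variable {ρ : Space → ℝ} {t₁ t₂ : ℝ} {𝒜 𝒜ext δ𝒜 : Potentials} {q δq : ℝ → Space} {R : ℝ → SO3}
  {Rv : ℝ → ℝ → SO3}

theorem total_scal_moderate (hext : 𝒜ext.Moderate t₁ t₂) (h : 𝒜.Decaying t₁ t₂) :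
    ModerateC1 t₁ t₂ (𝒜.total 𝒜ext).scal :=
  h.scal_decaying.decaying.moderateC1.add hext.scal_moderate

theorem total_vec_moderate (hext : 𝒜ext.Moderate t₁ t₂) (h : 𝒜.Decaying t₁ t₂) (i : Fin 3) :
    ModerateC1 t₁ t₂ ((𝒜.total 𝒜ext).vec i) :=
  (h.vec_decaying i).decaying.moderateC1.add (hext.vec_moderate i)

/-- The field energy is a quadratic form in the potentials and the coupling is linear in them. The
`ε`-dependence of the field term is thus an explicit polynomial, and all other dependence sits in
`particleLagrangian`. -/
theorem lagrangian_vary (hρ : IsChargeDensity ρ) (hext : 𝒜ext.Moderate t₁ t₂)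
    (h : 𝒜.Decaying t₁ t₂) (hδ : δ𝒜.Decaying t₁ t₂) (hq : Differentiable ℝ q)
    (hδq : Differentiable ℝ δq) (ε : ℝ) {t : ℝ} (ht : t ∈ Icc t₁ t₂) :
    lagrangian ρ (𝒜ext.A₀ t) (𝒜ext.A t) ((𝒜.vary δ𝒜 ε).A₀ t) ((𝒜.vary δ𝒜 ε).A t)
        (q t + ε • δq t) (Rv ε t) (timeDeriv (𝒜.vary δ𝒜 ε).A t)
        (deriv (fun t => q t + ε • δq t) t) (rotationDeriv (Rv ε) t)
      = 1 / 2 * (∫ x, fieldDensity 𝒜.scal 𝒜.vec 𝒜.scal 𝒜.vec (t, x))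
        + ε * (∫ x, fieldDensity 𝒜.scal 𝒜.vec δ𝒜.scal δ𝒜.vec (t, x))
        + 1 / 2 * (ε * ε) * (∫ x, fieldDensity δ𝒜.scal δ𝒜.vec δ𝒜.scal δ𝒜.vec (t, x))
        + particleLagrangian (momentOfInertia ρ)
          (coupling ρ (𝒜.total 𝒜ext).scal (𝒜.total 𝒜ext).vec)
          (coupling ρ δ𝒜.scal δ𝒜.vec) q δq Rv ε t := by
  have d0 := h.scal_decaying.decaying.differentiable
  have d1 := fun i => (h.vec_decaying i).decaying.differentiable
  have d0' := hδ.scal_decaying.decaying.differentiable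
  have d1' := fun i => (hδ.vec_decaying i).decaying.differentiable
  have dv0 : Differentiable ℝ (𝒜.vary δ𝒜 ε).scal := d0.add (d0'.const_mul ε)
  have dv1 : ∀ i, Differentiable ℝ ((𝒜.vary δ𝒜 ε).vec i) := fun i =>
    (d1 i).add ((d1' i).const_mul ε)
  have hE : ∀ x i, (𝒜.vary δ𝒜 ε).E t x i = electricComp 𝒜.scal 𝒜.vec i (t, x)
      + ε * electricComp δ𝒜.scal δ𝒜.vec i (t, x) := fun x i =>
    (Potentials.E_apply dv0 dv1 t x i).trans (electricComp_add_mul d0 d1 d0' d1' ε i (t, x))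
  have hB : ∀ x i, (𝒜.vary δ𝒜 ε).B t x i = curlComp 𝒜.vec i (t, x)
      + ε * curlComp δ𝒜.vec i (t, x) := fun x i =>
    (Potentials.B_apply dv1 t x i).trans (curlComp_add_mul d1 d1' ε i (t, x))
  have hf : ∫ x, (‖(𝒜.vary δ𝒜 ε).E t x‖ ^ 2 - ‖(𝒜.vary δ𝒜 ε).B t x‖ ^ 2)
      = (∫ x, fieldDensity 𝒜.scal 𝒜.vec 𝒜.scal 𝒜.vec (t, x))
        + 2 * ε * (∫ x, fieldDensity 𝒜.scal 𝒜.vec δ𝒜.scal δ𝒜.vec (t, x))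
        + ε * ε * (∫ x, fieldDensity δ𝒜.scal δ𝒜.vec δ𝒜.scal δ𝒜.vec (t, x)) := by
    have e1 := (decaying_fieldDensity h.scal_decaying h.vec_decaying h.scal_decaying
      h.vec_decaying).hasSpaceIntegral ht
    have e2 := (decaying_fieldDensity h.scal_decaying h.vec_decaying hδ.scal_decaying
      hδ.vec_decaying).hasSpaceIntegral ht
    have e3 := (decaying_fieldDensity hδ.scal_decaying hδ.vec_decaying hδ.scal_decaying
      hδ.vec_decaying).hasSpaceIntegral ht
    refine (((e1.add (e2.const_mul (2 * ε))).add (e3.const_mul (ε * ε))).congr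
      (fun x => ?_) rfl).integral_eq
    simp only [EuclideanSpace.real_norm_sq_eq, hE, hB, fieldDensity, Fin.sum_univ_three]
    ring
  have hdq : deriv (fun t => q t + ε • δq t) t = deriv q t + ε • deriv δq t :=
    ((hq t).hasDerivAt.add ((hδq t).hasDerivAt.const_smul ε)).deriv
  have hr := hρ.rapidDecay
  have hδ0 := hδ.scal_decaying.decaying.moderateC1
  have hδ1 := fun i => (hδ.vec_decaying i).decaying.moderateC1
  have ht0 := total_scal_moderate hext h
  have ht1 := total_vec_moderate hext h
  have hl := coupling_lagr_add_mul hr ht0 ht1 hδ0 hδ1 ε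
    (fun i => deriv q t i + ε * deriv δq t i) (angularVelocity (Rv ε) t)
    (p := (t, q t + ε • δq t)) ht
  have hs := hasSpaceIntegral_coupling_scal
    (a := fun i p => (𝒜.total 𝒜ext).vec i p + ε * δ𝒜.vec i p) hr
    (ht0.add (hδ0.const_mul ε)) ht (q t + ε • δq t)
  have hv := hasSpaceIntegral_coupling_vec
    (a₀ := fun p => (𝒜.total 𝒜ext).scal p + ε * δ𝒜.scal p) hr
    (fun i => (ht1 i).add ((hδ1 i).const_mul ε)) ht (q t + ε • δq t)
    (deriv q t + ε • deriv δq t) (angularVelocity (Rv ε) t)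
  have hs' : ∫ x, ((𝒜.vary δ𝒜 ε).A₀ t x + 𝒜ext.A₀ t x) * ρ (x - (q t + ε • δq t)) = _ :=
    (hs.congr (fun x => by simp only [Potentials.vary, Potentials.total, Potentials.scal]; ring)
      rfl).integral_eq
  have hv' : ∫ x, inner ℝ (deriv q t + ε • deriv δq t
        + cross (angularVelocity (Rv ε) t) (x - (q t + ε • δq t)))
      ((𝒜.vary δ𝒜 ε).A t x + 𝒜ext.A t x) * ρ (x - (q t + ε • δq t)) = _ :=
    (hv.congr (fun x => by
      simp only [Potentials.vary, Potentials.total, Potentials.vec, PiLp.inner_apply,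
        PiLp.add_apply, PiLp.smul_apply, smul_eq_mul, RCLike.inner_apply, conj_trivial]
      congr 1
      exact Finset.sum_congr rfl fun i _ => by ring) rfl).integral_eq
  have hunf : lagrangian ρ (𝒜ext.A₀ t) (𝒜ext.A t) ((𝒜.vary δ𝒜 ε).A₀ t) ((𝒜.vary δ𝒜 ε).A t)
        (q t + ε • δq t) (Rv ε t) (timeDeriv (𝒜.vary δ𝒜 ε).A t)
        (deriv q t + ε • deriv δq t) (rotationDeriv (Rv ε) t)
      = 1 / 2 * (∫ x, (‖(𝒜.vary δ𝒜 ε).E t x‖ ^ 2 - ‖(𝒜.vary δ𝒜 ε).B t x‖ ^ 2))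
        + 1 / 2 * ‖deriv q t + ε • deriv δq t‖ ^ 2
        + 1 / 2 * momentOfInertia ρ * ‖angularVelocity (Rv ε) t‖ ^ 2
        - (∫ x, ((𝒜.vary δ𝒜 ε).A₀ t x + 𝒜ext.A₀ t x) * ρ (x - (q t + ε • δq t)))
        + ∫ x, inner ℝ (deriv q t + ε • deriv δq t
          + cross (angularVelocity (Rv ε) t) (x - (q t + ε • δq t)))
          ((𝒜.vary δ𝒜 ε).A t x + 𝒜ext.A t x) * ρ (x - (q t + ε • δq t)) := rfl
  rw [hdq, hunf, hf, hs', hv', particleLagrangian, ← hl]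
  simp only [Coupling.lagr, EuclideanSpace.real_norm_sq_eq, PiLp.add_apply, PiLp.smul_apply,
    smul_eq_mul]
  ring

theorem continuousOn_force {c' : CouplingDeriv} {c : Coupling} (hc : c.Diff t₁ t₂ c')
    (hq : ContDiff ℝ 2 q) (hR : SmoothPath R) (i : Fin 3) :
    ContinuousOn (fun t => c'.force q R t i) (Icc t₁ t₂) := by
  have h1 : ∀ {U U'}, DiffUpToEnds t₁ t₂ U U' →
      ContinuousOn (fun t => U' (t, q t) (spaceDir i)) (Icc t₁ t₂) := fun hU =>
    (continuousOn_along hU.continuousOn_deriv hq.continuous).clm_apply continuousOn_const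
  have h2 : ContinuousOn (fun t => ∑ j, deriv q t j * c'.vec j (t, q t) (spaceDir i))
      (Icc t₁ t₂) := continuousOn_finsetSum _ fun j _ =>
    (contDiff_deriv_coord hq j).continuous.continuousOn.mul (h1 (hc.vec j))
  have h3 : ContinuousOn (fun t => ∑ j, angularVelocity R t j * c'.mom j (t, q t) (spaceDir i))
      (Icc t₁ t₂) := continuousOn_finsetSum _ fun j _ =>
    (contDiff_angularVelocity hR j).continuous.continuousOn.mul (h1 (hc.mom j))
  exact (((h1 hc.scal).neg.add h2).add h3).sub ((hc.vec i).continuousOn_deriv_along hq)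

theorem continuousOn_torque {c' : CouplingDeriv} {c : Coupling} (hc : c.Diff t₁ t₂ c')
    (hq : ContDiff ℝ 2 q) (hR : SmoothPath R) (i : Fin 3) :
    ContinuousOn (fun t => c.torque c' q R t i) (Icc t₁ t₂) := by
  have h1 : ∀ j k, ContinuousOn (fun t => angularVelocity R t j * c.mom k (t, q t))
      (Icc t₁ t₂) := fun j k => (contDiff_angularVelocity hR j).continuous.continuousOn.mul
    (continuousOn_along (hc.mom k).continuousOn hq.continuous)
  exact ((h1 (i + 1) (i + 2)).sub (h1 (i + 2) (i + 1))).sub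
    ((hc.mom i).continuousOn_deriv_along hq)

theorem continuousOn_lagr {c' : CouplingDeriv} {c : Coupling} (hc : c.Diff t₁ t₂ c')
    (hq : ContDiff ℝ 2 q) (hR : SmoothPath R) :
    ContinuousOn (fun t => c.lagr (fun i => deriv q t i) (angularVelocity R t) (t, q t))
      (Icc t₁ t₂) :=
  ((continuousOn_along hc.scal.continuousOn hq.continuous).neg.add
    (continuousOn_finsetSum _ fun j _ => (contDiff_deriv_coord hq j).continuous.continuousOn.mul
      (continuousOn_along (hc.vec j).continuousOn hq.continuous))).add
    (continuousOn_finsetSum _ fun j _ =>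
      (contDiff_angularVelocity hR j).continuous.continuousOn.mul
      (continuousOn_along (hc.mom j).continuousOn hq.continuous))

open IsRotationVariation

/-- The imbalance of force. -/
def forceDefect (ρ : Space → ℝ) (𝒜 : Potentials) (q : ℝ → Space) (R : ℝ → SO3) (t : ℝ)
    (i : Fin 3) : ℝ :=
  (couplingDeriv ρ 𝒜.scal 𝒜.vec).force q R t i - deriv (deriv q) t i

/-- The imbalance of torque. -/
def torqueDefect (ρ : Space → ℝ) (𝒜 : Potentials) (q : ℝ → Space) (R : ℝ → SO3) (t : ℝ)
    (i : Fin 3) : ℝ :=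
  (coupling ρ 𝒜.scal 𝒜.vec).torque (couplingDeriv ρ 𝒜.scal 𝒜.vec) q R t i
    - momentOfInertia ρ * deriv (fun s => angularVelocity R s i) t

theorem continuousOn_forceDefect (hρ : IsChargeDensity ρ) (hext : 𝒜ext.Moderate t₁ t₂)
    (h : 𝒜.Decaying t₁ t₂) (hq : ContDiff ℝ 2 q) (hR : SmoothPath R) (i : Fin 3) :
    ContinuousOn (fun t => forceDefect ρ (𝒜.total 𝒜ext) q R t i) (Icc t₁ t₂) := by
  have h2 : Continuous fun t => deriv (deriv q) t i :=
    (EuclideanSpace.proj i : Space →L[ℝ] ℝ).continuous.comp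
      ((ContDiff.deriv' (n := 1) hq).continuous_deriv le_rfl)
  exact (continuousOn_force (coupling_diff hρ.rapidDecay (total_scal_moderate hext h)
    (total_vec_moderate hext h)) hq hR i).sub h2.continuousOn

theorem continuousOn_torqueDefect (hρ : IsChargeDensity ρ) (hext : 𝒜ext.Moderate t₁ t₂)
    (h : 𝒜.Decaying t₁ t₂) (hq : ContDiff ℝ 2 q) (hR : SmoothPath R) (i : Fin 3) :
    ContinuousOn (fun t => torqueDefect ρ (𝒜.total 𝒜ext) q R t i) (Icc t₁ t₂) :=
  (continuousOn_torque (coupling_diff hρ.rapidDecay (total_scal_moderate hext h)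
    (total_vec_moderate hext h)) hq hR i).sub
    (continuousOn_const.mul ((contDiff_angularVelocity hR i).continuous_deriv le_rfl).continuousOn)

/-- The first variation of the action. -/
theorem hasDerivAt_action (hρ : IsChargeDensity ρ) (ht : t₁ ≤ t₂) (hext : 𝒜ext.Moderate t₁ t₂)
    (h : 𝒜.Decaying t₁ t₂) (hδ : δ𝒜.Decaying t₁ t₂)
    (hends : ∀ x i, δ𝒜.vec i (t₁, x) = 0 ∧ δ𝒜.vec i (t₂, x) = 0)
    (hq : ContDiff ℝ 2 q) (hδq : ContDiff ℝ 2 δq) (h1 : δq t₁ = 0) (h2 : δq t₂ = 0)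
    (hR : SmoothPath R) (hRv : IsRotationVariation t₁ t₂ R Rv) :
    HasDerivAt
      (fun ε : ℝ => action ρ 𝒜ext t₁ t₂ (𝒜.vary δ𝒜 ε) (fun t => q t + ε • δq t) (Rv ε))
      (∫ t in t₁..t₂, ((∫ x, (gaussDefect ρ q 𝒜.scal 𝒜.vec (t, x) * δ𝒜.scal (t, x)
          + ∑ i, ampereDefect ρ q R 𝒜.scal 𝒜.vec i (t, x) * δ𝒜.vec i (t, x)))
        + ∑ i, δq t i * forceDefect ρ (𝒜.total 𝒜ext) q R t i
        + ∑ i, angle Rv t i * torqueDefect ρ (𝒜.total 𝒜ext) q R t i)) 0 := by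
  have hr := hρ.rapidDecay
  have hc := coupling_diff hr (total_scal_moderate hext h) (total_vec_moderate hext h)
  have hδc := coupling_diff hr hδ.scal_decaying.decaying.moderateC1
    fun i => (hδ.vec_decaying i).decaying.moderateC1
  have hf0 := (decaying_fieldDensity h.scal_decaying h.vec_decaying h.scal_decaying
    h.vec_decaying).continuousOn_integral
  have hf1 := (decaying_fieldDensity h.scal_decaying h.vec_decaying hδ.scal_decaying
    hδ.vec_decaying).continuousOn_integral
  have hf2 := (decaying_fieldDensity hδ.scal_decaying hδ.vec_decaying hδ.scal_decaying
    hδ.vec_decaying).continuousOn_integral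
  have hm := decaying_momentumDensity h.scal_decaying h.vec_decaying hδ.vec_decaying
  have hτ := hm.continuousOn_integral_dirDeriv timeDir
  -- The term in which `E · δA` is differentiated in time integrates to zero, because `δA` vanishes
  -- at both ends; it can be added freely below.
  have hτ0 := hm.integral_dirDeriv_timeDir ht fun x => by
    simp [momentumDensity, (hends x _).1, (hends x _).2]
  have hp := paramDiff_particleLagrangian (momentOfInertia ρ) hc hδc hq hδq hRv
  have hL := ((((ParamDiff.const (1 / 2)).mul (ParamDiff.of_time hf0)).add
    (ParamDiff.param.mul (ParamDiff.of_time hf1))).add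
    (((ParamDiff.const (1 / 2)).mul (ParamDiff.param.mul ParamDiff.param)).mul
      (ParamDiff.of_time hf2))).add hp
  have hD := hL.hasDerivAt_integral ht
  have hact : (fun ε : ℝ => action ρ 𝒜ext t₁ t₂ (𝒜.vary δ𝒜 ε) (fun t => q t + ε • δq t) (Rv ε))
      = _ := funext fun ε => intervalIntegral.integral_congr fun t ht' =>
    lagrangian_vary hρ hext h hδ (hq.differentiable two_ne_zero) (hδq.differentiable two_ne_zero)
      ε (by rwa [uIcc_of_le ht] at ht')
  rw [hact]
  refine hD.congr_deriv ?_
  have hδl := continuousOn_lagr hδc hq hR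
  have hpart : ContinuousOn (fun t =>
      ∑ i, δq t i * forceDefect ρ (𝒜.total 𝒜ext) q R t i
        + ∑ i, angle Rv t i * torqueDefect ρ (𝒜.total 𝒜ext) q R t i) (Icc t₁ t₂) :=
    (continuousOn_finsetSum _ fun i _ => (contDiff_coord hδq i).continuous.continuousOn.mul
      (continuousOn_forceDefect hρ hext h hq hR i)).add
    (continuousOn_finsetSum _ fun i _ => ContinuousOn.mul
      (fun t _ => (hRv.hasDerivAt_angle i t).continuousAt.continuousWithinAt)
      (continuousOn_torqueDefect hρ hext h hq hR i))
  have hpi := integral_particleLagrangianDeriv (momentOfInertia ρ) ht hc hδc hq hδq h1 h2 hR hRv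
  have hI := fun {u : ℝ → ℝ} (hu : ContinuousOn u (Icc t₁ t₂)) =>
    hu.intervalIntegrable_of_Icc (μ := volume) ht
  calc _ = ∫ t in t₁..t₂, ((∫ x, fieldDensity 𝒜.scal 𝒜.vec δ𝒜.scal δ𝒜.vec (t, x))
        + particleLagrangianDeriv (momentOfInertia ρ)
          (coupling ρ (𝒜.total 𝒜ext).scal (𝒜.total 𝒜ext).vec) (coupling ρ δ𝒜.scal δ𝒜.vec)
          (couplingDeriv ρ (𝒜.total 𝒜ext).scal (𝒜.total 𝒜ext).vec)
          (couplingDeriv ρ δ𝒜.scal δ𝒜.vec) q δq Rv 0 t) :=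
        intervalIntegral.integral_congr fun t _ => by ring
    _ = (∫ t in t₁..t₂, ∫ x, fieldDensity 𝒜.scal 𝒜.vec δ𝒜.scal δ𝒜.vec (t, x))
        + (∫ t in t₁..t₂, ((coupling ρ δ𝒜.scal δ𝒜.vec).lagr (fun i => deriv q t i)
          (angularVelocity R t) (t, q t) + (∑ i, δq t i * forceDefect ρ (𝒜.total 𝒜ext) q R t i
        + ∑ i, angle Rv t i * torqueDefect ρ (𝒜.total 𝒜ext) q R t i)))
        + ∫ t in t₁..t₂, ∫ x, dirDeriv timeDir (momentumDensity 𝒜.scal 𝒜.vec δ𝒜.vec) (t, x) := by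
      rw [intervalIntegral.integral_add (hI hf1) (hI (hp.continuousOn_deriv_slice 0)), hpi, hτ0,
        add_zero]
      simp only [add_assoc, forceDefect, torqueDefect]
    _ = _ := by
      rw [← intervalIntegral.integral_add (hI hf1) (hI (hδl.fun_add hpart)),
        ← intervalIntegral.integral_add (hI (hf1.fun_add (hδl.fun_add hpart))) (hI hτ)]
      refine intervalIntegral.integral_congr fun t ht' => ?_
      rw [uIcc_of_le ht] at ht'
      have := (hasSpaceIntegral_maxwellDefect hr h.scal_decaying h.vec_decaying hδ.scal_decaying
        hδ.vec_decaying ht' q R).integral_eq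
      simp only
      rw [this]
      ring

end

/-! ### Test functions -/

/-- The fundamental lemma of the calculus of variations on `[t₁, t₂]`. -/
theorem eq_zero_of_forall_integral_mul_eq_zero {t₁ t₂ : ℝ} (ht : t₁ < t₂) {F : ℝ → ℝ}
    (hF : ContinuousOn F (Icc t₁ t₂))
    (h : ∀ g : ℝ → ℝ, ContDiff ℝ 2 g → HasCompactSupport g → g t₁ = 0 → g t₂ = 0 →
      ∫ t in t₁..t₂, g t * F t = 0) : ∀ t ∈ Icc t₁ t₂, F t = 0 := by
  -- Test functions supported in the open interval vanish at the ends and give the claim almost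
  -- everywhere; continuity then extends it to the closed interval.
  have h1 : ∀ᵐ t, t ∈ Ioo t₁ t₂ → F t = 0 := by
    refine isOpen_Ioo.ae_eq_zero_of_integral_contDiff_smul_eq_zero
      ((hF.mono Ioo_subset_Icc_self).locallyIntegrableOn measurableSet_Ioo)
      fun g hg hgc hgs => ?_
    have h2 : ∀ t, t ∉ Ioo t₁ t₂ → g t = 0 := fun t ht' =>
      image_eq_zero_of_notMem_tsupport fun h => ht' (hgs h)
    have h3 := h g (contDiff_infty.1 hg 2) hgc (h2 _ (by simp)) (h2 _ (by simp))
    rw [intervalIntegral.integral_of_le ht.le,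
      setIntegral_eq_integral_of_forall_compl_eq_zero fun t ht' => by
        rw [h2 t fun h => ht' (Ioo_subset_Ioc_self h), zero_mul]] at h3
    exact h3
  have h4 : F =ᵐ[volume.restrict (Icc t₁ t₂)] fun _ => 0 := by
    rw [← Measure.restrict_congr_set (Ioo_ae_eq_Icc (a := t₁) (b := t₂))]
    exact (ae_restrict_iff' measurableSet_Ioo).2 h1
  exact Measure.eqOn_Icc_of_ae_eq volume ht.ne h4 hF continuousOn_const

theorem exists_pow_mul_norm_le_of_hasCompactSupport {G : Type*} [NormedAddCommGroup G]
    {f : ℝ × Space → G} (hf : Continuous f) (hc : HasCompactSupport f) (n : ℕ) :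
    ∃ C, ∀ p, (1 + ‖p.2‖) ^ n * ‖f p‖ ≤ C := by
  obtain ⟨C, hC⟩ := Continuous.bounded_above_of_compact_support
    (f := fun p : ℝ × Space => (1 + ‖p.2‖) ^ n * ‖f p‖)
    (((continuous_const.add continuous_snd.norm).pow n).mul hf.norm) hc.norm.mul_left
  exact ⟨C, fun p => (le_abs_self _).trans (hC p)⟩

/-- Makes compactly supported test functions admissible as variations of the potentials: a
continuous compactly supported function stays bounded after multiplication by any power of `1 +
‖x‖`. -/
theorem smoothDecaying_of_hasCompactSupport {F : Type} [NormedAddCommGroup F] [NormedSpace ℝ F]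
    (t₁ t₂ : ℝ) {f : ℝ → Space → F} (hf : ContDiff ℝ 2 (fun p : ℝ × Space => f p.1 p.2))
    (hc : HasCompactSupport (fun p : ℝ × Space => f p.1 p.2)) : SmoothDecaying t₁ t₂ f := by
  have h1 : ∀ k ≤ 2, ∃ C, ∀ p : ℝ × Space, (1 + ‖p.2‖) ^ (k + 1) *
      ‖iteratedFDeriv ℝ k (fun p : ℝ × Space => f p.1 p.2) p‖ ≤ C := fun k hk =>
    exists_pow_mul_norm_le_of_hasCompactSupport
      (hf.continuous_iteratedFDeriv (m := k) (by exact_mod_cast hk)) (hc.iteratedFDeriv k) _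
  obtain ⟨C₀, h0⟩ := h1 0 (by norm_num)
  obtain ⟨C₁, h1'⟩ := h1 1 (by norm_num)
  obtain ⟨C₂, h2⟩ := h1 2 le_rfl
  refine ⟨hf, max C₀ (max C₁ C₂), fun k hk t _ x => ?_⟩
  rw [le_div_iff₀ (by positivity), mul_comm]
  obtain rfl | rfl | rfl : k = 0 ∨ k = 1 ∨ k = 2 := by omega
  · exact (h0 (t, x)).trans (le_max_left _ _)
  · exact (h1' (t, x)).trans ((le_max_left _ _).trans (le_max_right _ _))
  · exact (h2 (t, x)).trans ((le_max_right _ _).trans (le_max_right _ _))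

theorem hasCompactSupport_mul_time {g : ℝ → ℝ} {k : Space → ℝ} (hg : HasCompactSupport g)
    (hk : HasCompactSupport k) : HasCompactSupport fun p : ℝ × Space => g p.1 * k p.2 := by
  refine HasCompactSupport.intro (hg.isCompact.prod hk.isCompact) fun p hp => ?_
  by_cases h : p.1 ∈ tsupport g
  · rw [image_eq_zero_of_notMem_tsupport fun h' => hp ⟨h, h'⟩, mul_zero]
  · rw [image_eq_zero_of_notMem_tsupport h, zero_mul]

/-- The fundamental lemma of the calculus of variations on `[t₁, t₂] × ℝ³`. -/
theorem eq_zero_of_forall_integral_integral_mul_eq_zero {t₁ t₂ : ℝ} (ht : t₁ < t₂)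
    {m : ℝ × Space → ℝ} (hm : Continuous m)
    (h : ∀ (g : ℝ → ℝ) (k : Space → ℝ), ContDiff ℝ 2 g → HasCompactSupport g → g t₁ = 0 →
      g t₂ = 0 → ContDiff ℝ 2 k → HasCompactSupport k →
      ∫ t in t₁..t₂, ∫ x, m (t, x) * (g t * k x) = 0) :
    ∀ t ∈ Icc t₁ t₂, ∀ x, m (t, x) = 0 := by
  intro t ht' x
  -- Products `g(t) k(x)` suffice: for fixed `k` the one-dimensional lemma shows that `∫ k m(t, ·)`
  -- vanishes at every `t`, and then `k` is varied at that fixed time.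
  have h1 : ∀ᵐ x, m (t, x) = 0 := by
    refine ae_eq_zero_of_integral_contDiff_smul_eq_zero
      (by fun_prop : Continuous fun x => m (t, x)).locallyIntegrable fun k hk hkc => ?_
    refine eq_zero_of_forall_integral_mul_eq_zero ht
      (F := fun t => ∫ x, k x • m (t, x)) ?_ (fun g hg hgc h1 h2 => ?_) t ht'
    · refine continuousOn_integral_of_compact_support hkc.isCompact
        (Continuous.continuousOn ?_) fun p x _ hx => ?_
      · have := hk.continuous
        exact (by fun_prop : Continuous fun p : ℝ × Space => k p.2 • m (p.1, p.2))
      · rw [image_eq_zero_of_notMem_tsupport hx, zero_smul]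
    · rw [← h g k hg hgc h1 h2 (contDiff_infty.1 hk 2) hkc]
      refine intervalIntegral.integral_congr fun t _ => ?_
      rw [← integral_const_mul]
      refine integral_congr_ae (Filter.Eventually.of_forall fun x => ?_)
      simp only [smul_eq_mul]
      ring
  have h2 := (Continuous.ae_eq_iff_eq volume (by fun_prop : Continuous fun x => m (t, x))
    continuous_const).1 h1
  exact congrFun h2 x

/-! ### Rotations about the coordinate axes -/

/-- The rotation about the `k`-th axis by the angle with cosine `c` and sine `s`. -/
def axisMatrix (k : Fin 3) (c s : ℝ) : Matrix (Fin 3) (Fin 3) ℝ :=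
  Matrix.of fun a b => (if a = b then (if a = k then 1 else c) else 0)
    + s * skew (EuclideanSpace.single k 1) a b

theorem axisMatrix_mem (k : Fin 3) {c s : ℝ} (h : c ^ 2 + s ^ 2 = 1) :
    axisMatrix k c s ∈ Matrix.specialOrthogonalGroup (Fin 3) ℝ := by
  rw [Matrix.mem_specialOrthogonalGroup_iff, Matrix.mem_orthogonalGroup_iff]
  constructor
  · ext i j
    rw [Matrix.mul_apply, Fin.sum_univ_three]
    fin_cases k <;> fin_cases i <;> fin_cases j <;>
      simp [axisMatrix, skew] <;> first | linear_combination h | ring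
  · rw [Matrix.det_fin_three]
    fin_cases k <;> simp [axisMatrix, skew] <;> linear_combination h

/-- The rotation about the `k`-th axis by the angle `θ`. -/
def axisRotation (k : Fin 3) (θ : ℝ) : SO3 :=
  ⟨axisMatrix k (Real.cos θ) (Real.sin θ), axisMatrix_mem k (Real.cos_sq_add_sin_sq θ)⟩

theorem axisRotation_zero (k : Fin 3) : axisRotation k 0 = 1 := by
  ext i j
  simp [axisRotation, axisMatrix, Matrix.one_apply]

/-- The rotation of a path about the `k`-th axis by the angle `ε g(t)`. -/
def axisVariation (k : Fin 3) (g : ℝ → ℝ) (R : ℝ → SO3) (ε t : ℝ) : SO3 :=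
  axisRotation k (ε * g t) * R t

theorem axisVariation_apply (k : Fin 3) (g : ℝ → ℝ) (R : ℝ → SO3) (ε t : ℝ) (i j : Fin 3) :
    (axisVariation k g R ε t : Matrix (Fin 3) (Fin 3) ℝ) i j
      = ∑ m, ((if i = m then (if i = k then 1 else Real.cos (ε * g t)) else 0)
        + Real.sin (ε * g t) * skew (EuclideanSpace.single k 1) i m)
        * (R t : Matrix (Fin 3) (Fin 3) ℝ) m j := by
  simp [axisVariation, axisRotation, axisMatrix, Matrix.mul_apply]

theorem isRotationVariation_axisVariation {t₁ t₂ : ℝ} (k : Fin 3) {g : ℝ → ℝ}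
    (hg : ContDiff ℝ 2 g) (h1 : g t₁ = 0) (h2 : g t₂ = 0) {R : ℝ → SO3} (hR : SmoothPath R) :
    IsRotationVariation t₁ t₂ R (axisVariation k g R) where
  contDiff i j := by
    have hθ : ContDiff ℝ 2 fun p : ℝ × ℝ => p.1 * g p.2 := contDiff_fst.mul (hg.comp contDiff_snd)
    simp only [axisVariation_apply]
    refine ContDiff.sum fun m _ => ContDiff.mul (ContDiff.add ?_ ?_) ((hR m j).comp contDiff_snd)
    · split_ifs
      exacts [contDiff_const, Real.contDiff_cos.comp hθ, contDiff_const]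
    · exact (Real.contDiff_sin.comp hθ).mul contDiff_const
  at_zero t := by simp [axisVariation, axisRotation_zero]
  left_end ε := by simp [axisVariation, h1, axisRotation_zero]
  right_end ε := by simp [axisVariation, h2, axisRotation_zero]

theorem skew_apply_cyclic (w : Space) (j : Fin 3) : skew w (j + 2) (j + 1) = w j := by
  fin_cases j <;> simp [skew]

/-- The rotation multiplies `R` on the left, so `(∂_ε R) R⁻¹` at `ε = 0` is `g 𝒥 e_k`, whatever `R`
is. Hence `φ = g e_k` can be prescribed. -/
theorem IsRotationVariation.angle_axisVariation {t₁ t₂ : ℝ} {k : Fin 3} {g : ℝ → ℝ}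
    {R : ℝ → SO3} (h : IsRotationVariation t₁ t₂ R (axisVariation k g R)) (t : ℝ) (j : Fin 3) :
    angle (axisVariation k g R) t j = if j = k then g t else 0 := by
  have h1 : ∀ a l, fderiv ℝ (entry (axisVariation k g R) a l) (0, t) (1, 0)
      = ∑ m, g t * skew (EuclideanSpace.single k 1) a m
        * (R t : Matrix (Fin 3) (Fin 3) ℝ) m l := fun a l => by
    have h2 := h.hasDerivAt_entry t a l
    simp only [axisVariation_apply] at h2
    refine h2.unique (HasDerivAt.fun_sum fun m _ => HasDerivAt.mul_const ?_ _)
    have hθ : HasDerivAt (fun ε : ℝ => ε * g t) (g t) 0 := by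
      simpa using (hasDerivAt_id (0 : ℝ)).mul_const (g t)
    have hs : HasDerivAt (fun ε : ℝ => Real.sin (ε * g t)) (g t) 0 := by
      simpa using hθ.sin
    have hc : HasDerivAt (fun ε : ℝ => Real.cos (ε * g t)) 0 0 := by
      simpa using hθ.cos
    have h3 : HasDerivAt (fun ε : ℝ => if a = m then (if a = k then 1 else Real.cos (ε * g t))
        else 0) 0 0 := by
      split_ifs
      exacts [hasDerivAt_const _ _, hc, hasDerivAt_const _ _]
    simpa using h3.fun_add (hs.mul_const (skew (EuclideanSpace.single k 1) a m))
  have h5 : ∀ b l, entry (axisVariation k g R) b l (0, t)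
      = (R t : Matrix (Fin 3) (Fin 3) ℝ) b l := fun b l => by rw [entry, h.at_zero]
  simp only [angle, spin, h1, h5, Finset.sum_mul]
  rw [Finset.sum_comm]
  simp only [mul_assoc, ← Finset.mul_sum, row_orthonormal]
  simp [skew_apply_cyclic]

/-! ### The Maxwell-Lorentz system in components -/

section

variable {ρ : Space → ℝ} {t₁ t₂ : ℝ} {𝒜 𝒜ext : Potentials} {q : ℝ → Space} {R : ℝ → SO3}

theorem total_E_apply (hext : 𝒜ext.Moderate t₁ t₂) (h : 𝒜.Decaying t₁ t₂) (t : ℝ) (x : Space)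
    (i : Fin 3) : 𝒜.E t x i + 𝒜ext.E t x i
      = electricComp (𝒜.total 𝒜ext).scal (𝒜.total 𝒜ext).vec i (t, x) := by
  have d0 := h.scal_decaying.decaying.differentiable
  have d1 := fun i => (h.vec_decaying i).decaying.differentiable
  have d0' := hext.scal_moderate.differentiable
  have d1' := fun i => (hext.vec_moderate i).differentiable
  have h1 := electricComp_add_mul d0 d1 d0' d1' 1 i (t, x)
  simp only [one_mul] at h1
  rw [Potentials.E_apply d0 d1, Potentials.E_apply d0' d1', ← h1]
  rfl

theorem total_B_apply (hext : 𝒜ext.Moderate t₁ t₂) (h : 𝒜.Decaying t₁ t₂) (t : ℝ) (x : Space)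
    (i : Fin 3) : 𝒜.B t x i + 𝒜ext.B t x i = curlComp (𝒜.total 𝒜ext).vec i (t, x) := by
  have d1 := fun i => (h.vec_decaying i).decaying.differentiable
  have d1' := fun i => (hext.vec_moderate i).differentiable
  have h1 := curlComp_add_mul d1 d1' 1 i (t, x)
  simp only [one_mul] at h1
  rw [Potentials.B_apply d1, Potentials.B_apply d1', ← h1]
  rfl

theorem lorentzForce_apply (hext : 𝒜ext.Moderate t₁ t₂) (h : 𝒜.Decaying t₁ t₂) (t : ℝ)
    (x : Space) (i : Fin 3) :
    (𝒜.E t x + 𝒜ext.E t x + cross (bodyVelocity q R t x) (𝒜.B t x + 𝒜ext.B t x)) i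
      = lorentzForce (𝒜.total 𝒜ext).scal (𝒜.total 𝒜ext).vec
        (fun j => deriv q t j + cross (angularVelocity R t) (x - q t) j) i (t, x) := by
  rw [PiLp.add_apply, PiLp.add_apply, total_E_apply hext h, cross_apply, PiLp.add_apply,
    PiLp.add_apply, total_B_apply hext h, total_B_apply hext h]
  rfl

theorem force_iff (hρ : IsChargeDensity ρ) (hext : 𝒜ext.Moderate t₁ t₂) (h : 𝒜.Decaying t₁ t₂)
    {t : ℝ} (ht : t ∈ Icc t₁ t₂) :
    (deriv (deriv q) t = ∫ x, ρ (x - q t) • (𝒜.E t x + 𝒜ext.E t x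
        + cross (bodyVelocity q R t x) (𝒜.B t x + 𝒜ext.B t x)))
      ↔ ∀ i, forceDefect ρ (𝒜.total 𝒜ext) q R t i = 0 := by
  have h1 : ∀ i, HasSpaceIntegral (fun x => (ρ (x - q t) • (𝒜.E t x + 𝒜ext.E t x
        + cross (bodyVelocity q R t x) (𝒜.B t x + 𝒜ext.B t x))) i)
      ((couplingDeriv ρ (𝒜.total 𝒜ext).scal (𝒜.total 𝒜ext).vec).force q R t i) := fun i =>
    ((hasSpaceIntegral_force hρ (total_scal_moderate hext h) (total_vec_moderate hext h) ht q R
      i).translate (q t)).congr (fun x => by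
        rw [PiLp.smul_apply, lorentzForce_apply hext h, add_sub_cancel, smul_eq_mul]) rfl
  have h2 : ∀ i, (∫ x, ρ (x - q t) • (𝒜.E t x + 𝒜ext.E t x
        + cross (bodyVelocity q R t x) (𝒜.B t x + 𝒜ext.B t x))) i
      = (couplingDeriv ρ (𝒜.total 𝒜ext).scal (𝒜.total 𝒜ext).vec).force q R t i := fun i => by
    rw [eval_integral_piLp (fun i => (h1 i).integrable), (h1 i).integral_eq]
  constructor
  · intro h3 i
    rw [forceDefect, h3, h2, sub_self]
  · intro h3
    ext i
    rw [h2]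
    exact (sub_eq_zero.1 (h3 i)).symm

theorem torque_iff (hρ : IsChargeDensity ρ) (hext : 𝒜ext.Moderate t₁ t₂) (h : 𝒜.Decaying t₁ t₂)
    (hR : SmoothPath R) {t : ℝ} (ht : t ∈ Icc t₁ t₂) :
    (momentOfInertia ρ • deriv (angularVelocity R) t = ∫ x, ρ (x - q t) • cross (x - q t)
        (𝒜.E t x + 𝒜ext.E t x + cross (bodyVelocity q R t x) (𝒜.B t x + 𝒜ext.B t x)))
      ↔ ∀ i, torqueDefect ρ (𝒜.total 𝒜ext) q R t i = 0 := by
  have h1 : ∀ i, HasSpaceIntegral (fun x => (ρ (x - q t) • cross (x - q t)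
        (𝒜.E t x + 𝒜ext.E t x + cross (bodyVelocity q R t x) (𝒜.B t x + 𝒜ext.B t x))) i)
      ((coupling ρ (𝒜.total 𝒜ext).scal (𝒜.total 𝒜ext).vec).torque
        (couplingDeriv ρ (𝒜.total 𝒜ext).scal (𝒜.total 𝒜ext).vec) q R t i) := fun i =>
    ((hasSpaceIntegral_torque hρ (total_scal_moderate hext h) (total_vec_moderate hext h) ht q R
      i).translate (q t)).congr (fun x => by
        rw [PiLp.smul_apply, cross_apply, lorentzForce_apply hext h, lorentzForce_apply hext h,
          add_sub_cancel, smul_eq_mul]) rfl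
  have h2 : ∀ i, (∫ x, ρ (x - q t) • cross (x - q t)
        (𝒜.E t x + 𝒜ext.E t x + cross (bodyVelocity q R t x) (𝒜.B t x + 𝒜ext.B t x))) i
      = (coupling ρ (𝒜.total 𝒜ext).scal (𝒜.total 𝒜ext).vec).torque
        (couplingDeriv ρ (𝒜.total 𝒜ext).scal (𝒜.total 𝒜ext).vec) q R t i := fun i => by
    rw [eval_integral_piLp (fun i => (h1 i).integrable), (h1 i).integral_eq]
  have hd : DifferentiableAt ℝ (angularVelocity R) t := differentiableAt_euclidean.2 fun i =>
    (contDiff_angularVelocity hR i).differentiable one_ne_zero t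
  have h3 : ∀ i, deriv (fun s => angularVelocity R s i) t = deriv (angularVelocity R) t i :=
    fun i => (hasDerivAt_coord hd.hasDerivAt i).deriv
  simp only [torqueDefect, h3]
  constructor
  · intro h4 i
    rw [← h2, ← h4]
    simp
  · intro h4
    ext i
    rw [h2, PiLp.smul_apply, smul_eq_mul]
    exact (sub_eq_zero.1 (h4 i)).symm

/-- The equations for `Ḃ` and `∇ · B` impose no condition: they are the symmetry of second
derivatives of the potentials. -/
theorem maxwellLorentzSystem_iff (hρ : IsChargeDensity ρ) (hext : 𝒜ext.Moderate t₁ t₂)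
    (h : 𝒜.Decaying t₁ t₂) (hR : SmoothPath R) :
    MaxwellLorentzSystem ρ 𝒜ext.E 𝒜ext.B t₁ t₂ 𝒜.E 𝒜.B q R ↔
      (∀ t ∈ Icc t₁ t₂, ∀ x, gaussDefect ρ q 𝒜.scal 𝒜.vec (t, x) = 0) ∧
      (∀ i, ∀ t ∈ Icc t₁ t₂, ∀ x, ampereDefect ρ q R 𝒜.scal 𝒜.vec i (t, x) = 0) ∧
      (∀ i, ∀ t ∈ Icc t₁ t₂, forceDefect ρ (𝒜.total 𝒜ext) q R t i = 0) ∧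
      (∀ i, ∀ t ∈ Icc t₁ t₂, torqueDefect ρ (𝒜.total 𝒜ext) q R t i = 0) := by
  have h0 := h.scal_decaying
  have h1 := h.vec_decaying
  have d0 := h0.decaying.differentiable
  have d1 := fun i => (h1 i).decaying.differentiable
  have hE : ∀ i, (fun p : ℝ × Space => 𝒜.E p.1 p.2 i) = electricComp 𝒜.scal 𝒜.vec i := fun i =>
    funext fun p => Potentials.E_apply d0 d1 p.1 p.2 i
  have hB : ∀ i, (fun p : ℝ × Space => 𝒜.B p.1 p.2 i) = curlComp 𝒜.vec i := fun i =>
    funext fun p => Potentials.B_apply d1 p.1 p.2 i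
  have dE := fun i => (decaying_electricComp h0 h1 i).differentiable
  have dB := fun i => (decaying_curlComp h1 i).differentiable
  have dE' : ∀ p i, DifferentiableAt ℝ (fun p : ℝ × Space => 𝒜.E p.1 p.2 i) p := fun p i => by
    rw [hE]; exact dE i p
  have dB' : ∀ p i, DifferentiableAt ℝ (fun p : ℝ × Space => 𝒜.B p.1 p.2 i) p := fun p i => by
    rw [hB]; exact dB i p
  have hEt : ∀ t x i, timeDeriv 𝒜.E t x i
      = dirDeriv timeDir (electricComp 𝒜.scal 𝒜.vec i) (t, x) := fun t x i => by
    rw [timeDeriv_apply (dE' _), hE]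
  have hBt : ∀ t x i, timeDeriv 𝒜.B t x i = dirDeriv timeDir (curlComp 𝒜.vec i) (t, x) :=
    fun t x i => by rw [timeDeriv_apply (dB' _), hB]
  have hEc : ∀ t x i, curl (𝒜.E t) x i
      = curlComp (electricComp 𝒜.scal 𝒜.vec) i (t, x) := fun t x i => by
    rw [curl_apply (dE' _), ← funext hE]
  have hBc : ∀ t x i, curl (𝒜.B t) x i = curlComp (curlComp 𝒜.vec) i (t, x) := fun t x i => by
    rw [curl_apply (dB' _), ← funext hB]
  have hEd : ∀ t x, divergence (𝒜.E t) x
      = ∑ i, dirDeriv (spaceDir i) (electricComp 𝒜.scal 𝒜.vec i) (t, x) := fun t x => by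
    rw [divergence_apply (dE' _)]; simp only [hE]
  have hBd : ∀ t x, divergence (𝒜.B t) x
      = ∑ i, dirDeriv (spaceDir i) (curlComp 𝒜.vec i) (t, x) := fun t x => by
    rw [divergence_apply (dB' _)]; simp only [hB]
  have dd0 : ∀ v p, DifferentiableAt ℝ (dirDeriv v 𝒜.scal) p := fun v p =>
    (h0.decaying_dirDeriv v).differentiable p
  have dd1 : ∀ i v p, DifferentiableAt ℝ (dirDeriv v (𝒜.vec i)) p := fun i v p =>
    ((h1 i).decaying_dirDeriv v).differentiable p
  have hdB : ∀ v i p, dirDeriv v (curlComp 𝒜.vec i) p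
      = dirDeriv v (dirDeriv (spaceDir (i + 1)) (𝒜.vec (i + 2))) p
        - dirDeriv v (dirDeriv (spaceDir (i + 2)) (𝒜.vec (i + 1))) p := fun v i p => by
    rw [show curlComp 𝒜.vec i = _ from funext (curlComp_apply 𝒜.vec i),
      dirDeriv_sub (dd1 _ _ _) (dd1 _ _ _)]
  have hdE : ∀ v i p, dirDeriv v (electricComp 𝒜.scal 𝒜.vec i) p
      = -dirDeriv v (dirDeriv (spaceDir i) 𝒜.scal) p
        - dirDeriv v (dirDeriv timeDir (𝒜.vec i)) p := fun v i p => by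
    have h2 := dirDeriv_sub (v := v) (f := fun p => -dirDeriv (spaceDir i) 𝒜.scal p)
      (dd0 (spaceDir i) p).fun_neg (dd1 i timeDir p)
    rw [dirDeriv_neg] at h2
    exact h2
  have c0 := dirDeriv_comm h0.contDiff
  have c1 := fun i => dirDeriv_comm (h1 i).contDiff
  constructor
  · intro hML
    refine ⟨fun t ht x => ?_, fun i t ht x => ?_, fun i t ht => ?_, fun i t ht => ?_⟩
    · rw [gaussDefect, ← hEd, hML.div_electric t ht x, sub_self]
    · have h2 := congrArg (fun v : Space => v i) (hML.electric t ht x)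
      simp only [PiLp.sub_apply, PiLp.smul_apply, smul_eq_mul, hEt, hBc] at h2
      rw [ampereDefect, h2]
      ring
    · exact (force_iff hρ hext h ht).1 (hML.force t ht) i
    · exact (torque_iff hρ hext h hR ht).1 (hML.torque t ht) i
  · rintro ⟨hg, ha, hf, hτ⟩
    refine ⟨fun t ht x => ?_, fun t ht x => ?_, fun t ht x => ?_, fun t ht x => ?_,
      fun t ht => (force_iff hρ hext h ht).2 fun i => hf i t ht,
      fun t ht => (torque_iff hρ hext h hR ht).2 fun i => hτ i t ht⟩
    · ext i
      have h2 := ha i t ht x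
      rw [ampereDefect] at h2
      simp only [PiLp.sub_apply, PiLp.smul_apply, smul_eq_mul, hEt, hBc]
      linarith
    -- Faraday's law: the second derivatives of `A₀` cancel in the curl of a gradient, and the time
    -- derivative commutes with the space derivatives of `A`.
    · ext i
      rw [PiLp.neg_apply, hBt, hEc, hdB, curlComp_apply, hdE, hdE, c1 _ timeDir, c1 _ timeDir,
        c0 (spaceDir (i + 1))]
      ring
    · rw [hEd]
      exact sub_eq_zero.1 (hg t ht x)
    -- The divergence of a curl: the six second derivatives of `A` cancel in pairs.
    · rw [hBd]
      simp only [hdB, Fin.sum_univ_three, Fin.isValue, zero_add, Fin.reduceAdd]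
      rw [c1 2 (spaceDir 0), c1 1 (spaceDir 0), c1 0 (spaceDir 1)]
      ring

end

/-! ### The equations of motion from the least action principle. -/

section

variable {ρ : Space → ℝ} {t₁ t₂ : ℝ} {𝒜 𝒜ext : Potentials} {q : ℝ → Space} {R : ℝ → SO3}

theorem continuous_comp_sub_path (hρ : IsChargeDensity ρ) (hq : ContDiff ℝ 2 q) :
    Continuous fun p : ℝ × Space => ρ (p.2 - q p.1) :=
  hρ.contDiff.continuous.comp (continuous_snd.sub (hq.continuous.comp continuous_fst))

theorem continuous_gaussDefect (hρ : IsChargeDensity ρ) (h : 𝒜.Decaying t₁ t₂)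
    (hq : ContDiff ℝ 2 q) : Continuous (gaussDefect ρ q 𝒜.scal 𝒜.vec) :=
  (continuous_finsetSum _ fun i _ => continuous_dirDeriv
    (decaying_electricComp h.scal_decaying h.vec_decaying i).contDiff _).sub
    (continuous_comp_sub_path hρ hq)

theorem continuous_bodyVelocity (hq : ContDiff ℝ 2 q) (hR : SmoothPath R) (i : Fin 3) :
    Continuous fun p : ℝ × Space => bodyVelocity q R p.1 p.2 i := by
  have h1 : ∀ j, Continuous fun p : ℝ × Space => angularVelocity R p.1 j := fun j =>
    (contDiff_angularVelocity hR j).continuous.comp continuous_fst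
  have h2 : ∀ j, Continuous fun p : ℝ × Space => p.2 j - q p.1 j := fun j =>
    ((EuclideanSpace.proj j : Space →L[ℝ] ℝ).continuous.comp continuous_snd).sub
      ((EuclideanSpace.proj j : Space →L[ℝ] ℝ).continuous.comp
        (hq.continuous.comp continuous_fst))
  have h3 : Continuous fun p : ℝ × Space => deriv q p.1 i :=
    (contDiff_deriv_coord hq i).continuous.comp continuous_fst
  simp only [bodyVelocity, PiLp.add_apply, cross_apply, PiLp.sub_apply]
  exact h3.add (((h1 _).mul (h2 _)).sub ((h1 _).mul (h2 _)))

theorem continuous_ampereDefect (hρ : IsChargeDensity ρ) (h : 𝒜.Decaying t₁ t₂)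
    (hq : ContDiff ℝ 2 q) (hR : SmoothPath R) (i : Fin 3) :
    Continuous (ampereDefect ρ q R 𝒜.scal 𝒜.vec i) := by
  have hB : ∀ j k, Continuous (dirDeriv (spaceDir j) (curlComp 𝒜.vec k)) := fun j k =>
    continuous_dirDeriv (decaying_curlComp h.vec_decaying k).contDiff _
  refine ((continuous_dirDeriv
    (decaying_electricComp h.scal_decaying h.vec_decaying i).contDiff _).sub ?_).add
    ((continuous_comp_sub_path hρ hq).mul (continuous_bodyVelocity hq hR i))
  rw [show curlComp (curlComp 𝒜.vec) i = _ from funext (curlComp_apply _ i)]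
  exact (hB _ _).sub (hB _ _)

theorem isRotationVariation_const (hR : SmoothPath R) :
    IsRotationVariation t₁ t₂ R fun _ => R where
  contDiff i j := (hR i j).comp contDiff_snd
  at_zero _ := rfl
  left_end _ := rfl
  right_end _ := rfl

theorem smoothDecaying_zero {F : Type} [NormedAddCommGroup F] [NormedSpace ℝ F] :
    SmoothDecaying t₁ t₂ (fun _ _ => 0 : ℝ → Space → F) :=
  smoothDecaying_of_hasCompactSupport t₁ t₂ contDiff_const HasCompactSupport.zero

/-- The potentials which vanish identically. -/
def zeroPotentials : Potentials where
  A₀ _ _ := 0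
  A _ _ := 0

theorem decaying_zeroPotentials : zeroPotentials.Decaying t₁ t₂ :=
  ⟨smoothDecaying_zero, smoothDecaying_zero⟩

/-- Uniqueness of the derivative: the computed first variation must equal the value `0` prescribed
by the principle. -/
theorem LeastActionPrinciple.integral_eq_zero (hρ : IsChargeDensity ρ) (ht : t₁ ≤ t₂)
    (hext : 𝒜ext.Moderate t₁ t₂) (h : 𝒜.Decaying t₁ t₂) (hq : ContDiff ℝ 2 q)
    (hR : SmoothPath R) (hS : LeastActionPrinciple ρ 𝒜ext t₁ t₂ 𝒜 q R)
    {δ𝒜 : Potentials} {δq : ℝ → Space} {Rv : ℝ → ℝ → SO3} (hδ : δ𝒜.Decaying t₁ t₂)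
    (hends : ∀ x, δ𝒜.A₀ t₁ x = 0 ∧ δ𝒜.A t₁ x = 0 ∧ δ𝒜.A₀ t₂ x = 0 ∧ δ𝒜.A t₂ x = 0)
    (hδq : ContDiff ℝ 2 δq) (h1 : δq t₁ = 0) (h2 : δq t₂ = 0)
    (hRv : IsRotationVariation t₁ t₂ R Rv) :
    ∫ t in t₁..t₂, ((∫ x, (gaussDefect ρ q 𝒜.scal 𝒜.vec (t, x) * δ𝒜.scal (t, x)
          + ∑ i, ampereDefect ρ q R 𝒜.scal 𝒜.vec i (t, x) * δ𝒜.vec i (t, x)))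
        + ∑ i, δq t i * forceDefect ρ (𝒜.total 𝒜ext) q R t i
        + ∑ i, IsRotationVariation.angle Rv t i
          * torqueDefect ρ (𝒜.total 𝒜ext) q R t i) = 0 :=
  (hasDerivAt_action hρ ht hext h hδ
    (fun x i => by simp [Potentials.vec, (hends x).2.1, (hends x).2.2.2]) hq hδq h1 h2 hR
    hRv).unique (hS δ𝒜 δq Rv hδ hδq hends h1 h2 hRv)

theorem LeastActionPrinciple.gaussDefect_eq_zero (hρ : IsChargeDensity ρ) (ht : t₁ < t₂) (hext : 𝒜ext.Moderate t₁ t₂)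
    (h : 𝒜.Decaying t₁ t₂) (hq : ContDiff ℝ 2 q) (hR : SmoothPath R)
    (hS : LeastActionPrinciple ρ 𝒜ext t₁ t₂ 𝒜 q R) :
    ∀ t ∈ Icc t₁ t₂, ∀ x, gaussDefect ρ q 𝒜.scal 𝒜.vec (t, x) = 0 := by
  refine eq_zero_of_forall_integral_integral_mul_eq_zero ht (continuous_gaussDefect hρ h hq)
    fun g k hg hgc h1 h2 hk hkc => ?_
  have hRc := isRotationVariation_const (t₁ := t₁) (t₂ := t₂) hR
  have h3 := hS.integral_eq_zero hρ ht.le hext h hq hR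
    (δ𝒜 := ⟨fun t x => g t * k x, fun _ _ => 0⟩) (δq := fun _ => 0)
    ⟨smoothDecaying_of_hasCompactSupport t₁ t₂
      ((hg.comp contDiff_fst).mul (hk.comp contDiff_snd)) (hasCompactSupport_mul_time hgc hkc),
      smoothDecaying_zero⟩ (fun x => by simp [h1, h2]) contDiff_const rfl rfl hRc
  rw [← h3]
  refine intervalIntegral.integral_congr fun t _ => ?_
  simp [Potentials.scal, Potentials.vec, hRc.angle_eq_zero]

theorem LeastActionPrinciple.ampereDefect_eq_zero (hρ : IsChargeDensity ρ) (ht : t₁ < t₂) (hext : 𝒜ext.Moderate t₁ t₂)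
    (h : 𝒜.Decaying t₁ t₂) (hq : ContDiff ℝ 2 q) (hR : SmoothPath R)
    (hS : LeastActionPrinciple ρ 𝒜ext t₁ t₂ 𝒜 q R) (i : Fin 3) :
    ∀ t ∈ Icc t₁ t₂, ∀ x, ampereDefect ρ q R 𝒜.scal 𝒜.vec i (t, x) = 0 := by
  refine eq_zero_of_forall_integral_integral_mul_eq_zero ht (continuous_ampereDefect hρ h hq hR i)
    fun g k hg hgc h1 h2 hk hkc => ?_
  have hRc := isRotationVariation_const (t₁ := t₁) (t₂ := t₂) hR
  have h3 := hS.integral_eq_zero hρ ht.le hext h hq hR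
    (δ𝒜 := ⟨fun _ _ => 0, fun t x => (g t * k x) • EuclideanSpace.single i 1⟩)
    (δq := fun _ => 0)
    ⟨smoothDecaying_zero, smoothDecaying_of_hasCompactSupport t₁ t₂
      (((hg.comp contDiff_fst).mul (hk.comp contDiff_snd)).smul contDiff_const)
      (hasCompactSupport_mul_time hgc hkc).smul_right⟩
    (fun x => by simp [h1, h2]) contDiff_const rfl rfl hRc
  rw [← h3]
  refine intervalIntegral.integral_congr fun t _ => ?_
  simp [Potentials.scal, Potentials.vec, hRc.angle_eq_zero]

theorem LeastActionPrinciple.forceDefect_eq_zero (hρ : IsChargeDensity ρ) (ht : t₁ < t₂) (hext : 𝒜ext.Moderate t₁ t₂)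
    (h : 𝒜.Decaying t₁ t₂) (hq : ContDiff ℝ 2 q) (hR : SmoothPath R)
    (hS : LeastActionPrinciple ρ 𝒜ext t₁ t₂ 𝒜 q R) (i : Fin 3) :
    ∀ t ∈ Icc t₁ t₂, forceDefect ρ (𝒜.total 𝒜ext) q R t i = 0 := by
  refine eq_zero_of_forall_integral_mul_eq_zero ht (continuousOn_forceDefect hρ hext h hq hR i)
    fun g hg _ h1 h2 => ?_
  have hRc := isRotationVariation_const (t₁ := t₁) (t₂ := t₂) hR
  have h3 := hS.integral_eq_zero hρ ht.le hext h hq hR (δ𝒜 := zeroPotentials)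
    (δq := fun t => g t • EuclideanSpace.single i 1) decaying_zeroPotentials
    (fun x => ⟨rfl, rfl, rfl, rfl⟩) (hg.smul contDiff_const) (by simp [h1]) (by simp [h2]) hRc
  rw [← h3]
  refine intervalIntegral.integral_congr fun t _ => ?_
  simp [zeroPotentials, Potentials.scal, Potentials.vec, hRc.angle_eq_zero]

theorem LeastActionPrinciple.torqueDefect_eq_zero (hρ : IsChargeDensity ρ) (ht : t₁ < t₂) (hext : 𝒜ext.Moderate t₁ t₂)
    (h : 𝒜.Decaying t₁ t₂) (hq : ContDiff ℝ 2 q) (hR : SmoothPath R)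
    (hS : LeastActionPrinciple ρ 𝒜ext t₁ t₂ 𝒜 q R) (i : Fin 3) :
    ∀ t ∈ Icc t₁ t₂, torqueDefect ρ (𝒜.total 𝒜ext) q R t i = 0 := by
  refine eq_zero_of_forall_integral_mul_eq_zero ht (continuousOn_torqueDefect hρ hext h hq hR i)
    fun g hg _ h1 h2 => ?_
  -- Turning the body by `ε g(t)` about the `i`-th axis isolates the `i`-th component of the torque
  -- defect.
  have hRv := isRotationVariation_axisVariation i hg h1 h2 hR
  have h3 := hS.integral_eq_zero hρ ht.le hext h hq hR (δ𝒜 := zeroPotentials)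
    (δq := fun _ => 0) decaying_zeroPotentials
    (fun x => ⟨rfl, rfl, rfl, rfl⟩) contDiff_const rfl rfl hRv
  rw [← h3]
  refine intervalIntegral.integral_congr fun t _ => ?_
  simp [zeroPotentials, Potentials.scal, Potentials.vec, hRv.angle_axisVariation]

end

end RotatingCharge

end

theorem theorem2p1 (ρ : Space → ℝ) (hρ : IsChargeDensity ρ) (t₁ t₂ : ℝ) (ht : t₁ < t₂)
    (𝒜ext : Potentials) (hext : 𝒜ext.Moderate t₁ t₂)
    (𝒜 : Potentials) (h𝒜 : 𝒜.Decaying t₁ t₂)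
    (q : ℝ → Space) (hq : ContDiff ℝ 2 q)
    (R : ℝ → SO3) (hR : SmoothPath R) :
    MaxwellLorentzSystem ρ 𝒜ext.E 𝒜ext.B t₁ t₂ 𝒜.E 𝒜.B q R ↔
      LeastActionPrinciple ρ 𝒜ext t₁ t₂ 𝒜 q R := by
  rw [maxwellLorentzSystem_iff hρ hext h𝒜 hR]
  constructor
  · rintro ⟨hg, ha, hf, hτ⟩ δ𝒜 δq Rv hδ hδq hends h1 h2 hRv
    refine (hasDerivAt_action hρ ht.le hext h𝒜 hδ
      (fun x i => by simp [Potentials.vec, (hends x).2.1, (hends x).2.2.2]) hq hδq h1 h2 hR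
      hRv).congr_deriv ?_
    refine (intervalIntegral.integral_congr (g := fun _ => 0) fun t ht' => ?_).trans (by simp)
    rw [uIcc_of_le ht.le] at ht'
    simp [hg t ht', fun i => ha i t ht', fun i => hf i t ht', fun i => hτ i t ht']
  · exact fun hS => ⟨hS.gaussDefect_eq_zero hρ ht hext h𝒜 hq hR,
      hS.ampereDefect_eq_zero hρ ht hext h𝒜 hq hR, hS.forceDefect_eq_zero hρ ht hext h𝒜 hq hR,
      hS.torqueDefect_eq_zero hρ ht hext h𝒜 hq hR⟩
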